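/- **Setting.** Let $k$ be a field, $A$ a unital $k$-algebra and $(\Omega^1,\mathrm d)$ a first order differential calculus on $A$: an $A$-bimodule $\Omega^1$ with a $k$-linear derivation $\mathrm d:A\to\Omega^1$ such that $\Omega^1$ is spanned by the elements $a\,\mathrm db$. Suppose that a finite family $\{\omega_i\}_{i\in I}$ is a basis of $\Omega^1$ both as a left and as a right $A$-module, and write (summing over repeated indices) $$\omega_jf=C_{ij}(f)\,\omega_i,\qquad f\omega_j=\omega_i\,C^{-1}_{ij}(f),\qquad \mathrm df=\omega_i\,\partial^R_i(f)\qquad(f\in A).$$ Suppose that $\Omega^1$ is pivotal with respect to this basis, i.e. there is an $A$-bimodule $\mathfrak X$, elements $x_i\in\mathfrak X$ $(i\in I)$ and bimodule maps $\mathrm{ev}^L:\mathfrak X\otimes_A\Omega^1\to A$, $\mathrm{ev}^R:\Omega^1\otimes_A\mathfrak X\to A$ which make $\mathfrak X$ both a left and a right dual of $\Omega^1$, with coevaluations $\mathrm{coev}^L(1)=\omega_i\otimes x_i$ and $\mathrm{coev}^R(1)=x_i\otimes\omega_i$ (so $\mathrm{ev}^L(x_i,\omega_j)=\delta_{ij}=\mathrm{ev}^R(\omega_i,x_j)$).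 **The Hopf algebroid $\mathcal{IIL}(\Omega^1)$.** It is the $k$-algebra generated by $a\in A$, $\underline a$ for $a\in A$, $x\in\mathfrak X$, $(x,\xi)\in\mathfrak X\otimes\Omega^1$ and $(\xi,y)\in\Omega^1\otimes\mathfrak X$ (all $k$-linear in the entries), with product $\bullet$ and relations: $a\mapsto a$ and $a\mapsto\underline a$ are algebra maps from $A$ and $A^{op}$ with commuting images; $$a\bullet x=ax,\quad x\bullet a=xa+\mathrm{ev}^L(x,\mathrm da),\quad x\bullet\underline a=\underline a\bullet x+(x,\mathrm da),$$ $$a\bullet(x,\xi)=(ax,\xi),\quad (x,\xi)\bullet a=(xa,\xi),\quad \underline a\bullet(x,\xi)=(x,\xi a),\quad (x,\xi)\bullet\underline a=(x,a\xi),$$ $$a\bullet(\xi,y)=(a\xi,y),\quad (\xi,y)\bullet a=(\xi a,y),\quad \underline a\bullet(\xi,y)=(\xi,ya),\quad (\xi,y)\bullet\underline a=(\xi,ay),$$ $$(\omega_i,y)\bullet(x_i,\xi)=\underline{\mathrm{ev}^R(\xi,y)},\qquad (x,\omega_i)\bullet(\xi,x_i)=\mathrm{ev}^L(x,\xi),$$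 $$(x_i,\xi)\bullet(\omega_i,x)=\underline{\mathrm{ev}^L(x,\xi)},\qquad (\xi,x_i)\bullet(x,\omega_i)=\mathrm{ev}^R(\xi,x).$$ It carries source $s(a)=a$, target $t(a)=\underline a$ and $$\Delta x=x\otimes1+(x,\omega_i)\otimes x_i,\quad \Delta(x,\xi)=(x,\omega_i)\otimes(x_i,\xi),\quad \Delta(\xi,y)=(\xi,x_i)\otimes(\omega_i,y),$$ $$\varepsilon(x)=0,\quad \varepsilon(x,\xi)=\mathrm{ev}^L(x,\xi),\quad \varepsilon(\xi,y)=\mathrm{ev}^R(\xi,y).$$ Throughout, a Hopf algebroid over $A$ is a left bialgebroid $L$ over $A$ whose Galois map $\lambda:L\otimes_{A^{op}}L\to L\otimes_AL$, $X\otimes Y\mapsto X_{(1)}\otimes X_{(2)}Y$, is bijective; an isomorphism of Hopf algebroids is an algebra isomorphism compatible with $s,t,\Delta,\varepsilon$. **Proposition.** 1. The $k$-algebra $H=k\langle x_i,t_{ij},\underline t_{ij}\rangle$ generated by $x_i,t_{ij},\underline t_{ij}$ $(i,j\in I)$ with relations $$t_{ij}\underline t_{kj}=\delta_{ik},\quad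 \underline t_{ij}t_{ik}=\delta_{jk},\quad t_{ji}\underline t_{jk}=\delta_{ik},\quad \underline t_{ij}t_{kj}=\delta_{ik}$$ is a Hopf algebra over $k$ with $$\Delta x_i=x_i\otimes1+t_{ij}\otimes x_j,\quad \Delta t_{ij}=t_{ik}\otimes t_{kj},\quad \Delta\underline t_{ij}=\underline t_{ik}\otimes\underline t_{kj},\quad \varepsilon(x_i)=0,\quad \varepsilon(t_{ij})=\varepsilon(\underline t_{ij})=\delta_{ij},$$ $$St_{ij}=\underline t_{ji},\qquad S\underline t_{ij}=t_{ji},\qquad Sx_i=-\underline t_{ji}x_j .$$ 2. $A$ is a left $H$-module algebra by $x_i\triangleright f=\partial^R_i(f)$, $t_{ij}\triangleright f=C^{-1}_{ij}(f)$, $\underline t_{ij}\triangleright f=C_{ji}(f)$. 3. $\mathcal{IIL}(\Omega^1)$, with the above structure, is a Hopf algebroid over $A$. There is an algebra map $j:H\to\mathcal{IIL}(\Omega^1)$ with $j(x_i)=x_i$, $j(t_{ij})=(x_i,\omega_j)$, $j(\underline t_{ij})=(\omega_i,x_j)$, and it is injective if $A\neq0$; thus $H\subset\mathcal{IIL}(\Omega^1)$.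 4. Let $A^e\#H$ be the vector space $A\otimes A\otimes H$ with (Sweedler notation) $$(b\otimes b'\#h)(c\otimes c'\#g)=b(h_{(1)}\triangleright c)\otimes c'(Sg_{(2)}\triangleright b')\#h_{(2)}g_{(1)},$$ $$s(b)=b\otimes1\#1,\quad t(b)=1\otimes b\#1,\quad \Delta(b\otimes b'\#h)=(b\otimes1\#h_{(1)})\otimes_A(1\otimes b'\#h_{(2)}),\quad \varepsilon(b\otimes b'\#h)=b(h\triangleright b')$$ (the cocycle Hopf algebroid with trivial cocycle). This is a Hopf algebroid over $A$, and $b\otimes b'\#h\mapsto b\bullet j(h)\bullet\underline{b'}$ is an isomorphism of Hopf algebroids $A^e\#H\cong\mathcal{IIL}(\Omega^1)$. 5. Let $P=A\#H$ be the smash product, with $(a\#h)(b\#g)=a(h_{(1)}\triangleright b)\#h_{(2)}g$, and the right $H$-coaction $a\#h\mapsto a\#h_{(1)}\otimes h_{(2)}$, also written $p\mapsto p_{(0)}\otimes p_{(1)}$. Then $P$ is an $H$-comodule algebra and $A\subseteq P$, $a\mapsto a\#1$, is a Hopf–Galois extension (in particular $A=P^{coH}$) for which $P$ is faithfully flat as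 a left $A$-module. The Ehresmann–Schauenburg algebra $$\mathcal L(P,H)=\{\textstyle\sum p\otimes q\in P\otimes P^{op}\mid \sum p_{(0)}\otimes q_{(0)}\otimes p_{(1)}q_{(1)}=\sum p\otimes q\otimes1\}$$ with $s(b)=b\otimes1$, $t(b)=1\otimes b$, $\varepsilon(p\otimes q)=pq$, $\Delta(p\otimes q)=p_{(0)}\otimes\tau(p_{(1)})\otimes q$, where $\tau:H\to P\otimes_AP$ is the translation map (the inverse of the canonical map $q\otimes p\mapsto qp_{(0)}\otimes p_{(1)}$ restricted to $1\otimes H$), is a Hopf algebroid over $A$, and $A^e\#H\cong\mathcal L(A\#H,H)$ as Hopf algebroids. -/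

import Mathlib

open scoped TensorProduct

/-! ### The Hopf algebra `H` -/

/-- The generators `x_i`, `t_ij` and `u_ij` of the algebra `H`. -/
inductive HGen (I : Type*) where
  | x (i : I)
  | t (i j : I)
  | u (i j : I)

/-- The defining relations of `H`: `t_ij u_mj = δ_im`, `u_ij t_im = δ_jm`, `t_ji u_jm = δ_im` and
`u_ij t_mj = δ_im`, summed over repeated indices. -/
inductive HRel (k : Type*) [Field k] (I : Type*) [Fintype I] [DecidableEq I] :
    FreeAlgebra k (HGen I) → FreeAlgebra k (HGen I) → Prop
  | t_mul_u (i m : I) : HRel k I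
      (∑ j, FreeAlgebra.ι k (.t i j) * FreeAlgebra.ι k (.u m j)) (if i = m then 1 else 0)
  | u_mul_t (j m : I) : HRel k I
      (∑ i, FreeAlgebra.ι k (.u i j) * FreeAlgebra.ι k (.t i m)) (if j = m then 1 else 0)
  | t_mul_u' (i m : I) : HRel k I
      (∑ j, FreeAlgebra.ι k (.t j i) * FreeAlgebra.ι k (.u j m)) (if i = m then 1 else 0)
  | u_mul_t' (i m : I) : HRel k I
      (∑ j, FreeAlgebra.ι k (.u i j) * FreeAlgebra.ι k (.t m j)) (if i = m then 1 else 0)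

/-- The algebra `H` generated by the `x_i`, `t_ij` and `u_ij`, where `u_ij = S t_ji`. -/
def HAlg (k : Type*) [Field k] (I : Type*) [Fintype I] [DecidableEq I] : Type _ :=
  RingQuot (HRel k I)

namespace HAlg
variable {k : Type*} [Field k] {I : Type*} [Fintype I] [DecidableEq I]

noncomputable instance : Ring (HAlg k I) := inferInstanceAs (Ring (RingQuot (HRel k I)))
noncomputable instance : Algebra k (HAlg k I) := inferInstanceAs (Algebra k (RingQuot (HRel k I)))

variable (k I) in
/-- The quotient map. -/
noncomputable def mk : FreeAlgebra k (HGen I) →ₐ[k] HAlg k I := RingQuot.mkAlgHom k (HRel k I)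

variable (k) in
/-- The generator `x_i`. -/
noncomputable def x (i : I) : HAlg k I := mk k I (FreeAlgebra.ι k (.x i))
variable (k) in
/-- The generator `t_ij`. -/
noncomputable def t (i j : I) : HAlg k I := mk k I (FreeAlgebra.ι k (.t i j))
variable (k) in
/-- The generator `u_ij`. -/
noncomputable def u (i j : I) : HAlg k I := mk k I (FreeAlgebra.ι k (.u i j))

theorem sum_t_u (i m : I) : ∑ j, t k i j * u k m j = if i = m then 1 else 0 := by
  have h : mk k I _ = mk k I _ := RingQuot.mkAlgHom_rel k (HRel.t_mul_u (k := k) i m)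
  rw [apply_ite (mk k I), map_one, map_zero] at h
  rw [← h]; simp [t, u]

theorem sum_u_t (j m : I) : ∑ i, u k i j * t k i m = if j = m then 1 else 0 := by
  have h : mk k I _ = mk k I _ := RingQuot.mkAlgHom_rel k (HRel.u_mul_t (k := k) j m)
  rw [apply_ite (mk k I), map_one, map_zero] at h
  rw [← h]; simp [t, u]

theorem sum_t_u' (i m : I) : ∑ j, t k j i * u k j m = if i = m then 1 else 0 := by
  have h : mk k I _ = mk k I _ := RingQuot.mkAlgHom_rel k (HRel.t_mul_u' (k := k) i m)
  rw [apply_ite (mk k I), map_one, map_zero] at h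
  rw [← h]; simp [t, u]

theorem sum_u_t' (i m : I) : ∑ j, u k i j * t k m j = if i = m then 1 else 0 := by
  have h : mk k I _ = mk k I _ := RingQuot.mkAlgHom_rel k (HRel.u_mul_t' (k := k) i m)
  rw [apply_ite (mk k I), map_one, map_zero] at h
  rw [← h]; simp [t, u]

/-- The universal property of `H`. -/
noncomputable def lift {B : Type*} [Semiring B] [Algebra k B] (X : I → B) (T U : I → I → B)
    (h₁ : ∀ i m, ∑ j, T i j * U m j = if i = m then 1 else 0)
    (h₂ : ∀ j m, ∑ i, U i j * T i m = if j = m then 1 else 0)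
    (h₃ : ∀ i m, ∑ j, T j i * U j m = if i = m then 1 else 0)
    (h₄ : ∀ i m, ∑ j, U i j * T m j = if i = m then 1 else 0) : HAlg k I →ₐ[k] B :=
  RingQuot.liftAlgHom k ⟨FreeAlgebra.lift k fun
    | .x i => X i
    | .t i j => T i j
    | .u i j => U i j, by
      intro a b h
      cases h with
      | t_mul_u i m => rw [apply_ite (FreeAlgebra.lift k _), map_one, map_zero]; simpa using h₁ i m
      | u_mul_t i m => rw [apply_ite (FreeAlgebra.lift k _), map_one, map_zero]; simpa using h₂ i m
      | t_mul_u' i m => rw [apply_ite (FreeAlgebra.lift k _), map_one, map_zero]; simpa using h₃ i m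
      | u_mul_t' i m => rw [apply_ite (FreeAlgebra.lift k _), map_one, map_zero]; simpa using h₄ i m⟩

section
variable {B : Type*} [Semiring B] [Algebra k B] (X : I → B) (T U : I → I → B)
    (h₁ : ∀ i m, ∑ j, T i j * U m j = if i = m then 1 else 0)
    (h₂ : ∀ j m, ∑ i, U i j * T i m = if j = m then 1 else 0)
    (h₃ : ∀ i m, ∑ j, T j i * U j m = if i = m then 1 else 0)
    (h₄ : ∀ i m, ∑ j, U i j * T m j = if i = m then 1 else 0)

@[simp] theorem lift_x (i : I) : lift X T U h₁ h₂ h₃ h₄ (x k i) = X i := 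
  (RingQuot.liftAlgHom_mkAlgHom_apply k _ _ _).trans (by simp)
@[simp] theorem lift_t (i j : I) : lift X T U h₁ h₂ h₃ h₄ (t k i j) = T i j := 
  (RingQuot.liftAlgHom_mkAlgHom_apply k _ _ _).trans (by simp)
@[simp] theorem lift_u (i j : I) : lift X T U h₁ h₂ h₃ h₄ (u k i j) = U i j := 
  (RingQuot.liftAlgHom_mkAlgHom_apply k _ _ _).trans (by simp)
end

theorem algHom_ext {B : Type*} [Semiring B] [Algebra k B] {f g : HAlg k I →ₐ[k] B}
    (hx : ∀ i, f (x k i) = g (x k i)) (ht : ∀ i j, f (t k i j) = g (t k i j))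
    (hu : ∀ i j, f (u k i j) = g (u k i j)) : f = g := by
  apply RingQuot.ringQuot_ext'
  ext a
  cases a with
  | x i => exact hx i
  | t i j => exact ht i j
  | u i j => exact hu i j

theorem adjoin_eq_top : Algebra.adjoin k
    ((Set.range (x k : I → HAlg k I)) ∪ (Set.range fun p : I × I => t k p.1 p.2) ∪
      (Set.range fun p : I × I => u k p.1 p.2)) = ⊤ := by
  set S := Algebra.adjoin k
    ((Set.range (x k : I → HAlg k I)) ∪ (Set.range fun p : I × I => t k p.1 p.2) ∪
      (Set.range fun p : I × I => u k p.1 p.2)) with hS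
  have hx : ∀ i, x k i ∈ S := fun i => Algebra.subset_adjoin (by simp)
  have ht : ∀ i j, t k i j ∈ S := fun i j => Algebra.subset_adjoin
    (Or.inl (Or.inr ⟨(i, j), rfl⟩))
  have hu : ∀ i j, u k i j ∈ S := fun i j => Algebra.subset_adjoin (Or.inr ⟨(i, j), rfl⟩)
  let f : HAlg k I →ₐ[k] S := lift (B := S) (fun i => ⟨x k i, hx i⟩) (fun i j => ⟨t k i j, ht i j⟩)
    (fun i j => ⟨u k i j, hu i j⟩)
    (fun i m => by apply Subtype.ext; simpa [apply_ite Subtype.val] using sum_t_u i m)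
    (fun i m => by apply Subtype.ext; simpa [apply_ite Subtype.val] using sum_u_t i m)
    (fun i m => by apply Subtype.ext; simpa [apply_ite Subtype.val] using sum_t_u' i m)
    (fun i m => by apply Subtype.ext; simpa [apply_ite Subtype.val] using sum_u_t' i m)
  have hf : S.val.comp f = AlgHom.id k _ := algHom_ext (by simp [f]) (by simp [f]) (by simp [f])
  rw [eq_top_iff]
  intro a _
  have := congr($hf a)
  simp only [AlgHom.comp_apply, AlgHom.id_apply] at this
  rw [← this]
  exact (f a).2

theorem comul_rel_row {B : Type*} [Semiring B] [Algebra k B] (T U : I → I → B)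
    (h : ∀ i m, ∑ j, T i j * U m j = if i = m then 1 else 0) (i m : I) :
    ∑ j, (∑ p, T i p ⊗ₜ[k] T p j) * (∑ q, U m q ⊗ₜ[k] U q j) = if i = m then 1 else 0 := by
  calc _ = ∑ p, ∑ q, (T i p * U m q) ⊗ₜ[k] (∑ j, T p j * U q j) := by
        simp only [Finset.sum_mul_sum, Algebra.TensorProduct.tmul_mul_tmul, TensorProduct.tmul_sum]
        rw [Finset.sum_comm]
        exact Finset.sum_congr rfl fun p _ => Finset.sum_comm
    _ = (∑ p, T i p * U m p) ⊗ₜ[k] (1 : B) := by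
        rw [TensorProduct.sum_tmul]; simp [h, TensorProduct.tmul_ite]
    _ = _ := by
        rw [h]; split_ifs <;> simp [Algebra.TensorProduct.one_def]

theorem comul_rel_col {B : Type*} [Semiring B] [Algebra k B] (T U : I → I → B)
    (h : ∀ j m, ∑ i, U i j * T i m = if j = m then 1 else 0) (j m : I) :
    ∑ i, (∑ p, U i p ⊗ₜ[k] U p j) * (∑ q, T i q ⊗ₜ[k] T q m) = if j = m then 1 else 0 := by
  calc _ = ∑ p, ∑ q, (∑ i, U i p * T i q) ⊗ₜ[k] (U p j * T q m) := by
        simp only [Finset.sum_mul_sum, Algebra.TensorProduct.tmul_mul_tmul, TensorProduct.sum_tmul]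
        rw [Finset.sum_comm]
        exact Finset.sum_congr rfl fun p _ => Finset.sum_comm
    _ = (1 : B) ⊗ₜ[k] (∑ p, U p j * T p m) := by
        rw [TensorProduct.tmul_sum]; simp [h, TensorProduct.ite_tmul]
    _ = _ := by
        rw [h]; split_ifs <;> simp [Algebra.TensorProduct.one_def]

/-- `Δ x_i = x_i ⊗ 1 + t_ij ⊗ x_j`, `Δ t_ij = t_im ⊗ t_mj`, `Δ u_ij = u_im ⊗ u_mj`. -/
noncomputable def comulHom : HAlg k I →ₐ[k] HAlg k I ⊗[k] HAlg k I :=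
  lift (fun i => x k i ⊗ₜ 1 + ∑ j, t k i j ⊗ₜ x k j)
    (fun i j => ∑ m, t k i m ⊗ₜ t k m j) (fun i j => ∑ m, u k i m ⊗ₜ u k m j)
    (comul_rel_row _ _ sum_t_u) (comul_rel_col _ _ sum_u_t)
    (comul_rel_col _ _ sum_t_u') (comul_rel_row _ _ sum_u_t')

/-- `ε x_i = 0`, `ε t_ij = δ_ij`, `ε u_ij = δ_ij`. -/
noncomputable def counitHom : HAlg k I →ₐ[k] k :=
  lift (fun _ => 0) (fun i j => if i = j then 1 else 0) (fun i j => if i = j then 1 else 0)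
    (by intro i m; simp) (by intro i m; simp [eq_comm]) (by intro i m; simp [eq_comm])
    (by intro i m; simp)

/-- `S x_i = - u_ji x_j`, `S t_ij = u_ji`, `S u_ij = t_ji`, as an algebra map to the opposite algebra. -/
noncomputable def antipodeHom : HAlg k I →ₐ[k] (HAlg k I)ᵐᵒᵖ :=
  lift (fun i => .op (-∑ j, u k j i * x k j)) (fun i j => .op (u k j i)) (fun i j => .op (t k j i))
    (fun i m => by
      apply MulOpposite.unop_injective
      simpa [apply_ite MulOpposite.unop, eq_comm] using sum_t_u' m i)
    (fun i m => by
      apply MulOpposite.unop_injective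
      simpa [apply_ite MulOpposite.unop, eq_comm] using sum_u_t' m i)
    (fun i m => by
      apply MulOpposite.unop_injective
      simpa [apply_ite MulOpposite.unop, eq_comm] using sum_t_u m i)
    (fun i m => by
      apply MulOpposite.unop_injective
      simpa [apply_ite MulOpposite.unop, eq_comm] using sum_u_t m i)

theorem comulHom_x (i : I) : comulHom (x k i) = x k i ⊗ₜ 1 + ∑ j, t k i j ⊗ₜ x k j := by
  simp [comulHom]
theorem comulHom_t (i j : I) : comulHom (t k i j) = ∑ m, t k i m ⊗ₜ t k m j := by
  simp [comulHom]
theorem comulHom_u (i j : I) : comulHom (u k i j) = ∑ m, u k i m ⊗ₜ u k m j := by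
  simp [comulHom]

noncomputable instance : Bialgebra k (HAlg k I) :=
  Bialgebra.ofAlgHom comulHom counitHom
    (by
      apply algHom_ext
      · intro i
        simp [comulHom_x, comulHom_t, TensorProduct.add_tmul, TensorProduct.tmul_add,
          TensorProduct.sum_tmul, TensorProduct.tmul_sum, Algebra.TensorProduct.one_def,
          Finset.sum_add_distrib, add_assoc]
        exact Finset.sum_comm
      · intro i j
        simp [comulHom_t, TensorProduct.sum_tmul, TensorProduct.tmul_sum]
        exact Finset.sum_comm
      · intro i j
        simp [comulHom_u, TensorProduct.sum_tmul, TensorProduct.tmul_sum]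
        exact Finset.sum_comm)
    (by
      apply algHom_ext <;> intros <;>
        simp [comulHom_x, comulHom_t, comulHom_u, counitHom, TensorProduct.ite_tmul])
    (by
      apply algHom_ext <;> intros <;>
        simp [comulHom_x, comulHom_t, comulHom_u, counitHom, TensorProduct.tmul_ite])

theorem induct (p : HAlg k I → Prop) (hx : ∀ i, p (x k i)) (ht : ∀ i j, p (t k i j))
    (hu : ∀ i j, p (u k i j)) (hk : ∀ r, p (algebraMap k _ r)) (ha : ∀ a b, p a → p b → p (a + b))
    (hm : ∀ a b, p a → p b → p (a * b)) (a : HAlg k I) : p a := by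
  have h : a ∈ Algebra.adjoin k
    ((Set.range (x k : I → HAlg k I)) ∪ (Set.range fun p : I × I => t k p.1 p.2) ∪
      (Set.range fun p : I × I => u k p.1 p.2)) := by rw [adjoin_eq_top]; trivial
  induction h using Algebra.adjoin_induction with
  | mem a ha =>
    rcases ha with (⟨i, rfl⟩ | ⟨i, rfl⟩) | ⟨i, rfl⟩
    exacts [hx i, ht _ _, hu _ _]
  | algebraMap r => exact hk r
  | add a b _ _ h₁ h₂ => exact ha a b h₁ h₂
  | mul a b _ _ h₁ h₂ => exact hm a b h₁ h₂

/-- The antipode as a linear map. -/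
noncomputable def antipodeLin : HAlg k I →ₗ[k] HAlg k I :=
  (MulOpposite.opLinearEquiv k).symm.toLinearMap ∘ₗ (antipodeHom (k := k) (I := I)).toLinearMap

theorem antipodeLin_mul (a b : HAlg k I) :
    antipodeLin (a * b) = antipodeLin b * antipodeLin a := by simp [antipodeLin]
theorem antipodeLin_algebraMap (r : k) :
    antipodeLin (algebraMap k (HAlg k I) r) = algebraMap k _ r := by
  simp [antipodeLin, MulOpposite.algebraMap_apply]
theorem antipodeLin_x (i : I) : antipodeLin (x k i) = -∑ j, u k j i * x k j := by
  simp [antipodeLin, antipodeHom]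
theorem antipodeLin_t (i j : I) : antipodeLin (t k i j) = u k j i := by
  simp [antipodeLin, antipodeHom]
theorem antipodeLin_u (i j : I) : antipodeLin (u k i j) = t k j i := by
  simp [antipodeLin, antipodeHom]
theorem antipodeLin_one : antipodeLin (1 : HAlg k I) = 1 := by
  simp [antipodeLin]

theorem comul_eq (a : HAlg k I) : Coalgebra.comul (R := k) a = comulHom a := rfl
theorem counit_eq (a : HAlg k I) : Coalgebra.counit (R := k) a = counitHom a := rfl

theorem mul_antipode_left (a : HAlg k I) :
    LinearMap.mul' k _ (antipodeLin.rTensor _ (comulHom a)) = algebraMap k _ (counitHom a) := by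
  induction a using induct with
  | hx i => simp [comulHom_x, antipodeLin_x, antipodeLin_t, counitHom]
  | ht i j => simp [comulHom_t, antipodeLin_t, counitHom, sum_u_t, apply_ite (algebraMap k _)]
  | hu i j => simp [comulHom_u, antipodeLin_u, counitHom, sum_t_u', apply_ite (algebraMap k _)]
  | hk r =>
    simp [Algebra.TensorProduct.algebraMap_apply, antipodeLin_algebraMap]
  | ha a b h₁ h₂ => simp [h₁, h₂]
  | hm a b h₁ h₂ =>
    have key : ∀ z w : HAlg k I ⊗[k] HAlg k I,
        LinearMap.mul' k _ (antipodeLin.rTensor _ (z * w)) =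
        LinearMap.mul' k _ ((LinearMap.mulLeft k (LinearMap.mul' k _ (antipodeLin.rTensor _ z))).lTensor _
          (antipodeLin.rTensor _ w)) := by
      intro z w
      induction w with
      | zero => simp
      | add w₁ w₂ e₁ e₂ => simp only [mul_add, map_add, e₁, e₂]
      | tmul c d =>
        induction z with
        | zero => simp
        | add z₁ z₂ e₁ e₂ =>
          simp only [add_mul, map_add, e₁, e₂]
          simp [add_mul, mul_add]
        | tmul p q => simp [antipodeLin_mul, mul_assoc]
    rw [map_mul, key, h₁, map_mul, map_mul, ← h₂]
    generalize comulHom b = w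
    induction w with
    | zero => simp
    | add w₁ w₂ e₁ e₂ => simp only [mul_add, map_add, e₁, e₂]
    | tmul c d =>
      simp [Algebra.left_comm]

theorem mul_antipode_right (a : HAlg k I) :
    LinearMap.mul' k _ (antipodeLin.lTensor _ (comulHom a)) = algebraMap k _ (counitHom a) := by
  induction a using induct with
  | hx i =>
    simp only [comulHom_x, map_add, map_sum, LinearMap.lTensor_tmul, LinearMap.mul'_apply,
      antipodeLin_one, mul_one, antipodeLin_x, mul_neg, Finset.mul_sum, Finset.sum_neg_distrib]
    rw [Finset.sum_comm]
    simp [← mul_assoc, ← Finset.sum_mul, sum_t_u, counitHom]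
  | ht i j => simp [comulHom_t, antipodeLin_t, counitHom, sum_t_u, apply_ite (algebraMap k _)]
  | hu i j => simp [comulHom_u, antipodeLin_u, counitHom, sum_u_t', apply_ite (algebraMap k _)]
  | hk r =>
    simp [Algebra.TensorProduct.algebraMap_apply, antipodeLin_one]
  | ha a b h₁ h₂ => simp [h₁, h₂]
  | hm a b h₁ h₂ =>
    have key : ∀ z w : HAlg k I ⊗[k] HAlg k I,
        LinearMap.mul' k _ (antipodeLin.lTensor _ (z * w)) =
        LinearMap.mul' k _ ((LinearMap.mulRight k (LinearMap.mul' k _ (antipodeLin.lTensor _ w))).rTensor _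
          (antipodeLin.lTensor _ z)) := by
      intro z w
      induction z with
      | zero => simp
      | add w₁ w₂ e₁ e₂ => simp only [add_mul, map_add, e₁, e₂]
      | tmul c d =>
        induction w with
        | zero => simp
        | add z₁ z₂ e₁ e₂ =>
          simp only [mul_add, map_add, e₁, e₂]
          simp [add_mul, mul_add]
        | tmul p q => simp [antipodeLin_mul, mul_assoc]
    rw [map_mul, key, h₂, map_mul, map_mul, ← h₁]
    generalize comulHom a = w
    induction w with
    | zero => simp
    | add w₁ w₂ e₁ e₂ => simp only [add_mul, map_add, e₁, e₂]
    | tmul c d =>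
      simp [mul_assoc, Algebra.commutes]

noncomputable instance : HopfAlgebra k (HAlg k I) where
  antipode := antipodeLin
  mul_antipode_rTensor_comul := LinearMap.ext mul_antipode_left
  mul_antipode_lTensor_comul := LinearMap.ext mul_antipode_right

end HAlg

universe u

section
variable {k H : Type*} [Field k] [Ring H] [HopfAlgebra k H]
open Coalgebra HopfAlgebra

theorem antipode_tmul_one_mul_comul (y : H) :
    TensorProduct.lift (LinearMap.mk₂ k (fun a b : H => (antipode k a ⊗ₜ[k] (1 : H)) * comul b)
      (by intros; simp [TensorProduct.add_tmul, add_mul])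
      (by intros; simp [← TensorProduct.smul_tmul'])
      (by intros; simp [mul_add]) (by intros; simp)) (comul (R := k) y) = 1 ⊗ₜ y := by
  let Ξ : H ⊗[k] (H ⊗[k] H) →ₗ[k] H ⊗[k] H :=
    (LinearMap.rTensor H (LinearMap.mul' k H ∘ₗ (antipode k).rTensor H)) ∘ₗ
      (TensorProduct.assoc k H H H).symm.toLinearMap
  have h1 : ∀ (a : H) (w : H ⊗[k] H), (antipode k a ⊗ₜ[k] (1 : H)) * w = Ξ (a ⊗ₜ w) := by
    intro a w
    induction w with
    | zero => simp
    | add p q hp hq => simp [mul_add, hp, hq, TensorProduct.tmul_add]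
    | tmul p q => simp [Ξ]
  have h2 : ∀ z : H ⊗[k] H,
      TensorProduct.lift (LinearMap.mk₂ k (fun a b : H => (antipode k a ⊗ₜ[k] (1 : H)) * comul b)
      (by intros; simp [TensorProduct.add_tmul, add_mul])
      (by intros; simp [← TensorProduct.smul_tmul'])
      (by intros; simp [mul_add]) (by intros; simp)) z = Ξ (comul.lTensor H z) := by
    intro z
    induction z with
    | zero => simp
    | add p q hp hq => simp only [map_add, hp, hq]
    | tmul p q => simp [h1]
  rw [h2, ← coassoc_apply]
  simp only [Ξ, LinearMap.comp_apply, LinearEquiv.coe_coe, LinearEquiv.symm_apply_apply]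
  rw [← LinearMap.comp_apply (LinearMap.rTensor H _), ← LinearMap.rTensor_comp,
    LinearMap.comp_assoc, mul_antipode_rTensor_comul, LinearMap.rTensor_comp,
    LinearMap.comp_apply, rTensor_counit_comul]
  simp

theorem comul_antipode (h : H) :
    comul (R := k) (antipode k h) =
      TensorProduct.map (antipode k) (antipode k)
        (TensorProduct.comm k H H (comul (R := k) h)) := by
  have hl : WithConv.toConv (TensorProduct.map (antipode k) (antipode k) ∘ₗ
      (TensorProduct.comm k H H).toLinearMap ∘ₗ (comul (R := k) (A := H))) *
      WithConv.toConv (comul (R := k) (A := H)) = 1 := by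
    ext c
    let Θ : H ⊗[k] (H ⊗[k] H) →ₗ[k] H ⊗[k] H :=
      LinearMap.mul' k (H ⊗[k] H) ∘ₗ TensorProduct.map
        (TensorProduct.map (antipode k) (antipode k) ∘ₗ
          (TensorProduct.comm k H H).toLinearMap) comul ∘ₗ
        (TensorProduct.assoc k H H H).symm.toLinearMap
    have h1 : ∀ (a y : H), Θ (a ⊗ₜ comul (R := k) y) = 1 ⊗ₜ (antipode k a * y) := by
      intro a y
      rw [show (1 : H) ⊗ₜ[k] (antipode k a * y) = (1 ⊗ₜ antipode k a) * (1 ⊗ₜ y) by simp,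
        ← antipode_tmul_one_mul_comul y]
      generalize comul (R := k) y = w
      induction w with
      | zero => simp
      | add p q hp hq => simp only [map_add, TensorProduct.tmul_add, hp, hq, mul_add]
      | tmul p q => simp [Θ, ← mul_assoc]
    have h2 : ∀ z : H ⊗[k] H, Θ (comul.lTensor H z) =
        1 ⊗ₜ (LinearMap.mul' k H ((antipode k).rTensor H z)) := by
      intro z
      induction z with
      | zero => simp
      | add p q hp hq => simp only [map_add, TensorProduct.tmul_add, hp, hq]
      | tmul p q => simp [h1]
    have h3 := h2 (comul c)
    rw [← coassoc_apply] at h3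
    simp only [mul_antipode_rTensor_comul_apply] at h3
    have h4 : ∀ z : H ⊗[k] H, Θ (TensorProduct.assoc k H H H (comul.rTensor H z)) =
       LinearMap.mul' k (H ⊗[k] H) (TensorProduct.map (TensorProduct.map (antipode k) (antipode k) ∘ₗ
      (TensorProduct.comm k H H).toLinearMap ∘ₗ (comul (R := k) (A := H))) comul z) := by
      intro z
      induction z with
      | zero => simp
      | add p q hp hq => simp only [map_add, hp, hq]
      | tmul p q => simp [Θ]
    rw [h4] at h3
    rw [LinearMap.convMul_apply, LinearMap.convOne_apply]
    refine Eq.trans h3 ?_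
    simp [Algebra.algebraMap_eq_smul_one, Algebra.TensorProduct.one_def]
  have := left_inv_eq_right_inv hl (LinearMap.comul_right_inv (R := k) (C := H))
  have := congr(WithConv.ofConv $this h)
  exact this.symm
end

/-- A left `H`-module algebra structure on `A`: an action with `h ▷ (a b) = (h₁ ▷ a) (h₂ ▷ b)` and
`h ▷ 1 = ε(h) 1`. -/
structure HopfModuleAlgebra (k H A : Type*) [Field k] [Ring H] [HopfAlgebra k H] [Ring A]
    [Algebra k A] where
  act : H →ₐ[k] Module.End k A
  act_mul : ∀ h a b, act h (a * b) = LinearMap.mul' k A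
    (TensorProduct.map (act.toLinearMap.flip a) (act.toLinearMap.flip b) (Coalgebra.comul h))
  act_one : ∀ h, act h 1 = algebraMap k A (Coalgebra.counit h)

namespace HopfModuleAlgebra
variable {k H A : Type*} [Field k] [Ring H] [HopfAlgebra k H] [Ring A] [Algebra k A]
  (𝒜 : HopfModuleAlgebra k H A)
open Coalgebra HopfAlgebra

section
variable {M : Type*} [AddCommGroup M] [Module k M]

variable (k A M) in
/-- `a` acts on `A ⊗ M` by left multiplication on the first factor. -/
noncomputable def leftMul : A →ₐ[k] Module.End k (A ⊗[k] M) :=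
  (Module.endTensorEndAlgHom (R := k) (A := k) (M := A) (N := M)).comp
    (Algebra.TensorProduct.includeLeft.comp (Algebra.lmul k A))

/-- `h` acts on `A ⊗ M` by `a ⊗ m ↦ (h₁ ▷ a) ⊗ ρ(h₂) m`. -/
noncomputable def diagAct (ρ : H →ₐ[k] Module.End k M) : H →ₐ[k] Module.End k (A ⊗[k] M) :=
  (Module.endTensorEndAlgHom (R := k) (A := k) (M := A) (N := M)).comp
    ((Algebra.TensorProduct.map 𝒜.act ρ).comp (Bialgebra.comulAlgHom k H))

theorem leftMul_tmul (a c : A) (m : M) : leftMul k A M a (c ⊗ₜ m) = (a * c) ⊗ₜ m :=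
  rfl

theorem diagAct_tmul (ρ : H →ₐ[k] Module.End k M) (h : H) (c : A) (m : M) :
    𝒜.diagAct ρ h (c ⊗ₜ m) =
      TensorProduct.map (𝒜.act.toLinearMap.flip c) (ρ.toLinearMap.flip m) (comul h) := by
  simp only [diagAct, AlgHom.comp_apply, Bialgebra.comulAlgHom_apply]
  generalize comul (R := k) h = w
  induction w with
  | zero => simp
  | add p q hp hq => simp only [map_add, LinearMap.add_apply, hp, hq]
  | tmul p q => rfl

theorem diagAct_one_tmul (ρ : H →ₐ[k] Module.End k M) (h : H) (m : M) :
    𝒜.diagAct ρ h ((1 : A) ⊗ₜ m) = 1 ⊗ₜ ρ h m := by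
  rw [diagAct_tmul]
  have h1 : 𝒜.act.toLinearMap.flip (1 : A) = Algebra.linearMap k A ∘ₗ counit := by
    ext h; simp [act_one]
  have h2 : ∀ z : H ⊗[k] H, TensorProduct.map (𝒜.act.toLinearMap.flip (1 : A)) (ρ.toLinearMap.flip m) z
      = TensorProduct.map (Algebra.linearMap k A) (ρ.toLinearMap.flip m) (counit.rTensor H z) := by
    intro z
    rw [h1, ← LinearMap.comp_apply, LinearMap.rTensor, ← TensorProduct.map_comp, LinearMap.comp_id]
  rw [h2, rTensor_counit_comul]
  simp

theorem diagAct_mul_leftMul (ρ : H →ₐ[k] Module.End k M) (h : H) (a : A) :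
    𝒜.diagAct ρ h * leftMul k A M a =
      LinearMap.mul' k _ (TensorProduct.map
        ((leftMul k A M).toLinearMap ∘ₗ 𝒜.act.toLinearMap.flip a) (𝒜.diagAct ρ).toLinearMap
          (comul h)) := by
  ext c m
  simp only [TensorProduct.AlgebraTensorModule.curry_apply, TensorProduct.curry_apply,
    LinearMap.coe_restrictScalars, Module.End.mul_apply, leftMul_tmul, diagAct_tmul]
  let Ψ : H ⊗[k] (H ⊗[k] H) →ₗ[k] A ⊗[k] M :=
    TensorProduct.map (LinearMap.mul' k A ∘ₗ TensorProduct.map (𝒜.act.toLinearMap.flip a)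
      (𝒜.act.toLinearMap.flip c)) (ρ.toLinearMap.flip m) ∘ₗ (TensorProduct.assoc k H H H).symm.toLinearMap
  have h1 : ∀ z : H ⊗[k] H, TensorProduct.map (𝒜.act.toLinearMap.flip (a * c)) (ρ.toLinearMap.flip m) z
      = Ψ (TensorProduct.assoc k H H H (comul.rTensor H z)) := by
    intro z
    induction z with
    | zero => simp
    | add p q hp hq => simp only [map_add, hp, hq]
    | tmul p q => simp [Ψ, act_mul]
  have h2 : ∀ z : H ⊗[k] H, (LinearMap.mul' k (Module.End k (A ⊗[k] M)) (TensorProduct.map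
        ((leftMul k A M).toLinearMap ∘ₗ 𝒜.act.toLinearMap.flip a) (𝒜.diagAct ρ).toLinearMap
          z)) (c ⊗ₜ m) = Ψ (comul.lTensor H z) := by
    intro z
    induction z with
    | zero => simp
    | add p q hp hq => simp only [map_add, LinearMap.add_apply, hp, hq]
    | tmul p q =>
      simp only [TensorProduct.map_tmul, LinearMap.mul'_apply, Module.End.mul_apply,
        AlgHom.toLinearMap_apply, diagAct_tmul, LinearMap.lTensor_tmul]
      generalize comul (R := k) q = w
      induction w with
      | zero => simp
      | add p q hp hq => simp only [map_add, TensorProduct.tmul_add, hp, hq]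
      | tmul r s => simp [Ψ, leftMul_tmul]
  rw [h1, h2, coassoc_apply]

end

/-! ### Smash product `A # H` -/

/-- The smash product `A # H`, with `(a # h) (b # g) = a (h₁ ▷ b) # h₂ g`. -/
def SmashProduct (_ : HopfModuleAlgebra k H A) : Type _ := A ⊗[k] H

noncomputable instance : AddCommGroup 𝒜.SmashProduct := inferInstanceAs (AddCommGroup (A ⊗[k] H))
noncomputable instance : Module k 𝒜.SmashProduct := inferInstanceAs (Module k (A ⊗[k] H))

namespace SmashProduct

/-- Operator of left multiplication. -/
noncomputable def opr : A ⊗[k] H →ₗ[k] Module.End k (A ⊗[k] H) :=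
  LinearMap.mul' k _ ∘ₗ TensorProduct.map (leftMul k A H).toLinearMap
    (𝒜.diagAct (Algebra.lmul k H)).toLinearMap

theorem opr_opr (x y : A ⊗[k] H) : opr 𝒜 (opr 𝒜 x y) = opr 𝒜 x * opr 𝒜 y := by
  induction x with
  | zero => simp
  | add p q hp hq => simp only [map_add, LinearMap.add_apply, hp, hq, add_mul]
  | tmul a h =>
    induction y with
    | zero => simp
    | add p q hp hq => simp only [map_add, hp, hq, mul_add]
    | tmul b g =>
      have e : opr 𝒜 (a ⊗ₜ h) * opr 𝒜 (b ⊗ₜ g) = leftMul k A H a *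
          (𝒜.diagAct (Algebra.lmul k H) h * leftMul k A H b) *
          𝒜.diagAct (Algebra.lmul k H) g := by simp [opr, mul_assoc]
      rw [e, diagAct_mul_leftMul]
      simp only [opr, LinearMap.comp_apply, TensorProduct.map_tmul, LinearMap.mul'_apply,
        Module.End.mul_apply, AlgHom.toLinearMap_apply, diagAct_tmul]
      generalize comul (R := k) h = w
      induction w with
      | zero => simp
      | add p q hp hq => simp only [map_add, hp, hq, mul_add, add_mul]
      | tmul p q => simp [leftMul_tmul, mul_assoc]

theorem opr_one (x : A ⊗[k] H) : opr 𝒜 x ((1 : A) ⊗ₜ[k] (1 : H)) = x := by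
  induction x with
  | zero => simp
  | add p q hp hq => simp only [map_add, LinearMap.add_apply, hp, hq]
  | tmul a h => simp [opr, diagAct_one_tmul, leftMul_tmul]

noncomputable instance : Ring 𝒜.SmashProduct :=
  { (inferInstance : AddCommGroup 𝒜.SmashProduct) with
    mul := fun x y => opr 𝒜 x y
    one := (1 : A) ⊗ₜ[k] (1 : H)
    left_distrib := fun x y z => map_add (opr 𝒜 x) y z
    right_distrib := fun x y z => congr($(map_add (opr 𝒜) x y) z)
    zero_mul := fun x => congr($(map_zero (opr 𝒜)) x)
    mul_zero := fun x => map_zero (opr 𝒜 x)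
    mul_assoc := fun x y z => congr($(opr_opr 𝒜 x y) z)
    one_mul := fun x => by
      change opr 𝒜 ((1 : A) ⊗ₜ[k] (1 : H)) x = x
      simp only [opr, LinearMap.comp_apply, TensorProduct.map_tmul, AlgHom.toLinearMap_apply,
        map_one, LinearMap.mul'_apply, mul_one]
      rfl
    mul_one := fun x => by
      change opr 𝒜 x ((1 : A) ⊗ₜ[k] (1 : H)) = x
      exact opr_one 𝒜 x }

noncomputable instance : Algebra k 𝒜.SmashProduct :=
  Algebra.ofModule (fun r x y => congr($(map_smul (opr 𝒜) r x) y))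
    (fun r x y => map_smul (opr 𝒜 x) r y)

/-- The element `a # h`. -/
noncomputable def tmul (a : A) (h : H) : 𝒜.SmashProduct := a ⊗ₜ[k] h

theorem tmul_mul_tmul (a b : A) (h g : H) :
    tmul 𝒜 a h * tmul 𝒜 b g =
      ∑ i ∈ (Repr.arbitrary k h).index,
        tmul 𝒜 (a * 𝒜.act ((Repr.arbitrary k h).left i) b) ((Repr.arbitrary k h).right i * g) := by
  change opr 𝒜 (a ⊗ₜ h) (b ⊗ₜ g) = ∑ i ∈ (Repr.arbitrary k h).index, (_ ⊗ₜ _)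
  simp only [opr, LinearMap.comp_apply, TensorProduct.map_tmul, LinearMap.mul'_apply,
        Module.End.mul_apply, AlgHom.toLinearMap_apply, diagAct_tmul]
  conv_lhs => rw [← (Repr.arbitrary k h).eq]
  simp [leftMul_tmul]

end SmashProduct

/-! ### The algebra `A^e # H` -/

/-- `c' ⊗ g ↦ c' (S g ▷ b)`. -/
noncomputable def rightTwist (b : A) : A ⊗[k] H →ₗ[k] A :=
  LinearMap.mul' k A ∘ₗ (𝒜.act.toLinearMap.flip b ∘ₗ antipode k).lTensor A

/-- `c' ⊗ g ↦ c' (S g₂ ▷ b) ⊗ g₁`. -/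
noncomputable def rightAct (b : A) : Module.End k (A ⊗[k] H) :=
  (𝒜.rightTwist b).rTensor H ∘ₗ (TensorProduct.assoc k A H H).symm.toLinearMap ∘ₗ
    ((TensorProduct.comm k H H).toLinearMap ∘ₗ comul).lTensor A

/-- `c' ⊗ g ↦ c' (S g₂ ▷ b) ⊗ g₁`. -/
noncomputable def rightActLin : A →ₗ[k] Module.End k (A ⊗[k] H) where
  toFun := 𝒜.rightAct
  map_add' a b := by
    ext c g
    simp only [rightAct, rightTwist, map_add, LinearMap.add_comp, LinearMap.lTensor_add,
      LinearMap.comp_add, LinearMap.rTensor_add]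
  map_smul' r b := by
    ext c g
    simp only [rightAct, rightTwist, map_smul, LinearMap.smul_comp, LinearMap.lTensor_smul,
      LinearMap.comp_smul, LinearMap.rTensor_smul, RingHom.id_apply]

theorem rightAct_tmul (b c : A) (g : H) :
    𝒜.rightAct b (c ⊗ₜ g) = TensorProduct.map
      (LinearMap.mulLeft k c ∘ₗ 𝒜.act.toLinearMap.flip b ∘ₗ antipode k) (LinearMap.id : H →ₗ[k] H)
        (TensorProduct.comm k H H (comul g)) := by
  simp only [rightAct, LinearMap.comp_apply, LinearMap.lTensor_tmul, LinearEquiv.coe_coe]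
  generalize (TensorProduct.comm k H H) (comul (R := k) g) = w
  induction w with
  | zero => simp
  | add p q hp hq => simp only [map_add, TensorProduct.tmul_add, hp, hq]
  | tmul p q => simp [rightTwist]

theorem act_antipode_mul (h : H) (a b : A) :
    𝒜.act (antipode k h) (a * b) = LinearMap.mul' k A (TensorProduct.map
      (𝒜.act.toLinearMap.flip a ∘ₗ antipode k) (𝒜.act.toLinearMap.flip b ∘ₗ antipode k)
        (TensorProduct.comm k H H (comul h))) := by
  rw [act_mul, comul_antipode, TensorProduct.map_comp, LinearMap.comp_apply]

theorem rightAct_mul (b d : A) : 𝒜.rightAct b * 𝒜.rightAct d = 𝒜.rightAct (d * b) := by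
  ext c g
  simp only [TensorProduct.AlgebraTensorModule.curry_apply, TensorProduct.curry_apply,
    LinearMap.coe_restrictScalars, Module.End.mul_apply, rightAct_tmul]
  let Ψ : H ⊗[k] (H ⊗[k] H) →ₗ[k] A ⊗[k] H :=
    (TensorProduct.comm k H A).toLinearMap ∘ₗ LinearMap.lTensor H
      (LinearMap.mulLeft k c ∘ₗ LinearMap.mul' k A ∘ₗ TensorProduct.map
        (𝒜.act.toLinearMap.flip d ∘ₗ antipode k) (𝒜.act.toLinearMap.flip b ∘ₗ antipode k) ∘ₗ
          (TensorProduct.comm k H H).toLinearMap)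
  have h1 : ∀ z : H ⊗[k] H, 𝒜.rightAct b (TensorProduct.map
      (LinearMap.mulLeft k c ∘ₗ 𝒜.act.toLinearMap.flip d ∘ₗ antipode k) (LinearMap.id : H →ₗ[k] H)
        (TensorProduct.comm k H H z)) = Ψ (TensorProduct.assoc k H H H (comul.rTensor H z)) := by
    intro z
    induction z with
    | zero => simp
    | add p q hp hq => simp only [map_add, hp, hq]
    | tmul p q =>
      simp only [TensorProduct.comm_tmul, TensorProduct.map_tmul, rightAct_tmul,
        LinearMap.rTensor_tmul]
      generalize comul (R := k) ((LinearMap.id : H →ₗ[k] H) p) = w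
      induction w with
      | zero => simp
      | add p q hp hq => simp only [map_add, TensorProduct.add_tmul, hp, hq]
      | tmul r s => simp [Ψ]
  have h2 : ∀ z : H ⊗[k] H, TensorProduct.map
      (LinearMap.mulLeft k c ∘ₗ 𝒜.act.toLinearMap.flip (d * b) ∘ₗ antipode k) (LinearMap.id : H →ₗ[k] H)
        (TensorProduct.comm k H H z) = Ψ (comul.lTensor H z) := by
    intro z
    induction z with
    | zero => simp
    | add p q hp hq => simp only [map_add, hp, hq]
    | tmul p q =>
      simp [Ψ, act_antipode_mul]
  rw [h1, h2, coassoc_apply]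

/-- `h` acts on `A ⊗ (A ⊗ H)` by `c ⊗ c' ⊗ g ↦ (h₁ ▷ c) ⊗ c' ⊗ h₂ g`. -/
noncomputable def leftOp : H →ₐ[k] Module.End k (A ⊗[k] (A ⊗[k] H)) :=
  𝒜.diagAct ((Module.endTensorEndAlgHom (R := k) (A := k) (M := A) (N := H)).comp
    (Algebra.TensorProduct.includeRight.comp (Algebra.lmul k H)))

/-- `b` acts on `A ⊗ (A ⊗ H)` by `c ⊗ c' ⊗ g ↦ c ⊗ c' (S g₂ ▷ b) ⊗ g₁`. -/
noncomputable def rightOp : A →ₗ[k] Module.End k (A ⊗[k] (A ⊗[k] H)) :=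
  LinearMap.lTensorHom A ∘ₗ 𝒜.rightActLin

theorem rightOp_mul (b d : A) : 𝒜.rightOp b * 𝒜.rightOp d = 𝒜.rightOp (d * b) := by
  simp only [rightOp, LinearMap.comp_apply, LinearMap.coe_lTensorHom]
  change _ = LinearMap.lTensor A (𝒜.rightAct (d * b))
  rw [← rightAct_mul]
  exact (LinearMap.lTensor_mul _ _ _).symm

theorem rightOp_mul_leftMul (b c : A) :
    𝒜.rightOp b * leftMul k A (A ⊗[k] H) c = leftMul k A (A ⊗[k] H) c * 𝒜.rightOp b := by
  ext d e
  rfl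

theorem rightOp_mul_leftOp (b : A) (g : H) :
    𝒜.rightOp b * 𝒜.leftOp g = LinearMap.mul' k _ (TensorProduct.map 𝒜.leftOp.toLinearMap
      (𝒜.rightOp ∘ₗ 𝒜.act.toLinearMap.flip b ∘ₗ antipode k) (comul g)) := by
  ext c d f
  simp only [TensorProduct.AlgebraTensorModule.curry_apply, TensorProduct.curry_apply,
    LinearMap.coe_restrictScalars, Module.End.mul_apply]
  let Φ : H ⊗[k] H →ₗ[k] A ⊗[k] H := TensorProduct.map
      (LinearMap.mulLeft k d ∘ₗ 𝒜.act.toLinearMap.flip b ∘ₗ antipode k) (LinearMap.id : H →ₗ[k] H)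
      ∘ₗ (TensorProduct.comm k H H).toLinearMap ∘ₗ
        LinearMap.mulRight k (comul (R := k) f)
  let Ψ : H ⊗[k] (H ⊗[k] H) →ₗ[k] A ⊗[k] (A ⊗[k] H) :=
    TensorProduct.map (𝒜.act.toLinearMap.flip c) Φ
  have h1 : 𝒜.rightOp b (𝒜.leftOp g (c ⊗ₜ (d ⊗ₜ f))) = Ψ (comul.lTensor H (comul g)) := by
    rw [leftOp, diagAct_tmul]
    generalize comul (R := k) g = z
    induction z with
    | zero => simp
    | add p q hp hq => simp only [map_add, hp, hq]
    | tmul p q =>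
      have : 𝒜.rightAct b (d ⊗ₜ (q * f)) = Φ (comul q) := by
        rw [rightAct_tmul, Bialgebra.comul_mul]; rfl
      simp only [TensorProduct.map_tmul, LinearMap.lTensor_tmul, Ψ]
      rw [← this]
      rfl
  have h2 : ∀ z : H ⊗[k] H, LinearMap.mul' k _ (TensorProduct.map 𝒜.leftOp.toLinearMap
      (𝒜.rightOp ∘ₗ 𝒜.act.toLinearMap.flip b ∘ₗ antipode k) z) (c ⊗ₜ (d ⊗ₜ f)) =
      Ψ (TensorProduct.assoc k H H H (comul.rTensor H z)) := by
    intro z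
    induction z with
    | zero => simp
    | add p q hp hq => simp only [map_add, LinearMap.add_apply, hp, hq]
    | tmul p q =>
      simp only [TensorProduct.map_tmul, LinearMap.mul'_apply, Module.End.mul_apply,
        LinearMap.rTensor_tmul]
      change 𝒜.leftOp p (c ⊗ₜ 𝒜.rightAct (𝒜.act (antipode k q) b) (d ⊗ₜ f)) = _
      rw [leftOp, diagAct_tmul, rightAct_tmul]
      generalize comul (R := k) p = w
      induction w with
      | zero => simp
      | add p q hp hq => simp only [map_add, TensorProduct.add_tmul, hp, hq]
      | tmul r s =>
        simp only [TensorProduct.map_tmul, TensorProduct.assoc_tmul, Ψ, Φ]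
        congr 1
        simp only [LinearMap.comp_apply, LinearMap.mulRight_apply]
        generalize comul (R := k) f = v
        induction v with
        | zero => simp
        | add p q hp hq => simp only [map_add, LinearMap.add_apply, mul_add, hp, hq]
        | tmul x y =>
          simp only [LinearEquiv.coe_coe, TensorProduct.comm_tmul, TensorProduct.map_tmul,
            Algebra.TensorProduct.tmul_mul_tmul]
          simp only [LinearMap.comp_apply, LinearMap.flip_apply, AlgHom.toLinearMap_apply,
            LinearMap.id_apply, antipode_mul_antidistrib, map_mul, Module.End.mul_apply]
          rfl
  rw [h1, h2, coassoc_apply]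

/-! ### The algebra `A^e # H` -/

/-- The algebra `A^e # H` on the vector space `A ⊗ A ⊗ H`, with
`(b ⊗ b' # h) (c ⊗ c' # g) = b (h₁ ▷ c) ⊗ c' (S g₂ ▷ b') # h₂ g₁`. -/
def CocycleSmash (_ : HopfModuleAlgebra k H A) : Type _ := A ⊗[k] (A ⊗[k] H)

noncomputable instance : AddCommGroup 𝒜.CocycleSmash :=
  inferInstanceAs (AddCommGroup (A ⊗[k] (A ⊗[k] H)))
noncomputable instance : Module k 𝒜.CocycleSmash :=
  inferInstanceAs (Module k (A ⊗[k] (A ⊗[k] H)))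

namespace CocycleSmash

/-- Operator of left multiplication. -/
noncomputable def opr : A ⊗[k] (A ⊗[k] H) →ₗ[k] Module.End k (A ⊗[k] (A ⊗[k] H)) :=
  LinearMap.mul' k _ ∘ₗ TensorProduct.map (leftMul k A (A ⊗[k] H)).toLinearMap
    (LinearMap.mul' k _ ∘ₗ TensorProduct.map 𝒜.leftOp.toLinearMap 𝒜.rightOp ∘ₗ
      (TensorProduct.comm k A H).toLinearMap)

theorem opr_tmul (b b' : A) (h : H) : opr 𝒜 (b ⊗ₜ (b' ⊗ₜ h)) =
    leftMul k A (A ⊗[k] H) b * (𝒜.leftOp h * 𝒜.rightOp b') := by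
  simp [opr]

theorem opr_opr (x y : A ⊗[k] (A ⊗[k] H)) : opr 𝒜 (opr 𝒜 x y) = opr 𝒜 x * opr 𝒜 y := by
  induction x with
  | zero => simp
  | add p q hp hq => simp only [map_add, LinearMap.add_apply, hp, hq, add_mul]
  | tmul b x =>
  induction x with
  | zero => simp
  | add p q hp hq => simp only [TensorProduct.tmul_add, map_add, LinearMap.add_apply, hp, hq, add_mul]
  | tmul b' h =>
  induction y with
  | zero => simp
  | add p q hp hq => simp only [map_add, hp, hq, mul_add]
  | tmul c y =>
  induction y with
  | zero => simp
  | add p q hp hq => simp only [TensorProduct.tmul_add, map_add, hp, hq, mul_add]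
  | tmul c' g =>
    have e : opr 𝒜 (b ⊗ₜ (b' ⊗ₜ h)) * opr 𝒜 (c ⊗ₜ (c' ⊗ₜ g)) = leftMul k A (A ⊗[k] H) b *
        ((𝒜.leftOp h * leftMul k A (A ⊗[k] H) c) * (𝒜.rightOp b' * 𝒜.leftOp g)) *
          𝒜.rightOp c' := by
      simp only [opr_tmul, mul_assoc]
      rw [← mul_assoc (𝒜.rightOp b') (leftMul k A (A ⊗[k] H) c), rightOp_mul_leftMul]
      simp only [mul_assoc]
    rw [e, rightOp_mul_leftOp, leftOp, diagAct_mul_leftMul, ← leftOp, opr_tmul]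
    simp only [Module.End.mul_apply]
    have e2 : 𝒜.rightOp b' (c ⊗ₜ (c' ⊗ₜ g)) = c ⊗ₜ 𝒜.rightAct b' (c' ⊗ₜ g) := rfl
    rw [e2, rightAct_tmul, leftOp, diagAct_tmul, ← leftOp]
    generalize comul (R := k) h = w
    generalize comul (R := k) g = v
    induction w with
    | zero => simp
    | add p q hp hq => simp only [map_add, hp, hq, mul_add, add_mul]
    | tmul p q =>
    induction v with
    | zero => simp
    | add p q hp hq =>
      simp only [map_add, TensorProduct.map_add_right, LinearMap.add_apply, hp, hq, mul_add,
        add_mul]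
    | tmul r s =>
      have e3 : ∀ z : A, ∀ w : H, (((Module.endTensorEndAlgHom (R := k) (A := k) (M := A) (N := H)).comp
        (Algebra.TensorProduct.includeRight.comp (Algebra.lmul k H))).toLinearMap.flip (z ⊗ₜ w)) q =
          z ⊗ₜ (q * w) := fun _ _ => rfl
      simp only [TensorProduct.map_tmul, TensorProduct.comm_tmul, e3, LinearMap.mul'_apply,
        leftMul_tmul, opr_tmul, LinearMap.id_apply]
      simp only [LinearMap.comp_apply, LinearMap.mulLeft_apply, LinearMap.flip_apply,
        AlgHom.toLinearMap_apply, map_mul, ← rightOp_mul, mul_assoc]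

theorem opr_one (x : A ⊗[k] (A ⊗[k] H)) : opr 𝒜 x ((1 : A) ⊗ₜ ((1 : A) ⊗ₜ (1 : H))) = x := by
  induction x with
  | zero => simp
  | add p q hp hq => simp only [map_add, LinearMap.add_apply, hp, hq]
  | tmul b x =>
  induction x with
  | zero => simp
  | add p q hp hq => simp only [TensorProduct.tmul_add, map_add, LinearMap.add_apply, hp, hq]
  | tmul b' h =>
    rw [opr_tmul]
    simp only [Module.End.mul_apply]
    have e2 : 𝒜.rightOp b' ((1 : A) ⊗ₜ ((1 : A) ⊗ₜ (1 : H))) =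
      (1 : A) ⊗ₜ 𝒜.rightAct b' ((1 : A) ⊗ₜ (1 : H)) := rfl
    rw [e2, rightAct_tmul, Bialgebra.comul_one, leftOp, diagAct_one_tmul, leftMul_tmul]
    simp only [Algebra.TensorProduct.one_def, TensorProduct.comm_tmul, TensorProduct.map_tmul,
      LinearMap.comp_apply, antipode_one, LinearMap.flip_apply, AlgHom.toLinearMap_apply, map_one,
      LinearMap.mulLeft_apply, one_mul, mul_one, LinearMap.id_apply, Module.End.one_apply]
    change b ⊗ₜ (b' ⊗ₜ (h * 1)) = _
    rw [mul_one]

theorem one_opr : opr 𝒜 ((1 : A) ⊗ₜ ((1 : A) ⊗ₜ (1 : H))) = 1 := by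
  rw [opr_tmul]
  have : 𝒜.rightAct 1 = 1 := by
    ext c g
    simp only [TensorProduct.AlgebraTensorModule.curry_apply, TensorProduct.curry_apply,
      LinearMap.coe_restrictScalars, rightAct_tmul]
    have h1 : 𝒜.act.toLinearMap.flip (1 : A) ∘ₗ antipode k = Algebra.linearMap k A ∘ₗ counit := by
      ext h; simp [act_one]
    have h2 : ∀ z : H ⊗[k] H, TensorProduct.map
        (LinearMap.mulLeft k c ∘ₗ 𝒜.act.toLinearMap.flip 1 ∘ₗ antipode k)
          (LinearMap.id : H →ₗ[k] H) (TensorProduct.comm k H H z) =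
        TensorProduct.comm k H A ((LinearMap.mulLeft k c ∘ₗ Algebra.linearMap k A).lTensor H
          (counit.lTensor H z)) := by
      intro z
      rw [h1]
      induction z with
      | zero => simp
      | add p q hp hq => simp only [map_add, hp, hq]
      | tmul p q => simp
    rw [h2, lTensor_counit_comul]
    simp
  have h3 : 𝒜.rightOp 1 = 1 := by
    change LinearMap.lTensor A (𝒜.rightAct 1) = 1
    rw [this]; exact LinearMap.lTensor_id _ _
  simp [h3]

noncomputable instance : Ring 𝒜.CocycleSmash :=
  { (inferInstance : AddCommGroup 𝒜.CocycleSmash) with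
    mul := fun x y => opr 𝒜 x y
    one := (1 : A) ⊗ₜ[k] ((1 : A) ⊗ₜ[k] (1 : H))
    left_distrib := fun x y z => map_add (opr 𝒜 x) y z
    right_distrib := fun x y z => congr($(map_add (opr 𝒜) x y) z)
    zero_mul := fun x => congr($(map_zero (opr 𝒜)) x)
    mul_zero := fun x => map_zero (opr 𝒜 x)
    mul_assoc := fun x y z => congr($(opr_opr 𝒜 x y) z)
    one_mul := fun x => congr($(one_opr 𝒜) x)
    mul_one := fun x => opr_one 𝒜 x }

noncomputable instance : Algebra k 𝒜.CocycleSmash :=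
  Algebra.ofModule (fun r x y => congr($(map_smul (opr 𝒜) r x) y))
    (fun r x y => map_smul (opr 𝒜 x) r y)

/-- The element `b ⊗ b' # h`. -/
noncomputable def tmul (b b' : A) (h : H) : 𝒜.CocycleSmash := b ⊗ₜ[k] (b' ⊗ₜ[k] h)

theorem tmul_mul_tmul (b b' c c' : A) (h g : H) :
    tmul 𝒜 b b' h * tmul 𝒜 c c' g =
      ∑ i ∈ (Repr.arbitrary k h).index, ∑ j ∈ (Repr.arbitrary k g).index,
        tmul 𝒜 (b * 𝒜.act ((Repr.arbitrary k h).left i) c)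
          (c' * 𝒜.act (antipode k ((Repr.arbitrary k g).right j)) b')
          ((Repr.arbitrary k h).right i * (Repr.arbitrary k g).left j) := by
  change opr 𝒜 _ _ = ∑ i ∈ (Repr.arbitrary k h).index, ∑ j ∈ (Repr.arbitrary k g).index, (_ ⊗ₜ (_ ⊗ₜ _))
  rw [tmul, tmul, opr_tmul]
  simp only [Module.End.mul_apply]
  have e2 : 𝒜.rightOp b' (c ⊗ₜ (c' ⊗ₜ g)) = c ⊗ₜ 𝒜.rightAct b' (c' ⊗ₜ g) := rfl
  rw [e2, rightAct_tmul, leftOp, diagAct_tmul]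
  conv_lhs => rw [← (Repr.arbitrary k h).eq, ← (Repr.arbitrary k g).eq]
  simp only [map_sum, TensorProduct.map_tmul, TensorProduct.comm_tmul, LinearMap.sum_apply,
    TensorProduct.tmul_sum]
  refine Finset.sum_congr rfl fun i _ => Finset.sum_congr rfl fun j _ => ?_
  rfl

end CocycleSmash
end HopfModuleAlgebra

/-! ### Balanced tensor products and left bialgebroids -/

section Balanced
variable {k B M N : Type*} [CommRing k] [AddCommGroup M] [Module k M] [AddCommGroup N] [Module k N]

/-- The submodule spanned by the `r b m ⊗ n - m ⊗ l b n`. -/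
def balancedRel (k : Type*) {B M N : Type*} [CommRing k] [AddCommGroup M] [Module k M]
    [AddCommGroup N] [Module k N] (r : B → M → M) (l : B → N → N) : Submodule k (M ⊗[k] N) :=
  Submodule.span k {z | ∃ b m n, z = r b m ⊗ₜ[k] n - m ⊗ₜ[k] l b n}

/-- The tensor product `M ⊗_B N`, where `r` is the right action of `B` on `M` and `l` the left
action of `B` on `N`. -/
abbrev BalancedTensor (k : Type*) {B M N : Type*} [CommRing k] [AddCommGroup M] [Module k M]
    [AddCommGroup N] [Module k N] (r : B → M → M) (l : B → N → N) : Type _ :=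
  (M ⊗[k] N) ⧸ balancedRel k r l
end Balanced

section Bialgebroid
variable (k B L : Type*) [Field k] [Ring B] [Algebra k B] [Ring L] [Algebra k L]
open MulOpposite

variable {k B L} in
/-- `L ⊗_B L`, i.e. the quotient of `L ⊗ L` by the `t(b) X ⊗ Y - X ⊗ s(b) Y`. -/
abbrev TakeuchiTensor (s : B →ₐ[k] L) (t : Bᵐᵒᵖ →ₐ[k] L) : Type _ :=
  BalancedTensor k (fun (b : B) (X : L) => t (op b) * X) (fun (b : B) (Y : L) => s b * Y)

variable {k B L} in
/-- The quotient map `L ⊗ L → L ⊗_B L`. -/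
def takeuchiMk (s : B →ₐ[k] L) (t : Bᵐᵒᵖ →ₐ[k] L) : L ⊗[k] L →ₗ[k] TakeuchiTensor s t :=
  Submodule.mkQ _

variable {k B L} in
/-- The relations of `L ⊗_B L ⊗_B L`. -/
def takeuchiTripleRel (s : B →ₐ[k] L) (t : Bᵐᵒᵖ →ₐ[k] L) : Submodule k (L ⊗[k] (L ⊗[k] L)) :=
  Submodule.span k
    ({z | ∃ b X Y Z, z = (t (op b) * X) ⊗ₜ[k] (Y ⊗ₜ[k] Z) - X ⊗ₜ[k] ((s b * Y) ⊗ₜ[k] Z)} ∪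
     {z | ∃ b X Y Z, z = X ⊗ₜ[k] ((t (op b) * Y) ⊗ₜ[k] Z) - X ⊗ₜ[k] (Y ⊗ₜ[k] (s b * Z))})

variable {k B L} in
/-- `(L ⊗_B L) ⊗_k L → L ⊗_B L ⊗_B L`. -/
noncomputable def takeuchiTripleLeft (s : B →ₐ[k] L) (t : Bᵐᵒᵖ →ₐ[k] L) :
    TakeuchiTensor s t ⊗[k] L →ₗ[k] (L ⊗[k] (L ⊗[k] L)) ⧸ takeuchiTripleRel s t :=
  TensorProduct.lift (Submodule.liftQ _
    (TensorProduct.curry ((takeuchiTripleRel s t).mkQ ∘ₗ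
      (TensorProduct.assoc k L L L).toLinearMap)) (by
    rw [balancedRel, Submodule.span_le]
    rintro _ ⟨b, X, Y, rfl⟩
    rw [SetLike.mem_coe, LinearMap.mem_ker]
    ext Z
    simp only [map_sub, LinearMap.sub_apply, TensorProduct.curry_apply, LinearMap.comp_apply,
      LinearEquiv.coe_coe, TensorProduct.assoc_tmul, LinearMap.zero_apply]
    rw [← map_sub, Submodule.mkQ_apply, Submodule.Quotient.mk_eq_zero]
    exact Submodule.subset_span (Or.inl ⟨b, X, Y, Z, rfl⟩)))

variable {k B L} in
/-- `L ⊗_k (L ⊗_B L) → L ⊗_B L ⊗_B L`. -/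
noncomputable def takeuchiTripleRight (s : B →ₐ[k] L) (t : Bᵐᵒᵖ →ₐ[k] L) :
    L ⊗[k] TakeuchiTensor s t →ₗ[k] (L ⊗[k] (L ⊗[k] L)) ⧸ takeuchiTripleRel s t :=
  TensorProduct.lift (LinearMap.flip (Submodule.liftQ _
    (TensorProduct.curry ((takeuchiTripleRel s t).mkQ ∘ₗ
      (TensorProduct.comm k (L ⊗[k] L) L).toLinearMap)) (by
    rw [balancedRel, Submodule.span_le]
    rintro _ ⟨b, Y, Z, rfl⟩
    rw [SetLike.mem_coe, LinearMap.mem_ker]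
    ext X
    simp only [map_sub, LinearMap.sub_apply, TensorProduct.curry_apply, LinearMap.comp_apply,
      LinearEquiv.coe_coe, TensorProduct.comm_tmul, LinearMap.zero_apply]
    rw [← map_sub, Submodule.mkQ_apply, Submodule.Quotient.mk_eq_zero]
    exact Submodule.subset_span (Or.inr ⟨b, X, Y, Z, rfl⟩))))

/-- A left bialgebroid `L` over the `k`-algebra `B`. In the axioms `w` and `v` are representatives
in `L ⊗ L` of coproducts `Δ X = X₁ ⊗_B X₂` and `Δ Y = Y₁ ⊗_B Y₂`. -/
structure LeftBialgebroid where
  /-- source map -/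
  s : B →ₐ[k] L
  /-- target map -/
  t : Bᵐᵒᵖ →ₐ[k] L
  comm : ∀ a b, s a * t b = t b * s a
  /-- coproduct -/
  comul : L →ₗ[k] TakeuchiTensor s t
  /-- counit -/
  counit : L →ₗ[k] B
  /-- `Δ (s(a) t(b) X) = s(a) X₁ ⊗_B t(b) X₂` -/
  comul_bimodule : ∀ a b X w, takeuchiMk s t w = comul X →
    comul (s a * t (op b) * X) = takeuchiMk s t ((s a ⊗ₜ t (op b)) * w)
  /-- `ε (s(a) t(b) X) = a ε(X) b` -/
  counit_bimodule : ∀ a b X, counit (s a * t (op b) * X) = a * counit X * b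
  coassoc : ∀ X w, takeuchiMk s t w = comul X →
    takeuchiTripleLeft s t (comul.rTensor L w) = takeuchiTripleRight s t (comul.lTensor L w)
  /-- `s(ε(X₁)) X₂ = X` -/
  counit_left : ∀ X w, takeuchiMk s t w = comul X →
    LinearMap.mul' k L ((s.toLinearMap ∘ₗ counit).rTensor L w) = X
  /-- `t(ε(X₂)) X₁ = X` -/
  counit_right : ∀ X w, takeuchiMk s t w = comul X →
    LinearMap.mul' k L (TensorProduct.comm k L L
      ((t.toLinearMap ∘ₗ (opLinearEquiv k).toLinearMap ∘ₗ counit).lTensor L w)) = X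
  /-- `X₁ t(a) ⊗_B X₂ = X₁ ⊗_B X₂ s(a)` -/
  takeuchi : ∀ a X w, takeuchiMk s t w = comul X →
    takeuchiMk s t (w * (t (op a) ⊗ₜ 1)) = takeuchiMk s t (w * (1 ⊗ₜ s a))
  comul_one : comul 1 = takeuchiMk s t 1
  /-- `Δ (X Y) = X₁ Y₁ ⊗_B X₂ Y₂` -/
  comul_mul : ∀ X Y w v, takeuchiMk s t w = comul X → takeuchiMk s t v = comul Y →
    comul (X * Y) = takeuchiMk s t (w * v)
  counit_one : counit 1 = 1
  counit_mul_s : ∀ X Y, counit (X * Y) = counit (X * s (counit Y))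
  counit_mul_t : ∀ X Y, counit (X * Y) = counit (X * t (op (counit Y)))

namespace LeftBialgebroid
variable {k B L}

/-- A left bialgebroid is a left Hopf algebroid (a Hopf algebroid in the Galois sense) if the map
`λ : L ⊗_{B^op} L → L ⊗_B L`, `λ (X ⊗ Y) = X₁ ⊗_B X₂ Y`, is (well defined and) invertible. Here
`X t(b) ⊗ Y = X ⊗ t(b) Y` in the domain. -/
def IsLeftHopf (𝓛 : LeftBialgebroid k B L) : Prop :=
  ∃ lam : BalancedTensor k (fun (b : B) (X : L) => X * 𝓛.t (op b))
      (fun (b : B) (Y : L) => 𝓛.t (op b) * Y) ≃ₗ[k] TakeuchiTensor 𝓛.s 𝓛.t,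
    ∀ X Y w, takeuchiMk 𝓛.s 𝓛.t w = 𝓛.comul X →
      lam (Submodule.Quotient.mk (X ⊗ₜ[k] Y)) = takeuchiMk 𝓛.s 𝓛.t (w * (1 ⊗ₜ Y))

/-- The algebra isomorphism `Φ` is an isomorphism of left bialgebroids over `B`. -/
def IsIso {L' : Type*} [Ring L'] [Algebra k L'] (𝓛 : LeftBialgebroid k B L)
    (𝓛' : LeftBialgebroid k B L') (Φ : L ≃ₐ[k] L') : Prop :=
  (∀ b, Φ (𝓛.s b) = 𝓛'.s b) ∧ (∀ b, Φ (𝓛.t b) = 𝓛'.t b) ∧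
  (∀ X, 𝓛'.counit (Φ X) = 𝓛.counit X) ∧
  ∀ X w, takeuchiMk 𝓛.s 𝓛.t w = 𝓛.comul X →
    𝓛'.comul (Φ X) = takeuchiMk 𝓛'.s 𝓛'.t
      (TensorProduct.map Φ.toLinearMap Φ.toLinearMap w)
end LeftBialgebroid
end Bialgebroid

/-! ### Ehresmann-Schauenburg -/
section ES
open MulOpposite Coalgebra

/-- A right `H`-comodule algebra `P`, with coaction `p ↦ p₀ ⊗ p₁`. -/
structure ComoduleAlgebra (k H P : Type*) [Field k] [Ring H] [HopfAlgebra k H] [Ring P]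
    [Algebra k P] where
  coact : P →ₐ[k] P ⊗[k] H
  coassoc : ∀ p, TensorProduct.assoc k P H H (coact.toLinearMap.rTensor H (coact p)) =
    (comul (R := k) (A := H)).lTensor P (coact p)
  counit : ∀ p, TensorProduct.rid k P ((Coalgebra.counit (R := k) (A := H)).lTensor P (coact p)) = p

namespace ComoduleAlgebra
variable {k H P : Type*} [Field k] [Ring H] [HopfAlgebra k H] [Ring P] [Algebra k P]
  (𝒞 : ComoduleAlgebra k H P)

/-- The diagonal coaction `p ⊗ q ↦ p₀ ⊗ q₀ ⊗ p₁ q₁`. -/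
noncomputable def diagCoact : P ⊗[k] Pᵐᵒᵖ →ₗ[k] (P ⊗[k] Pᵐᵒᵖ) ⊗[k] H :=
  (LinearMap.mul' k H).lTensor (P ⊗[k] Pᵐᵒᵖ) ∘ₗ
    (TensorProduct.tensorTensorTensorComm k P H Pᵐᵒᵖ H).toLinearMap ∘ₗ
      TensorProduct.map 𝒞.coact.toLinearMap
        ((opLinearEquiv k).toLinearMap.rTensor H ∘ₗ 𝒞.coact.toLinearMap ∘ₗ
          (opLinearEquiv k).symm.toLinearMap)

theorem diagCoact_tmul_mul (p q : P) (y : P ⊗[k] Pᵐᵒᵖ) (hy : 𝒞.diagCoact y = y ⊗ₜ 1) :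
    𝒞.diagCoact ((p ⊗ₜ op q) * y) =
      (LinearMap.mulRight k y).rTensor H (𝒞.diagCoact (p ⊗ₜ op q)) := by
  have key : ∀ (c d : P ⊗[k] H), ∃ F : (P ⊗[k] Pᵐᵒᵖ) ⊗[k] H →ₗ[k] (P ⊗[k] Pᵐᵒᵖ) ⊗[k] H,
     (∀ a b : P ⊗[k] H, F ((LinearMap.mul' k H).lTensor (P ⊗[k] Pᵐᵒᵖ) (TensorProduct.tensorTensorTensorComm k P H Pᵐᵒᵖ H
        (a ⊗ₜ (opLinearEquiv k).toLinearMap.rTensor H b))) =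
       (LinearMap.mul' k H).lTensor (P ⊗[k] Pᵐᵒᵖ) (TensorProduct.tensorTensorTensorComm k P H Pᵐᵒᵖ H
        ((c * a) ⊗ₜ (opLinearEquiv k).toLinearMap.rTensor H (b * d)))) ∧
     (∀ y : P ⊗[k] Pᵐᵒᵖ, F (y ⊗ₜ 1) = (LinearMap.mulRight k y).rTensor H
        ((LinearMap.mul' k H).lTensor (P ⊗[k] Pᵐᵒᵖ) (TensorProduct.tensorTensorTensorComm k P H Pᵐᵒᵖ H
          (c ⊗ₜ (opLinearEquiv k).toLinearMap.rTensor H d)))) := by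
    intro c d
    induction c with
    | zero => exact ⟨0, by simp, by simp⟩
    | add c₁ c₂ h₁ h₂ =>
      obtain ⟨F₁, h₁, h₁'⟩ := h₁
      obtain ⟨F₂, h₂, h₂'⟩ := h₂
      refine ⟨F₁ + F₂, fun a b => ?_, fun y => ?_⟩
      · simp only [LinearMap.add_apply, h₁, h₂, add_mul, TensorProduct.add_tmul, map_add]
      · rw [LinearMap.add_apply, h₁', h₂', TensorProduct.add_tmul, map_add, map_add, map_add]
    | tmul c g =>
    induction d with
    | zero => exact ⟨0, by simp, by simp⟩
    | add c₁ c₂ h₁ h₂ =>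
      obtain ⟨F₁, h₁, h₁'⟩ := h₁
      obtain ⟨F₂, h₂, h₂'⟩ := h₂
      refine ⟨F₁ + F₂, fun a b => ?_, fun y => ?_⟩
      · simp only [LinearMap.add_apply, h₁, h₂, mul_add, TensorProduct.tmul_add, map_add]
      · rw [LinearMap.add_apply, h₁', h₂', map_add, TensorProduct.tmul_add, map_add, map_add, map_add]
    | tmul d f =>
      refine ⟨TensorProduct.map (LinearMap.mulLeft k (c ⊗ₜ op d))
        (LinearMap.mulLeft k g ∘ₗ LinearMap.mulRight k f), fun a b => ?_, fun y => ?_⟩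
      · induction a with
        | zero => simp
        | add c₁ c₂ h₁ h₂ => simp only [mul_add, TensorProduct.add_tmul, map_add, h₁, h₂]
        | tmul a a' =>
        induction b with
        | zero => simp
        | add c₁ c₂ h₁ h₂ => simp only [add_mul, TensorProduct.tmul_add, map_add, h₁, h₂]
        | tmul b b' => simp [mul_assoc]
      · simp
  obtain ⟨F, h1, h2⟩ := key (𝒞.coact p) (𝒞.coact q)
  have h3 : ∀ y : P ⊗[k] Pᵐᵒᵖ, 𝒞.diagCoact ((p ⊗ₜ op q) * y) = F (𝒞.diagCoact y) := by
    intro y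
    induction y with
    | zero => simp
    | add c₁ c₂ h₁ h₂ => simp only [mul_add, map_add, h₁, h₂]
    | tmul a b =>
      obtain ⟨b, rfl⟩ := op_surjective b
      have e : ∀ a b : P, 𝒞.diagCoact (a ⊗ₜ op b) = (LinearMap.mul' k H).lTensor (P ⊗[k] Pᵐᵒᵖ)
          (TensorProduct.tensorTensorTensorComm k P H Pᵐᵒᵖ H
            (𝒞.coact a ⊗ₜ (opLinearEquiv k).toLinearMap.rTensor H (𝒞.coact b))) := fun _ _ => rfl
      rw [Algebra.TensorProduct.tmul_mul_tmul, ← op_mul, e, e, h1, map_mul, map_mul]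
  rw [h3, hy, h2]
  simp [diagCoact]

/-- `(P ⊗ P)^{co H}`, with the product `(p ⊗ q) (r ⊗ v) = p r ⊗ v q`. -/
noncomputable def ehresmann : Subalgebra k (P ⊗[k] Pᵐᵒᵖ) where
  carrier := {z | 𝒞.diagCoact z = z ⊗ₜ 1}
  add_mem' {a b} ha hb := by
    simp only [Set.mem_ofPred_eq] at *
    rw [map_add, ha, hb, TensorProduct.add_tmul]
  mul_mem' {a b} ha hb := by
    simp only [Set.mem_ofPred_eq] at *
    have h : ∀ z, 𝒞.diagCoact (z * b) = (LinearMap.mulRight k b).rTensor H (𝒞.diagCoact z) := by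
      intro z
      induction z with
      | zero => simp
      | add c₁ c₂ h₁ h₂ => rw [add_mul, map_add, h₁, h₂, map_add, map_add]
      | tmul p q => exact 𝒞.diagCoact_tmul_mul p (unop q) b hb
    rw [h, ha]; simp
  algebraMap_mem' r := by
    simp only [Set.mem_ofPred_eq, diagCoact, LinearMap.comp_apply,
      Algebra.TensorProduct.algebraMap_apply, TensorProduct.map_tmul, LinearEquiv.coe_coe,
      AlgHom.toLinearMap_apply, AlgHom.commutes]
    simp [Algebra.TensorProduct.one_def]

/-- The algebra `L(P, H)`, i.e. the subalgebra `(P ⊗ P)^{co H}` of `P ⊗ P^op` as a type. -/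
def EhresmannAlgebra : Type _ := 𝒞.ehresmann

noncomputable instance : Ring 𝒞.EhresmannAlgebra := inferInstanceAs (Ring 𝒞.ehresmann)
noncomputable instance : Algebra k 𝒞.EhresmannAlgebra := inferInstanceAs (Algebra k 𝒞.ehresmann)

/-- The inclusion `L(P, H) → P ⊗ P^op`. -/
noncomputable def ehresmannVal : 𝒞.EhresmannAlgebra →ₐ[k] P ⊗[k] Pᵐᵒᵖ := 𝒞.ehresmann.val

variable {B : Type*} [Ring B] [Algebra k B]

/-- `P ⊗_B P`, for an algebra map `ι : B → P`. -/
abbrev RelTensor (ι : B →ₐ[k] P) : Type _ :=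
  BalancedTensor k (fun (b : B) (p : P) => p * ι b) (fun (b : B) (q : P) => ι b * q)

end ComoduleAlgebra

/-- `P` is faithfully flat as a left `B`-module: a map `f : M → N` of right `B`-modules is injective
if and only if `f ⊗_B id : M ⊗_B P → N ⊗_B P` is. -/
def IsLeftFaithfullyFlat {k : Type*} {B : Type u} {P : Type*} [Field k] [Ring B] [Algebra k B] [Ring P]
    [Algebra k P] (ι : B →ₐ[k] P) : Prop :=
  ∀ (M N : Type u) [AddCommGroup M] [AddCommGroup N] [Module Bᵐᵒᵖ M] [Module Bᵐᵒᵖ N]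
    (f : M →ₗ[Bᵐᵒᵖ] N),
    Function.Injective f ↔
      ∀ z : M ⊗[ℤ] P,
        f.toAddMonoidHom.toIntLinearMap.rTensor P z ∈
          balancedRel ℤ (fun (b : B) (m : N) => op b • m) (fun b (p : P) => ι b * p) →
        z ∈ balancedRel ℤ (fun (b : B) (m : M) => op b • m) (fun b (p : P) => ι b * p)

variable {k H P : Type*} [Field k] [Ring H] [HopfAlgebra k H] [Ring P] [Algebra k P]

/-- `ι : B → P` exhibits `B` as the coinvariants of the `H`-comodule algebra `P`, and the canonical
map `P ⊗_B P → P ⊗ H`, `q ⊗ p ↦ q p₀ ⊗ p₁`, is bijective. -/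
structure HopfGaloisExtension (𝒞 : ComoduleAlgebra k H P) {B : Type*} [Ring B] [Algebra k B]
    (ι : B →ₐ[k] P) where
  injective : Function.Injective ι
  range_eq : ∀ p, p ∈ Set.range ι ↔ 𝒞.coact p = p ⊗ₜ 1
  /-- the canonical map -/
  can : ComoduleAlgebra.RelTensor ι ≃ₗ[k] P ⊗[k] H
  can_apply : ∀ q p, can (Submodule.Quotient.mk (q ⊗ₜ[k] p)) = (q ⊗ₜ 1) * 𝒞.coact p

namespace HopfGaloisExtension
variable {𝒞 : ComoduleAlgebra k H P} {B : Type*} [Ring B] [Algebra k B] {ι : B →ₐ[k] P}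
  (G : HopfGaloisExtension 𝒞 ι)

/-- The translation map `τ : H → P ⊗_B P`, `h ↦ can⁻¹ (1 ⊗ h)`. -/
noncomputable def translation : H →ₗ[k] ComoduleAlgebra.RelTensor ι :=
  G.can.symm.toLinearMap ∘ₗ TensorProduct.mk k P H 1

/-- The map `b ↦ b ⊗ 1` to `P ⊗ P^op`. -/
noncomputable def src (ι : B →ₐ[k] P) : B →ₐ[k] P ⊗[k] Pᵐᵒᵖ :=
  Algebra.TensorProduct.includeLeft.comp ι

/-- The map `b ↦ 1 ⊗ b` to `P ⊗ P^op`. -/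
noncomputable def tgt (ι : B →ₐ[k] P) : Bᵐᵒᵖ →ₐ[k] P ⊗[k] Pᵐᵒᵖ :=
  Algebra.TensorProduct.includeRight.comp (AlgHom.op ι)

/-- `(p, q) ↦ (u ⊗_B v ↦ p ⊗ u ⊗_B v ⊗ q)`. -/
noncomputable def insertMiddle (ι : B →ₐ[k] P) : P →ₗ[k] P →ₗ[k]
    ComoduleAlgebra.RelTensor ι →ₗ[k] TakeuchiTensor (src ι) (tgt ι) :=
  LinearMap.mk₂ k (fun p q => Submodule.liftQ _ (takeuchiMk (src ι) (tgt ι) ∘ₗ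
      TensorProduct.map (TensorProduct.mk k P Pᵐᵒᵖ p ∘ₗ (opLinearEquiv k).toLinearMap)
        ((TensorProduct.mk k P Pᵐᵒᵖ).flip (op q))) (by
    rw [balancedRel, Submodule.span_le]
    rintro _ ⟨b, u, v, rfl⟩
    rw [SetLike.mem_coe, LinearMap.mem_ker, LinearMap.comp_apply, map_sub, takeuchiMk,
      Submodule.mkQ_apply, Submodule.Quotient.mk_eq_zero]
    refine Submodule.subset_span ⟨b, p ⊗ₜ op u, v ⊗ₜ op q, ?_⟩
    simp [src, tgt]))
    (by intros; ext; simp [TensorProduct.add_tmul])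
    (by intros; ext; simp [← TensorProduct.smul_tmul'])
    (by intros; ext; simp [TensorProduct.tmul_add])
    (by intros; ext; simp)

/-- The map `P ⊗ H → Hom(P, (P ⊗ P) ⊗_B (P ⊗ P))`, `p ⊗ h ↦ (q ↦ p ⊗ τ(h) ⊗ q)`. -/
noncomputable def insertTranslation : P ⊗[k] H →ₗ[k] P →ₗ[k] TakeuchiTensor (src ι) (tgt ι) :=
  TensorProduct.lift (LinearMap.mk₂ k (fun p h => (insertMiddle ι p).flip (G.translation h))
    (by intros; ext; simp) (by intros; ext; simp) (by intros; ext; simp) (by intros; ext; simp))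

/-- The map `P ⊗ P → (P ⊗ P) ⊗_B (P ⊗ P)`, `p ⊗ q ↦ p₀ ⊗ τ(p₁) ⊗ q`. -/
noncomputable def comulFormula : P ⊗[k] Pᵐᵒᵖ →ₗ[k] TakeuchiTensor (src ι) (tgt ι) :=
  TensorProduct.lift (G.insertTranslation ∘ₗ 𝒞.coact.toLinearMap) ∘ₗ
    (opLinearEquiv k).symm.toLinearMap.lTensor P

/-- `𝓛` is the structure of the Ehresmann-Schauenburg bialgebroid on `L(P, H)`: `s(b) = b ⊗ 1`,
`t(b) = 1 ⊗ b`, `ε (p ⊗ q) = p q` and `Δ (p ⊗ q) = p₀ ⊗ τ(p₁) ⊗ q`, an identity in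
`(P ⊗ P) ⊗_B (P ⊗ P)`. -/
structure IsEhresmannSchauenburg (𝓛 : LeftBialgebroid k B 𝒞.EhresmannAlgebra) : Prop where
  s_eq : ∀ b, 𝒞.ehresmannVal (𝓛.s b) = ι b ⊗ₜ 1
  t_eq : ∀ b, 𝒞.ehresmannVal (𝓛.t (op b)) = 1 ⊗ₜ op (ι b)
  counit_eq : ∀ z, ι (𝓛.counit z) =
    LinearMap.mul' k P ((opLinearEquiv k).symm.toLinearMap.lTensor P (𝒞.ehresmannVal z))
  comul_eq : ∀ z w, takeuchiMk 𝓛.s 𝓛.t w = 𝓛.comul z →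
    takeuchiMk (src ι) (tgt ι) (TensorProduct.map 𝒞.ehresmannVal.toLinearMap
      𝒞.ehresmannVal.toLinearMap w) = G.comulFormula (𝒞.ehresmannVal z)

end HopfGaloisExtension
end ES

/-! ### First order differential calculi and pivotal duals -/
section Calculus
open MulOpposite

/-- A first order differential calculus on the `k`-algebra `A`: an `A`-bimodule `Ω` (the right
action being an action of `Aᵐᵒᵖ`) with a `k`-linear derivation `d : A → Ω` such that `Ω` is spanned
by the elements `a (d b)`. -/
structure DifferentialCalculus (k A Ω : Type*) [Field k] [Ring A] [Algebra k A] [AddCommGroup Ω]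
    [Module k Ω] [Module A Ω] [Module Aᵐᵒᵖ Ω] [SMulCommClass A Aᵐᵒᵖ Ω] [IsScalarTower k A Ω]
    [IsScalarTower k Aᵐᵒᵖ Ω] where
  d : A →ₗ[k] Ω
  leibniz : ∀ a b : A, d (a * b) = op b • d a + a • d b
  surjective : Submodule.span k {w | ∃ a b : A, w = a • d b} = ⊤

/-- A bimodule `𝔛` which is at the same time a left dual and a right dual of the bimodule `Ω`:
bimodule maps `evL : 𝔛 ⊗_A Ω → A`, `evR : Ω ⊗_A 𝔛 → A` and coevaluations
`coevL 1 = ∑ ω_i ⊗ x_i`, `coevR 1 = ∑ y_j ⊗ η_j`. -/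
structure PivotalDual (k A Ω 𝔛 I J : Type*) [Field k] [Ring A] [Algebra k A] [AddCommGroup Ω]
    [Module k Ω] [Module A Ω] [Module Aᵐᵒᵖ Ω] [SMulCommClass A Aᵐᵒᵖ Ω] [IsScalarTower k A Ω]
    [IsScalarTower k Aᵐᵒᵖ Ω] [AddCommGroup 𝔛]
    [Module k 𝔛] [Module A 𝔛] [Module Aᵐᵒᵖ 𝔛] [SMulCommClass A Aᵐᵒᵖ 𝔛] [IsScalarTower k A 𝔛]
    [IsScalarTower k Aᵐᵒᵖ 𝔛] [Fintype I] [Fintype J] where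
  evL : 𝔛 →ₗ[k] Ω →ₗ[k] A
  evL_left : ∀ (a : A) (x : 𝔛) (w : Ω), evL (a • x) w = a * evL x w
  evL_right : ∀ (a : A) (x : 𝔛) (w : Ω), evL x (op a • w) = evL x w * a
  evL_balanced : ∀ (a : A) (x : 𝔛) (w : Ω), evL (op a • x) w = evL x (a • w)
  evR : Ω →ₗ[k] 𝔛 →ₗ[k] A
  evR_left : ∀ (a : A) (w : Ω) (y : 𝔛), evR (a • w) y = a * evR w y
  evR_right : ∀ (a : A) (w : Ω) (y : 𝔛), evR w (op a • y) = evR w y * a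
  evR_balanced : ∀ (a : A) (w : Ω) (y : 𝔛), evR (op a • w) y = evR w (a • y)
  ω : I → Ω
  x : I → 𝔛
  y : J → 𝔛
  η : J → Ω
  coevL_Ω : ∀ w, ∑ i, op (evL (x i) w) • ω i = w
  coevL_𝔛 : ∀ z, ∑ i, evL z (ω i) • x i = z
  coevR_Ω : ∀ w, ∑ j, evR w (y j) • η j = w
  coevR_𝔛 : ∀ z, ∑ j, op (evR (η j) z) • y j = z

variable {k A Ω I : Type*} [Field k] [Ring A] [Algebra k A] [AddCommGroup Ω]
    [Module k Ω] [Module A Ω] [Module Aᵐᵒᵖ Ω] [SMulCommClass A Aᵐᵒᵖ Ω] [IsScalarTower k A Ω]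
    [IsScalarTower k Aᵐᵒᵖ Ω]

/-- The operators `C_ij` on `A` with `ω_j f = ∑ i, C_ij(f) ω_i`, for a left basis `ω`. -/
noncomputable def commutationOp (ω : Module.Basis I A Ω) (i j : I) (f : A) : A :=
  ω.repr (op f • ω j) i

/-- The operators `C⁻¹_ij` on `A` with `f ω_j = ∑ i, ω_i C⁻¹_ij(f)`, for a right basis `ω`. -/
noncomputable def commutationOpInv (ω : Module.Basis I Aᵐᵒᵖ Ω) (i j : I) (f : A) : A :=
  unop (ω.repr (f • ω j) i)

/-- The operators `∂^R_i` on `A` with `d f = ∑ i, ω_i ∂^R_i(f)`, for a right basis `ω`. -/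
noncomputable def DifferentialCalculus.rightPartial (D : DifferentialCalculus k A Ω)
    (ω : Module.Basis I Aᵐᵒᵖ Ω) (i : I) (f : A) : A :=
  unop (ω.repr (D.d f) i)

end Calculus

/-! ### Ghobadi's Hopf algebroid of a pivotal calculus -/
section Ghobadi
open MulOpposite

/-- Generators of the algebra `IIL(Ω)`: `a`, `a̲`, `x`, `(x, ξ)` and `(ξ, y)`. -/
inductive GhobadiGen (A Ω 𝔛 : Type*) where
  | src (a : A)
  | tgt (a : A)
  | vec (x : 𝔛)
  | vecForm (x : 𝔛) (ξ : Ω)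
  | formVec (ξ : Ω) (y : 𝔛)

variable {k A Ω 𝔛 I J : Type*} [Field k] [Ring A] [Algebra k A] [AddCommGroup Ω]
    [Module k Ω] [Module A Ω] [Module Aᵐᵒᵖ Ω] [SMulCommClass A Aᵐᵒᵖ Ω] [IsScalarTower k A Ω]
    [IsScalarTower k Aᵐᵒᵖ Ω] [AddCommGroup 𝔛]
    [Module k 𝔛] [Module A 𝔛] [Module Aᵐᵒᵖ 𝔛] [SMulCommClass A Aᵐᵒᵖ 𝔛] [IsScalarTower k A 𝔛]
    [IsScalarTower k Aᵐᵒᵖ 𝔛] [Fintype I] [Fintype J]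

/-- The free algebra on the generators of `IIL(Ω)`. -/
abbrev GhobadiFree (k A Ω 𝔛 : Type*) [Field k] : Type _ := FreeAlgebra k (GhobadiGen A Ω 𝔛)

namespace GhobadiFree
variable (k) (Ω 𝔛) in
/-- `a` -/
def src (a : A) : GhobadiFree k A Ω 𝔛 := FreeAlgebra.ι k (.src a)
variable (k) (Ω 𝔛) in
/-- `a̲` -/
def tgt (a : A) : GhobadiFree k A Ω 𝔛 := FreeAlgebra.ι k (.tgt a)
variable (k) (A Ω) in
/-- `x` -/
def vec (x : 𝔛) : GhobadiFree k A Ω 𝔛 := FreeAlgebra.ι k (.vec x)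
variable (k) (A) in
/-- `(x, ξ)` -/
def vecForm (x : 𝔛) (ξ : Ω) : GhobadiFree k A Ω 𝔛 := FreeAlgebra.ι k (.vecForm x ξ)
variable (k) (A) in
/-- `(ξ, y)` -/
def formVec (ξ : Ω) (y : 𝔛) : GhobadiFree k A Ω 𝔛 := FreeAlgebra.ι k (.formVec ξ y)
end GhobadiFree

open GhobadiFree in
/-- The defining relations of `IIL(Ω)`. -/
inductive GhobadiRel (D : DifferentialCalculus k A Ω) (P : PivotalDual k A Ω 𝔛 I J) :
    GhobadiFree k A Ω 𝔛 → GhobadiFree k A Ω 𝔛 → Prop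
  -- `a ↦ a` is an algebra map from `A`
  | src_algebraMap (r : k) : GhobadiRel D P (src k Ω 𝔛 (algebraMap k A r)) (algebraMap k _ r)
  | src_add (a b : A) : GhobadiRel D P (src k Ω 𝔛 (a + b)) (src k Ω 𝔛 a + src k Ω 𝔛 b)
  | src_mul (a b : A) : GhobadiRel D P (src k Ω 𝔛 (a * b)) (src k Ω 𝔛 a * src k Ω 𝔛 b)
  -- `a ↦ a̲` is an algebra map from the opposite algebra of `A`
  | tgt_algebraMap (r : k) : GhobadiRel D P (tgt k Ω 𝔛 (algebraMap k A r)) (algebraMap k _ r)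
  | tgt_add (a b : A) : GhobadiRel D P (tgt k Ω 𝔛 (a + b)) (tgt k Ω 𝔛 a + tgt k Ω 𝔛 b)
  | tgt_mul (a b : A) : GhobadiRel D P (tgt k Ω 𝔛 (a * b)) (tgt k Ω 𝔛 b * tgt k Ω 𝔛 a)
  | src_tgt (a b : A) : GhobadiRel D P (src k Ω 𝔛 a * tgt k Ω 𝔛 b) (tgt k Ω 𝔛 b * src k Ω 𝔛 a)
  -- `k`-linearity of the other generators
  | vec_add (x x' : 𝔛) : GhobadiRel D P (vec k A Ω (x + x')) (vec k A Ω x + vec k A Ω x')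
  | vec_smul (r : k) (x : 𝔛) : GhobadiRel D P (vec k A Ω (r • x)) (r • vec k A Ω x)
  | vecForm_add_left (x x' : 𝔛) (ξ : Ω) :
      GhobadiRel D P (vecForm k A (x + x') ξ) (vecForm k A x ξ + vecForm k A x' ξ)
  | vecForm_add_right (x : 𝔛) (ξ ξ' : Ω) :
      GhobadiRel D P (vecForm k A x (ξ + ξ')) (vecForm k A x ξ + vecForm k A x ξ')
  | vecForm_smul_left (r : k) (x : 𝔛) (ξ : Ω) :
      GhobadiRel D P (vecForm k A (r • x) ξ) (r • vecForm k A x ξ)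
  | vecForm_smul_right (r : k) (x : 𝔛) (ξ : Ω) :
      GhobadiRel D P (vecForm k A x (r • ξ)) (r • vecForm k A x ξ)
  | formVec_add_left (ξ ξ' : Ω) (y : 𝔛) :
      GhobadiRel D P (formVec k A (ξ + ξ') y) (formVec k A ξ y + formVec k A ξ' y)
  | formVec_add_right (ξ : Ω) (y y' : 𝔛) :
      GhobadiRel D P (formVec k A ξ (y + y')) (formVec k A ξ y + formVec k A ξ y')
  | formVec_smul_left (r : k) (ξ : Ω) (y : 𝔛) :
      GhobadiRel D P (formVec k A (r • ξ) y) (r • formVec k A ξ y)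
  | formVec_smul_right (r : k) (ξ : Ω) (y : 𝔛) :
      GhobadiRel D P (formVec k A ξ (r • y)) (r • formVec k A ξ y)
  -- relations of `L(Ω)`
  | src_vecForm (a : A) (x : 𝔛) (ξ : Ω) :
      GhobadiRel D P (src k Ω 𝔛 a * vecForm k A x ξ) (vecForm k A (a • x) ξ)
  | vecForm_src (a : A) (x : 𝔛) (ξ : Ω) :
      GhobadiRel D P (vecForm k A x ξ * src k Ω 𝔛 a) (vecForm k A (op a • x) ξ)
  | tgt_vecForm (a : A) (x : 𝔛) (ξ : Ω) :
      GhobadiRel D P (tgt k Ω 𝔛 a * vecForm k A x ξ) (vecForm k A x (op a • ξ))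
  | vecForm_tgt (a : A) (x : 𝔛) (ξ : Ω) :
      GhobadiRel D P (vecForm k A x ξ * tgt k Ω 𝔛 a) (vecForm k A x (a • ξ))
  | src_vec (a : A) (x : 𝔛) : GhobadiRel D P (src k Ω 𝔛 a * vec k A Ω x) (vec k A Ω (a • x))
  | vec_src (a : A) (x : 𝔛) : GhobadiRel D P (vec k A Ω x * src k Ω 𝔛 a)
      (vec k A Ω (op a • x) + src k Ω 𝔛 (P.evL x (D.d a)))
  | vec_tgt (a : A) (x : 𝔛) : GhobadiRel D P (vec k A Ω x * tgt k Ω 𝔛 a)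
      (tgt k Ω 𝔛 a * vec k A Ω x + vecForm k A x (D.d a))
  -- relations of the generators `(ξ, y)`
  | formVec_tgt (a : A) (ξ : Ω) (y : 𝔛) :
      GhobadiRel D P (formVec k A ξ y * tgt k Ω 𝔛 a) (formVec k A ξ (a • y))
  | tgt_formVec (a : A) (ξ : Ω) (y : 𝔛) :
      GhobadiRel D P (tgt k Ω 𝔛 a * formVec k A ξ y) (formVec k A ξ (op a • y))
  | formVec_src (a : A) (ξ : Ω) (y : 𝔛) :
      GhobadiRel D P (formVec k A ξ y * src k Ω 𝔛 a) (formVec k A (op a • ξ) y)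
  | src_formVec (a : A) (ξ : Ω) (y : 𝔛) :
      GhobadiRel D P (src k Ω 𝔛 a * formVec k A ξ y) (formVec k A (a • ξ) y)
  -- invertibility relations
  | inv_right (ξ : Ω) (y : 𝔛) :
      GhobadiRel D P (∑ i, formVec k A (P.ω i) y * vecForm k A (P.x i) ξ)
        (tgt k Ω 𝔛 (P.evR ξ y))
  | inv_left (x : 𝔛) (ξ : Ω) :
      GhobadiRel D P (∑ j, vecForm k A x (P.η j) * formVec k A ξ (P.y j))
        (src k Ω 𝔛 (P.evL x ξ))
  -- biinvertibility relations
  | biinv_left (x : 𝔛) (ξ : Ω) :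
      GhobadiRel D P (∑ j, vecForm k A (P.y j) ξ * formVec k A (P.η j) x)
        (tgt k Ω 𝔛 (P.evL x ξ))
  | biinv_right (ξ : Ω) (x : 𝔛) :
      GhobadiRel D P (∑ i, formVec k A ξ (P.x i) * vecForm k A x (P.ω i))
        (src k Ω 𝔛 (P.evR ξ x))

/-- The algebra `IIL(Ω)`. -/
def GhobadiAlgebra (D : DifferentialCalculus k A Ω) (P : PivotalDual k A Ω 𝔛 I J) : Type _ :=
  RingQuot (GhobadiRel D P)

namespace GhobadiAlgebra
variable (D : DifferentialCalculus k A Ω) (P : PivotalDual k A Ω 𝔛 I J)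

noncomputable instance : Ring (GhobadiAlgebra D P) :=
  inferInstanceAs (Ring (RingQuot (GhobadiRel D P)))
noncomputable instance : Algebra k (GhobadiAlgebra D P) :=
  inferInstanceAs (Algebra k (RingQuot (GhobadiRel D P)))

/-- The quotient map from the free algebra. -/
noncomputable def mk : GhobadiFree k A Ω 𝔛 →ₐ[k] GhobadiAlgebra D P :=
  RingQuot.mkAlgHom k (GhobadiRel D P)

/-- The element `a` of `IIL(Ω)`. -/
noncomputable def src (a : A) : GhobadiAlgebra D P := mk D P (GhobadiFree.src k Ω 𝔛 a)
/-- The element `a̲` of `IIL(Ω)`. -/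
noncomputable def tgt (a : A) : GhobadiAlgebra D P := mk D P (GhobadiFree.tgt k Ω 𝔛 a)
/-- The element `x` of `IIL(Ω)`. -/
noncomputable def vec (x : 𝔛) : GhobadiAlgebra D P := mk D P (GhobadiFree.vec k A Ω x)
/-- The element `(x, ξ)` of `IIL(Ω)`. -/
noncomputable def vecForm (x : 𝔛) (ξ : Ω) : GhobadiAlgebra D P := mk D P (GhobadiFree.vecForm k A x ξ)
/-- The element `(ξ, y)` of `IIL(Ω)`. -/
noncomputable def formVec (ξ : Ω) (y : 𝔛) : GhobadiAlgebra D P := mk D P (GhobadiFree.formVec k A ξ y)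

/-- `𝓑` is Ghobadi's bialgebroid structure on `IIL(Ω)`. Coproducts are determined by these values,
since the coproducts of `a` and `a̲` are fixed by the axioms of a bialgebroid. -/
structure IsGhobadi (𝓑 : LeftBialgebroid k A (GhobadiAlgebra D P)) : Prop where
  s_eq : ∀ a, 𝓑.s a = src D P a
  t_eq : ∀ a, 𝓑.t (op a) = tgt D P a
  comul_vec : ∀ x, 𝓑.comul (vec D P x) = takeuchiMk 𝓑.s 𝓑.t
    (vec D P x ⊗ₜ 1 + ∑ i, vecForm D P x (P.ω i) ⊗ₜ vec D P (P.x i))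
  comul_vecForm : ∀ x ξ, 𝓑.comul (vecForm D P x ξ) = takeuchiMk 𝓑.s 𝓑.t
    (∑ i, vecForm D P x (P.ω i) ⊗ₜ vecForm D P (P.x i) ξ)
  comul_formVec : ∀ ξ y, 𝓑.comul (formVec D P ξ y) = takeuchiMk 𝓑.s 𝓑.t
    (∑ j, formVec D P ξ (P.y j) ⊗ₜ formVec D P (P.η j) y)
  counit_vec : ∀ x, 𝓑.counit (vec D P x) = 0
  counit_vecForm : ∀ x ξ, 𝓑.counit (vecForm D P x ξ) = P.evL x ξ
  counit_formVec : ∀ ξ y, 𝓑.counit (formVec D P ξ y) = P.evR ξ y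

end GhobadiAlgebra
end Ghobadi

/-! ### The bialgebroid structure of `A^e # H` -/
section CocycleBialgebroid
open MulOpposite
open HopfModuleAlgebra (CocycleSmash)
variable {k H A : Type*} [Field k] [Ring H] [HopfAlgebra k H] [Ring A] [Algebra k A]

/-- `𝓢` is the bialgebroid structure over `A` of `A^e # H` (the cocycle bialgebroid for the trivial
cocycle):
`s b = b ⊗ 1 # 1`, `t b = 1 ⊗ b # 1`, `Δ (b ⊗ b' # h) = (b ⊗ 1 # h₁) ⊗_A (1 ⊗ b' # h₂)` and
`ε (b ⊗ b' # h) = b (h ▷ b')`. -/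
structure HopfModuleAlgebra.IsCocycleBialgebroid (𝒜 : HopfModuleAlgebra k H A)
    (𝓢 : LeftBialgebroid k A 𝒜.CocycleSmash) : Prop where
  s_eq : ∀ b, 𝓢.s b = CocycleSmash.tmul 𝒜 b 1 1
  t_eq : ∀ b, 𝓢.t (op b) = CocycleSmash.tmul 𝒜 1 b 1
  comul_eq : ∀ (b b' : A) (h : H) (ι : Type) (r : Coalgebra.Repr k h ι),
    𝓢.comul (CocycleSmash.tmul 𝒜 b b' h) = takeuchiMk 𝓢.s 𝓢.t
      (∑ i ∈ r.index, CocycleSmash.tmul 𝒜 b 1 (r.left i) ⊗ₜ CocycleSmash.tmul 𝒜 1 b' (r.right i))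
  counit_eq : ∀ b b' h, 𝓢.counit (CocycleSmash.tmul 𝒜 b b' h) = b * 𝒜.act h b'

end CocycleBialgebroid

/-! The three Hopf algebroids are one algebra in three guises, so the structure is built once, on an
abstract copy. A `SmashRep` in an algebra B consists of algebra maps s from A, t from A^op and j
from H, with commuting s and t and with cross relations that move j(h) past s(a) and t(b). These
relations force the elements s(b) j(h) t(b') to multiply as b ⊗ b' # h does in A^e # H
(`SmashRep.mul_eq`). The representation is universal if b ⊗ b' ⊗ h ↦ s(b) j(h) t(b') is bijective;
algebra maps out of B are then given by triples of the same kind (`SmashRep.IsUniversal.lift`).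

For a universal L all structure maps come from such lifts. The triple s(a) ⊗ 1, 1 ⊗ t(a), j(h₁) ⊗
j(h₂) on L ⊗_k L gives the coproduct. The multiplications and the action of H on A give an action of
L on A, and ε(X) = X ▷ 1. The triple s(a) ⊗ 1, 1 ⊗ s(a), j(h₁) ⊗ j(S h₂) on L ⊗ L^op gives X₊ ⊗ X₋,
hence the inverse of the Galois map. So the coproduct lifts to an algebra map into L ⊗_k L that is
coassociative before passing to ⊗_A. The point peculiar to bialgebroids is that left multiplication
by its values descends to L ⊗_A L (`SmashRep.diag_mem`), which makes products of representatives
well defined. Since Δ and ε are determined by s, j, t, an algebra isomorphism matching these is an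
isomorphism of bialgebroids (`SmashRep.IsUniversal.isIso`).

It remains to find three universal triples. For A^e # H the evaluation map is the identity. For L(A
# H, H), the element b ⊗ b' # h goes to (b # h₁) ⊗ (b' # S h₂); applying ε to the last leg recovers
it, and coinvariance gives surjectivity (`trans_eval_ehresmannProj`). For IIL(Ω), generators and
relations give maps in both directions that are inverse on generators
(`GhobadiAlgebra.rep_isUniversal`). Here the calculus enters. Coordinates with respect to ω_i are
evaluations against x_i, so H acts on A by evaluations. The four families of relations of H hold on
A by the four duality identities, and in IIL(Ω) by the invertibility and biinvertibility relations.
The relations with a and a̲ are the cross relations, because S x_i acts as minus the left partial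
derivative.

Finally, A ⊆ A # H is cleft: the inverse of the canonical map is p ⊗ h ↦ p j(S h₁) ⊗ j(h₂). Faithful
flatness holds because a k-basis of H makes A # H a nonzero free left A-module. -/

/-! ### Sweedler sums -/
section Sweedler
open Coalgebra HopfAlgebra

/-- The unbundled predicate of `k`-linearity, set up for `fun_prop`. -/
@[fun_prop]
structure IsLin (k : Type*) {M N : Type*} [Semiring k] [AddCommMonoid M] [Module k M]
    [AddCommMonoid N] [Module k N] (f : M → N) : Prop where
  map_add : ∀ x y, f (x + y) = f x + f y
  map_smul : ∀ (r : k) x, f (r • x) = r • f x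

namespace IsLin
variable {k M N P : Type*} [CommSemiring k] [AddCommMonoid M] [Module k M] [AddCommMonoid N]
  [Module k N] [AddCommMonoid P] [Module k P]

/-- The linear map with underlying function `f`. -/
def toLinearMap {f : M → N} (hf : IsLin k f) : M →ₗ[k] N where
  toFun := f
  map_add' := hf.map_add
  map_smul' := hf.map_smul

@[fun_prop] theorem id : IsLin k (fun x : M => x) := ⟨fun _ _ => rfl, fun _ _ => rfl⟩

@[fun_prop] theorem comp {f : N → P} {g : M → N} (hf : IsLin k f) (hg : IsLin k g) :
    IsLin k (fun x => f (g x)) :=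
  ⟨fun x y => by rw [hg.map_add, hf.map_add], fun r x => by rw [hg.map_smul, hf.map_smul]⟩

@[fun_prop] theorem linearMap (f : M →ₗ[k] N) : IsLin k (fun x => f x) :=
  ⟨f.map_add, f.map_smul⟩

@[fun_prop] theorem linearMap_left (y : N) : IsLin k (fun f : N →ₗ[k] P => f y) :=
  ⟨fun _ _ => rfl, fun _ _ => rfl⟩

@[fun_prop] theorem moduleEnd_left (y : N) : IsLin k (fun f : Module.End k N => f y) :=
  ⟨fun _ _ => rfl, fun _ _ => rfl⟩

@[fun_prop] theorem tmul_right (n : N) {f : M → P} (hf : IsLin k f) :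
    IsLin k (fun x => n ⊗ₜ[k] f x) :=
  ⟨fun x y => by rw [hf.map_add, TensorProduct.tmul_add],
    fun s x => by rw [hf.map_smul, TensorProduct.tmul_smul]⟩

@[fun_prop] theorem tmul_left {f : M → N} (hf : IsLin k f) (p : P) :
    IsLin k (fun x => f x ⊗ₜ[k] p) :=
  ⟨fun x y => by rw [hf.map_add, TensorProduct.add_tmul],
    fun s x => by rw [hf.map_smul, TensorProduct.smul_tmul']⟩

section
variable {B C : Type*} [Semiring B] [Algebra k B] [Semiring C] [Algebra k C]

@[fun_prop] theorem algHom (f : B →ₐ[k] C) : IsLin k (fun x => f x) :=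
  ⟨_root_.map_add f, _root_.map_smul f⟩

@[fun_prop] theorem const_mul (b : B) {f : M → B} (hf : IsLin k f) :
    IsLin k (fun x => b * f x) :=
  ⟨fun x y => by rw [hf.map_add, mul_add], fun s x => by rw [hf.map_smul, mul_smul_comm]⟩

@[fun_prop] theorem mul_const {f : M → B} (hf : IsLin k f) (b : B) :
    IsLin k (fun x => f x * b) :=
  ⟨fun x y => by rw [hf.map_add, add_mul], fun s x => by rw [hf.map_smul, smul_mul_assoc]⟩

@[fun_prop] theorem op {f : M → B} (hf : IsLin k f) : IsLin k (fun x => MulOpposite.op (f x)) :=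
  ⟨fun x y => by rw [hf.map_add, MulOpposite.op_add],
    fun s x => by rw [hf.map_smul, MulOpposite.op_smul]⟩

end

@[fun_prop] theorem mkQ {k M N : Type*} [Ring k] [AddCommGroup M] [Module k M] [AddCommMonoid N]
    [Module k N] (S : Submodule k M) {f : N → M} (hf : IsLin k f) :
    IsLin k (fun x => (Submodule.Quotient.mk (f x) : M ⧸ S)) :=
  ⟨fun x y => by rw [hf.map_add, Submodule.Quotient.mk_add],
    fun s x => by rw [hf.map_smul, Submodule.Quotient.mk_smul]⟩

end IsLin

variable {k H M N : Type*} [Field k] [AddCommGroup M] [Module k M] [AddCommGroup N] [Module k N]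

section
variable [AddCommGroup H] [Module k H] [Coalgebra k H]

variable (k) in
/-- The Sweedler sum `f h₁ h₂`, for a bilinear function `f`. -/
noncomputable def sweedler (h : H) (f : H → H → M) : M :=
  ∑ i ∈ (ℛ k h).index, f ((ℛ k h).left i) ((ℛ k h).right i)

theorem sweedler_eq_lift (h : H) (f : H →ₗ[k] H →ₗ[k] M) :
    sweedler k h (fun a b => f a b) = TensorProduct.lift f (comul h) := by
  rw [← (ℛ k h).eq, map_sum]
  rfl

/-- The bilinear map with underlying function `f`. -/
def bilin {H' : Type*} [AddCommGroup H'] [Module k H'] (f : H → H' → M)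
    (h₁ : ∀ b, IsLin k (fun a => f a b)) (h₂ : ∀ a, IsLin k (f a)) :
    H →ₗ[k] H' →ₗ[k] M :=
  LinearMap.mk₂ k f (fun a b c => (h₁ c).map_add a b) (fun r a b => (h₁ b).map_smul r a)
    (fun a b c => (h₂ a).map_add b c) (fun r a b => (h₂ a).map_smul r b)

/-- `sweedler` uses a chosen representative of the coproduct and makes sense for any f. Bilinearity
is what makes the value depend on the coproduct alone, which is why the rules below carry linearity
hypotheses in each slot. -/
theorem sweedler_eq (h : H) (f : H → H → M) (h₁ : ∀ b, IsLin k (fun a => f a b))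
    (h₂ : ∀ a, IsLin k (f a)) :
    sweedler k h f = TensorProduct.lift (bilin f h₁ h₂) (comul h) :=
  sweedler_eq_lift h (bilin f h₁ h₂)

@[fun_prop] theorem IsLin.sweedler_const {X : Type*} [AddCommGroup X] [Module k X] (h : H)
    {F : X → H → H → M} (hF : ∀ a b, IsLin k (fun x => F x a b)) :
    IsLin k (fun x => sweedler k h (F x)) :=
  ⟨fun x y => by simp only [sweedler, (hF _ _).map_add, Finset.sum_add_distrib],
    fun r x => by simp only [sweedler, (hF _ _).map_smul, Finset.smul_sum]⟩

@[fun_prop] theorem IsLin.sweedler_arg {X : Type*} [AddCommGroup X] [Module k X] {g : X → H}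
    (hg : IsLin k g) {f : H → H → M} (h₁ : ∀ b, IsLin k (fun a => f a b))
    (h₂ : ∀ a, IsLin k (fun b => f a b)) :
    IsLin k (fun x => sweedler k (g x) f) :=
  ⟨fun x y => by simp only [sweedler_eq _ f h₁ h₂, hg.map_add, _root_.map_add],
    fun r x => by simp only [sweedler_eq _ f h₁ h₂, hg.map_smul, _root_.map_smul]⟩

theorem map_sweedler {X Y F : Type*} [AddCommGroup X] [AddCommGroup Y] [FunLike F X Y]
    [AddMonoidHomClass F X Y] (φ : F) (h : H) (f : H → H → X) : φ (sweedler k h f) = sweedler k h (fun a b => φ (f a b)) :=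
  map_sum φ _ _

theorem IsLin.map_sweedler {φ : M → N} (hφ : IsLin k φ) (h : H) (f : H → H → M) :
    φ (sweedler k h f) = sweedler k h (fun a b => φ (f a b)) :=
  _root_.map_sweedler hφ.toLinearMap h f

theorem mul_sweedler {B : Type*} [Ring B] [Algebra k B] (b : B) (h : H) (f : H → H → B) :
    b * sweedler k h f = sweedler k h (fun x y => b * f x y) := Finset.mul_sum _ _ _

theorem sweedler_mul {B : Type*} [Ring B] [Algebra k B] (b : B) (h : H) (f : H → H → B) :
    sweedler k h f * b = sweedler k h (fun x y => f x y * b) := Finset.sum_mul _ _ _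

theorem tmul_sweedler (n : N) (h : H) (f : H → H → M) :
    n ⊗ₜ[k] sweedler k h f = sweedler k h (fun x y => n ⊗ₜ f x y) := TensorProduct.tmul_sum _ _ _

theorem sweedler_tmul (n : N) (h : H) (f : H → H → M) :
    sweedler k h f ⊗ₜ[k] n = sweedler k h (fun x y => f x y ⊗ₜ n) := TensorProduct.sum_tmul _ _ _

theorem comul_eq_sweedler (h : H) : comul (R := k) h = sweedler k h (fun a b => a ⊗ₜ b) :=
  (ℛ k h).eq.symm

theorem sweedler_eq_sum {ι : Type*} (h : H) (r : Coalgebra.Repr k h ι) (f : H → H → M)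
    (h₁ : ∀ b, IsLin k (fun a => f a b)) (h₂ : ∀ a, IsLin k (f a)) :
    sweedler k h f = ∑ i ∈ r.index, f (r.left i) (r.right i) := by
  rw [sweedler_eq h f h₁ h₂, ← r.eq, map_sum]
  rfl

/-- No linearity is needed: both sides are finite double sums over the same fixed representatives.
-/
theorem sweedler_comm {H' X : Type*} [AddCommGroup H'] [Module k H'] [Coalgebra k H']
    [AddCommGroup X] (h : H) (g : H') (f : H → H → H' → H' → X) :
    sweedler k h (fun a b => sweedler k g (fun c d => f a b c d)) =
      sweedler k g (fun c d => sweedler k h (fun a b => f a b c d)) := Finset.sum_comm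

/-- A trilinear f factors through a linear map on H ⊗ (H ⊗ H), which is applied to the
coassociativity identity for chosen representatives. -/
theorem sweedler_assoc (h : H) (f : H → H → H → M) (h₁ : ∀ b c, IsLin k (fun a => f a b c))
    (h₂ : ∀ a c, IsLin k (fun b => f a b c)) (h₃ : ∀ a b, IsLin k (fun c => f a b c)) :
    sweedler k h (fun a b => sweedler k a (fun a₁ a₂ => f a₁ a₂ b)) =
      sweedler k h (fun a b => sweedler k b (fun b₁ b₂ => f a b₁ b₂)) := by
  let g : H →ₗ[k] H →ₗ[k] H →ₗ[k] M := bilin (fun a b => (h₃ a b).toLinearMap)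
    (fun b => ⟨fun _ _ => LinearMap.ext fun c => (h₁ b c).map_add _ _,
      fun _ _ => LinearMap.ext fun c => (h₁ b c).map_smul _ _⟩)
    (fun a => ⟨fun _ _ => LinearMap.ext fun c => (h₂ a c).map_add _ _,
      fun _ _ => LinearMap.ext fun c => (h₂ a c).map_smul _ _⟩)
  let F : H ⊗[k] (H ⊗[k] H) →ₗ[k] M := TensorProduct.lift (TensorProduct.lift g) ∘ₗ
    (TensorProduct.assoc k H H H).symm.toLinearMap
  have hF : ∀ a b c, F (a ⊗ₜ (b ⊗ₜ c)) = f a b c := fun _ _ _ => rfl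
  have e := congr(F $(sum_tmul_tmul_eq (ℛ k h) (fun i => ℛ k ((ℛ k h).left i))
    (fun i => ℛ k ((ℛ k h).right i))))
  simp only [map_sum, hF] at e
  exact e

theorem sweedler_counit_left (h : H) (f : H → M) (hf : IsLin k f) :
    sweedler k h (fun a b => counit (R := k) a • f b) = f h := by
  have := congr(TensorProduct.lid k M ((hf.toLinearMap).lTensor k $(sum_counit_tmul_eq (ℛ k h))))
  simp only [map_sum, LinearMap.lTensor_tmul, TensorProduct.lid_tmul, one_smul] at this
  exact this

theorem sweedler_counit_right (h : H) (f : H → M) (hf : IsLin k f) :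
    sweedler k h (fun a b => counit (R := k) b • f a) = f h := by
  have := congr(TensorProduct.rid k M ((hf.toLinearMap).rTensor k $(sum_tmul_counit_eq (ℛ k h))))
  simp only [map_sum, LinearMap.rTensor_tmul, TensorProduct.rid_tmul, one_smul] at this
  exact this

end

section
variable [Ring H] [HopfAlgebra k H]

theorem sweedler_one (f : H → H → M) (h₁ : ∀ b, IsLin k (fun a => f a b))
    (h₂ : ∀ a, IsLin k (fun b => f a b)) : sweedler k (1 : H) f = f 1 1 := by
  rw [sweedler_eq _ f h₁ h₂, Bialgebra.comul_one]
  rfl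

theorem sweedler_product (h g : H) (f : H → H → M) (h₁ : ∀ b, IsLin k (fun a => f a b))
    (h₂ : ∀ a, IsLin k (fun b => f a b)) : sweedler k (h * g) f =
      sweedler k h (fun a b => sweedler k g (fun c d => f (a * c) (b * d))) := by
  rw [sweedler_eq _ f h₁ h₂, Bialgebra.comul_mul]
  conv_lhs => rw [← (ℛ k h).eq, ← (ℛ k g).eq]
  simp only [Finset.sum_mul_sum, map_sum, Algebra.TensorProduct.tmul_mul_tmul]
  rfl

/-- The antipode reverses the coproduct (`comul_antipode`). -/
theorem sweedler_antipode (h : H) (f : H → H → M) (h₁ : ∀ b, IsLin k (fun a => f a b))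
    (h₂ : ∀ a, IsLin k (fun b => f a b)) : sweedler k (antipode k h) f =
      sweedler k h (fun a b => f (antipode k b) (antipode k a)) := by
  rw [sweedler_eq _ f h₁ h₂]
  rw [comul_antipode]
  conv_lhs => rw [← (ℛ k h).eq]
  simp only [map_sum]
  rfl

theorem sweedler_antipode_mul (h : H) (f : H → M) (hf : IsLin k f) :
    sweedler k h (fun a b => f (antipode k a * b)) = counit (R := k) h • f 1 := by
  rw [← hf.map_smul, ← sum_antipode_mul_eq_smul (ℛ k h)]
  exact (hf.map_sweedler h _).symm

theorem sweedler_mul_antipode (h : H) (f : H → M) (hf : IsLin k f) :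
    sweedler k h (fun a b => f (a * antipode k b)) = counit (R := k) h • f 1 := by
  rw [← hf.map_smul, ← sum_mul_antipode_eq_smul (ℛ k h)]
  exact (hf.map_sweedler h _).symm

variable (h : H) (f : H → H → M)

/-- `f h₁ (S h₂ h₃) = f h 1` -/
theorem sweedler_right_antipode_mul (h₁ : ∀ b, IsLin k (fun a => f a b))
    (h₂ : ∀ a, IsLin k (fun b => f a b)) :
    sweedler k h (fun a b => sweedler k b (fun c d => f a (antipode k c * d))) = f h 1 := by
  simp only [sweedler_antipode_mul _ _ (h₂ _)]
  exact sweedler_counit_right h (fun a => f a 1) (h₁ 1)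

/-- `f h₁ (h₂ S h₃) = f h 1` -/
theorem sweedler_right_mul_antipode (h₁ : ∀ b, IsLin k (fun a => f a b))
    (h₂ : ∀ a, IsLin k (fun b => f a b)) :
    sweedler k h (fun a b => sweedler k b (fun c d => f a (c * antipode k d))) = f h 1 := by
  simp only [sweedler_mul_antipode _ _ (h₂ _)]
  exact sweedler_counit_right h (fun a => f a 1) (h₁ 1)

/-- `f (S h₁ h₂) h₃ = f 1 h` -/
theorem sweedler_left_antipode_mul (h₁ : ∀ b, IsLin k (fun a => f a b))
    (h₂ : ∀ a, IsLin k (fun b => f a b)) :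
    sweedler k h (fun a b => sweedler k b (fun c d => f (antipode k a * c) d)) = f 1 h := by
  -- Rebracketing puts S h₁ and h₂ into one coproduct, where the antipode axiom applies.
  rw [← sweedler_assoc h (fun a b c => f (antipode k a * b) c) (by intros; fun_prop)
    (by intros; fun_prop) (by intros; fun_prop)]
  simp only [sweedler_antipode_mul _ (fun x => f x _) (h₁ _)]
  exact sweedler_counit_left h (fun a => f 1 a) (h₂ 1)

/-- `f (h₁ S h₂) h₃ = f 1 h` -/
theorem sweedler_left_mul_antipode (h₁ : ∀ b, IsLin k (fun a => f a b))
    (h₂ : ∀ a, IsLin k (fun b => f a b)) :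
    sweedler k h (fun a b => sweedler k b (fun c d => f (a * antipode k c) d)) = f 1 h := by
  rw [← sweedler_assoc h (fun a b c => f (a * antipode k b) c) (by intros; fun_prop)
    (by intros; fun_prop) (by intros; fun_prop)]
  simp only [sweedler_mul_antipode _ (fun x => f x _) (h₁ _)]
  exact sweedler_counit_left h (fun a => f 1 a) (h₂ 1)

end
end Sweedler

/-! ### Representations of A^e # H and their universal property -/

section Smash
open Coalgebra HopfAlgebra MulOpposite

variable {k H A : Type*} [Field k] [Ring H] [HopfAlgebra k H] [Ring A] [Algebra k A]

@[fun_prop] theorem IsLin.act_left (𝒜 : HopfModuleAlgebra k H A) {M : Type*} [AddCommGroup M]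
    [Module k M] {f : M → H} (hf : IsLin k f) (a : A) : IsLin k (fun x => 𝒜.act (f x) a) :=
  ⟨fun x y => by simp [hf.map_add], fun r x => by simp [hf.map_smul]⟩

@[fun_prop] theorem IsLin.act_right (𝒜 : HopfModuleAlgebra k H A) {M : Type*} [AddCommGroup M]
    [Module k M] {f : M → A} (hf : IsLin k f) (h : H) : IsLin k (fun x => 𝒜.act h (f x)) :=
  ⟨fun x y => by simp [hf.map_add], fun r x => by simp [hf.map_smul]⟩

theorem HopfModuleAlgebra.act_mul_eq_sweedler (𝒜 : HopfModuleAlgebra k H A) (h : H) (a b : A) :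
    𝒜.act h (a * b) = sweedler k h fun h₁ h₂ => 𝒜.act h₁ a * 𝒜.act h₂ b := by
  rw [𝒜.act_mul, comul_eq_sweedler, map_sweedler, map_sweedler]
  rfl

/-- Algebra maps `s : A → B`, `t : A^op → B` and `j : H → B` with commuting `s` and `t` that satisfy
the cross relations `j(h) s(a) = s(h₁ ▷ a) j(h₂)` and `t(b) j(h) = j(h₁) t(S h₂ ▷ b)` of `A^e # H`. -/
structure SmashRep (𝒜 : HopfModuleAlgebra k H A) (B : Type*) [Ring B] [Algebra k B] where
  s : A →ₐ[k] B
  t : Aᵐᵒᵖ →ₐ[k] B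
  j : H →ₐ[k] B
  comm : ∀ a b, s a * t b = t b * s a
  j_mul_s : ∀ h a, j h * s a = sweedler k h fun h₁ h₂ => s (𝒜.act h₁ a) * j h₂
  t_mul_j : ∀ b h, t (op b) * j h =
    sweedler k h fun h₁ h₂ => j h₁ * t (op (𝒜.act (antipode k h₂) b))

namespace SmashRep
variable {𝒜 : HopfModuleAlgebra k H A} {B : Type*} [Ring B] [Algebra k B] (R : SmashRep 𝒜 B)

@[fun_prop] theorem _root_.IsLin.smashRep_s {M : Type*} [AddCommGroup M] [Module k M] {f : M → A}
    (hf : IsLin k f) : IsLin k (fun x => R.s (f x)) :=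
  ⟨fun x y => by simp [hf.map_add], fun r x => by simp [hf.map_smul]⟩

@[fun_prop] theorem _root_.IsLin.smashRep_j {M : Type*} [AddCommGroup M] [Module k M] {f : M → H}
    (hf : IsLin k f) : IsLin k (fun x => R.j (f x)) :=
  ⟨fun x y => by simp [hf.map_add], fun r x => by simp [hf.map_smul]⟩

@[fun_prop] theorem _root_.IsLin.smashRep_t {M : Type*} [AddCommGroup M] [Module k M] {f : M → A}
    (hf : IsLin k f) : IsLin k (fun x => R.t (op (f x))) :=
  ⟨fun x y => by simp [hf.map_add], fun r x => by simp [hf.map_smul]⟩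

/-- `b ⊗ b' ⊗ h ↦ s(b) j(h) t(b')` -/
noncomputable def eval : A ⊗[k] (A ⊗[k] H) →ₗ[k] B :=
  LinearMap.mul' k B ∘ₗ TensorProduct.map R.s.toLinearMap
    (LinearMap.mul' k B ∘ₗ TensorProduct.map R.j.toLinearMap
      (R.t.toLinearMap ∘ₗ (opLinearEquiv k).toLinearMap) ∘ₗ (TensorProduct.comm k A H).toLinearMap)

theorem eval_tmul (b b' : A) (h : H) : R.eval (b ⊗ₜ (b' ⊗ₜ h)) = R.s b * R.j h * R.t (op b') := by
  simp [eval, mul_assoc]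

/-- This inverts the relation `t_mul_j`: substituting it on the right produces S(h₂) h₃ acting on b,
which collapses. -/
theorem j_mul_t (h : H) (b : A) :
    R.j h * R.t (op b) = sweedler k h fun h₁ h₂ => R.t (op (𝒜.act h₂ b)) * R.j h₁ := by
  simp only [R.t_mul_j]
  rw [sweedler_assoc h (fun p q r => R.j p * R.t (op (𝒜.act (antipode k q) (𝒜.act r b))))
    (by intros; fun_prop) (by intros; fun_prop) (by intros; fun_prop)]
  simp only [← Module.End.mul_apply, ← map_mul]
  rw [sweedler_right_antipode_mul h (fun p q => R.j p * R.t (op (𝒜.act q b)))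
    (by intros; fun_prop) (by intros; fun_prop)]
  simp

/-- The right side is the product formula of A^e # H, so the normal forms s(b) j(h) t(b') multiply
in the same way in every representation. Only the two inner pairs j(h) s(c) and t(b') j(g) have to
be exchanged. -/
theorem mul_eq (b b' c c' : A) (h g : H) :
    R.s b * R.j h * R.t (op b') * (R.s c * R.j g * R.t (op c')) =
      sweedler k h fun h₁ h₂ => sweedler k g fun g₁ g₂ =>
        R.s (b * 𝒜.act h₁ c) * R.j (h₂ * g₁) * R.t (op (c' * 𝒜.act (antipode k g₂) b')) := by
  calc _ = R.s b * (R.j h * R.s c) * (R.t (op b') * R.j g) * R.t (op c') := by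
        simp only [mul_assoc]
        rw [← mul_assoc (R.t (op b')) (R.s c), ← R.comm]
        simp only [mul_assoc]
    _ = _ := by
        simp only [R.j_mul_s, R.t_mul_j, mul_sweedler, sweedler_mul, map_mul, op_mul, mul_assoc]
        exact sweedler_comm g h _

/-- `B` is spanned by the `s(b) j(h) t(b')` and is isomorphic to `A^e # H`. -/
def IsUniversal : Prop := Function.Bijective R.eval

section
variable {R} (hR : R.IsUniversal)
include hR

theorem IsUniversal.induction {p : B → Prop} (hp : ∀ b h b', p (R.s b * R.j h * R.t (op b')))
    (ha : ∀ x y, p x → p y → p (x + y)) (x : B) : p x := by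
  obtain ⟨z, rfl⟩ := hR.2 x
  induction z with
  | zero => simpa using hp 0 0 0
  | add z w hz hw => rw [map_add]; exact ha _ _ hz hw
  | tmul b z =>
    induction z with
    | zero => simpa using hp 0 0 0
    | add z w hz hw => rw [TensorProduct.tmul_add, map_add]; exact ha _ _ hz hw
    | tmul b' h => rw [eval_tmul]; exact hp b h b'

theorem IsUniversal.linearMap_ext {M : Type*} [AddCommGroup M] [Module k M] {f g : B →ₗ[k] M}
    (h : ∀ b h b', f (R.s b * R.j h * R.t (op b')) = g (R.s b * R.j h * R.t (op b'))) : f = g :=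
  LinearMap.ext fun x => hR.induction (p := fun x => f x = g x) h
    (fun x y hx hy => by rw [map_add, map_add, hx, hy]) x

end

/-- The linear isomorphism `A ⊗ A ⊗ H → B`. -/
noncomputable def IsUniversal.equiv {R : SmashRep 𝒜 B} (hR : R.IsUniversal) :
    A ⊗[k] (A ⊗[k] H) ≃ₗ[k] B := LinearEquiv.ofBijective R.eval hR

theorem IsUniversal.algHom_ext {R : SmashRep 𝒜 B} (hR : R.IsUniversal) {C : Type*} [Semiring C]
    [Algebra k C] {f g : B →ₐ[k] C} (hs : ∀ b, f (R.s b) = g (R.s b))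
    (hj : ∀ h, f (R.j h) = g (R.j h)) (ht : ∀ b, f (R.t (op b)) = g (R.t (op b))) : f = g :=
  AlgHom.ext fun x => hR.induction (p := fun x => f x = g x)
    (fun b h b' => by simp only [map_mul, hs, hj, ht])
    (fun x y hx hy => by rw [map_add, map_add, hx, hy]) x

/-- The universal property of `A^e # H`. -/
noncomputable def IsUniversal.lift {R : SmashRep 𝒜 B} (hR : R.IsUniversal) {C : Type*} [Ring C]
    [Algebra k C] (R' : SmashRep 𝒜 C) : B →ₐ[k] C :=
  have e : ∀ z, (R'.eval ∘ₗ hR.equiv.symm.toLinearMap) (R.eval z) = R'.eval z := fun z =>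
    congr(R'.eval $(hR.equiv.symm_apply_apply z))
  have e' : ∀ b h b', (R'.eval ∘ₗ hR.equiv.symm.toLinearMap) (R.s b * R.j h * R.t (op b')) =
      R'.s b * R'.j h * R'.t (op b') := fun b h b' => by
    rw [← eval_tmul, ← eval_tmul]; exact e (b ⊗ₜ (b' ⊗ₜ h))
  AlgHom.ofLinearMap (R'.eval ∘ₗ hR.equiv.symm.toLinearMap)
    (by
      have := e' 1 1 1
      simpa using this)
    (by
      intro x y
      induction x using hR.induction with
      | ha x y hx hy => rw [add_mul, map_add, map_add, hx, hy, add_mul]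
      | hp b h b' =>
        induction y using hR.induction with
        | ha x y hx hy => rw [mul_add, map_add, map_add, hx, hy, mul_add]
        | hp c g c' =>
          -- Source and target obey the same product formula, so multiplicativity is checked summand
          -- by summand.
          rw [mul_eq, e', e', mul_eq]
          simp only [map_sweedler, e'])

section
variable {R : SmashRep 𝒜 B} (hR : R.IsUniversal) {C : Type*} [Ring C] [Algebra k C]
  (R' : SmashRep 𝒜 C)

theorem IsUniversal.lift_apply (b : A) (h : H) (b' : A) :
    hR.lift R' (R.s b * R.j h * R.t (op b')) = R'.s b * R'.j h * R'.t (op b') :=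
  by
  rw [← eval_tmul, ← eval_tmul]
  exact congr(R'.eval $(hR.equiv.symm_apply_apply (b ⊗ₜ (b' ⊗ₜ h))))

@[simp] theorem IsUniversal.lift_s (b : A) : hR.lift R' (R.s b) = R'.s b := by
  simpa using hR.lift_apply R' b 1 1

@[simp] theorem IsUniversal.lift_j (h : H) : hR.lift R' (R.j h) = R'.j h := by
  simpa using hR.lift_apply R' 1 h 1

@[simp] theorem IsUniversal.lift_t (b : Aᵐᵒᵖ) : hR.lift R' (R.t b) = R'.t b := by
  simpa using hR.lift_apply R' 1 1 (unop b)

theorem IsUniversal.lift_eval (z : A ⊗[k] (A ⊗[k] H)) : hR.lift R' (R.eval z) = R'.eval z :=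
  congr(R'.eval $(hR.equiv.symm_apply_apply z))

end

/-- The representation on `A` in which `s` and `t` are the multiplications and `j` the action. -/
noncomputable def base (𝒜 : HopfModuleAlgebra k H A) : SmashRep 𝒜 (Module.End k A) where
  s := Algebra.lmul k A
  t := AlgHom.ofLinearMap ((LinearMap.mul k A).flip ∘ₗ (opLinearEquiv k).symm.toLinearMap)
    (by ext; simp) (by intro x y; ext; simp [mul_assoc])
  j := 𝒜.act
  comm a b := by ext; simp [mul_assoc]
  j_mul_s h a := by
    ext b
    rw [IsLin.map_sweedler (φ := fun f : Module.End k A => f b) (by fun_prop)]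
    exact 𝒜.act_mul_eq_sweedler h a b
  t_mul_j b h := by
    ext a
    rw [IsLin.map_sweedler (φ := fun f : Module.End k A => f a) (by fun_prop)]
    simp only [AlgHom.ofLinearMap_apply, Module.End.mul_apply, LinearMap.comp_apply,
      LinearEquiv.coe_coe, coe_opLinearEquiv_symm, unop_op, LinearMap.flip_apply,
      LinearMap.mul_apply', 𝒜.act_mul_eq_sweedler]
    -- By the module algebra axiom the right side is (h₁ ▷ a) (h₂ S(h₃) ▷ b), which reduces to (h ▷
    -- a) b.
    rw [sweedler_assoc h (fun p q r => 𝒜.act p a * 𝒜.act q (𝒜.act (antipode k r) b))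
      (by intros; fun_prop) (by intros; fun_prop) (by intros; fun_prop)]
    simp only [← Module.End.mul_apply, ← map_mul]
    rw [sweedler_right_mul_antipode h (fun p q => 𝒜.act p a * 𝒜.act q b)
      (by intros; fun_prop) (by intros; fun_prop)]
    simp

end SmashRep
end Smash

/-! ### Representations of A # H in B, and the induced representation of A^e # H in B ⊗ B^op -/

section Crossed
open Coalgebra HopfAlgebra MulOpposite
variable {k H A : Type*} [Field k] [Ring H] [HopfAlgebra k H] [Ring A] [Algebra k A]

variable (k H) in
/-- The antipode as an algebra map to the opposite algebra. -/
noncomputable def antipodeOp : H →ₐ[k] Hᵐᵒᵖ :=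
  AlgHom.ofLinearMap ((opLinearEquiv k).toLinearMap ∘ₗ antipode k) (by simp)
    (by intro x y; simp [antipode_mul_antidistrib])

/-- Algebra maps `s : A → B`, `j : H → B` that satisfy the cross relations
`j(h) s(a) = s(h₁ ▷ a) j(h₂)` of `A # H`. -/
structure CrossedRep (𝒜 : HopfModuleAlgebra k H A) (B : Type*) [Ring B] [Algebra k B] where
  s : A →ₐ[k] B
  j : H →ₐ[k] B
  j_mul_s : ∀ h a, j h * s a = sweedler k h fun h₁ h₂ => s (𝒜.act h₁ a) * j h₂

namespace CrossedRep
variable {𝒜 : HopfModuleAlgebra k H A} {B : Type*} [Ring B] [Algebra k B] (R : CrossedRep 𝒜 B)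

@[fun_prop] theorem _root_.IsLin.crossedRep_s {M : Type*} [AddCommGroup M] [Module k M] {f : M → A}
    (hf : IsLin k f) : IsLin k (fun x => R.s (f x)) :=
  ⟨fun x y => by simp [hf.map_add], fun r x => by simp [hf.map_smul]⟩

@[fun_prop] theorem _root_.IsLin.crossedRep_j {M : Type*} [AddCommGroup M] [Module k M] {f : M → H}
    (hf : IsLin k f) : IsLin k (fun x => R.j (f x)) :=
  ⟨fun x y => by simp [hf.map_add], fun r x => by simp [hf.map_smul]⟩

/-- `h ↦ j(h₁) ⊗ j(S h₂)` -/
noncomputable def transJ : H →ₐ[k] B ⊗[k] Bᵐᵒᵖ :=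
  (Algebra.TensorProduct.map R.j ((AlgHom.op R.j).comp (antipodeOp k H))).comp
    (Bialgebra.comulAlgHom k H)

theorem transJ_apply (h : H) :
    R.transJ h = sweedler k h fun h₁ h₂ => R.j h₁ ⊗ₜ op (R.j (antipode k h₂)) := by
  simp only [transJ, AlgHom.comp_apply, Bialgebra.comulAlgHom_apply]
  rw [comul_eq_sweedler, map_sweedler]
  rfl

/-- The representation of `A^e # H` with `s(a) = s(a) ⊗ 1`, `t(a) = 1 ⊗ s(a)` and
`j(h) = j(h₁) ⊗ j(S h₂)`. -/
noncomputable def trans : SmashRep 𝒜 (B ⊗[k] Bᵐᵒᵖ) where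
  s := Algebra.TensorProduct.includeLeft.comp R.s
  t := Algebra.TensorProduct.includeRight.comp (AlgHom.op R.s)
  j := R.transJ
  comm a b := by simp
  j_mul_s h a := by
    simp only [transJ_apply, mul_sweedler, sweedler_mul, AlgHom.comp_apply,
      Algebra.TensorProduct.includeLeft_apply, Algebra.TensorProduct.tmul_mul_tmul, mul_one,
      R.j_mul_s, sweedler_tmul, one_mul]
    exact sweedler_assoc h (fun p q r => (R.s (𝒜.act p a) * R.j q) ⊗ₜ op (R.j (antipode k r)))
      (by intros; fun_prop) (by intros; fun_prop) (by intros; fun_prop)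
  t_mul_j b h := by
    simp only [transJ_apply, mul_sweedler, sweedler_mul, AlgHom.comp_apply,
      Algebra.TensorProduct.includeRight_apply, Algebra.TensorProduct.tmul_mul_tmul, mul_one,
      AlgHom.op_apply_apply, unop_op, ← op_mul,
      R.j_mul_s, one_mul]
    -- In the opposite factor the claim is the cross relation j(S h₂) s(b) = s(S h₃ ▷ b) j(S h₂):
    -- the antipode reverses the coproduct.
    rw [sweedler_assoc h (fun p q r => R.j p ⊗ₜ
        op (R.s (𝒜.act (antipode k r) b) * R.j (antipode k q)))
      (by intros; fun_prop) (by intros; fun_prop) (by intros; fun_prop)]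
    congr! 3 with p q
    rw [sweedler_antipode q (fun x y => R.s (𝒜.act x b) * R.j y) (by intros; fun_prop)
      (by intros; fun_prop)]
    exact (IsLin.map_sweedler (φ := fun x => R.j p ⊗ₜ[k] op x) (by fun_prop) q _)

end CrossedRep

end Crossed

/-! ### Maps out of balanced tensor products -/

section BalancedLift
variable {k B M N P : Type*} [CommRing k] [AddCommGroup M] [Module k M] [AddCommGroup N] [Module k N]
  [AddCommGroup P] [Module k P] {r : B → M → M} {l : B → N → N}

theorem balancedRel_mk_eq (b : B) (m : M) (n : N) :
    (Submodule.Quotient.mk (r b m ⊗ₜ[k] n) : BalancedTensor k r l) =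
      Submodule.Quotient.mk (m ⊗ₜ[k] l b n) :=
  (Submodule.Quotient.eq _).2 (Submodule.subset_span ⟨b, m, n, rfl⟩)

theorem balancedRel_le_ker (F : M ⊗[k] N →ₗ[k] P)
    (hF : ∀ b m n, F (r b m ⊗ₜ n) = F (m ⊗ₜ l b n)) : balancedRel k r l ≤ LinearMap.ker F := by
  rw [balancedRel, Submodule.span_le]
  rintro _ ⟨b, m, n, rfl⟩
  rw [SetLike.mem_coe, LinearMap.mem_ker, map_sub, hF, sub_self]

/-- A linear map on `M ⊗ N` with `F(m b ⊗ n) = F(m ⊗ b n)` factors through `M ⊗_B N`. -/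
def balancedLift (F : M ⊗[k] N →ₗ[k] P) (hF : ∀ b m n, F (r b m ⊗ₜ n) = F (m ⊗ₜ l b n)) :
    BalancedTensor k r l →ₗ[k] P :=
  Submodule.liftQ _ F (balancedRel_le_ker F hF)

end BalancedLift

/-! ### The bialgebroid structure carried by a universal representation -/

section Bialg
open Coalgebra HopfAlgebra MulOpposite
variable {k H A L : Type*} [Field k] [Ring H] [HopfAlgebra k H] [Ring A] [Algebra k A]
  [Ring L] [Algebra k L]

section
variable (s : A →ₐ[k] L) (t : Aᵐᵒᵖ →ₐ[k] L)

theorem takeuchiMk_t_tmul (b : A) (X Y : L) :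
    takeuchiMk s t ((t (op b) * X) ⊗ₜ Y) = takeuchiMk s t (X ⊗ₜ (s b * Y)) :=
  balancedRel_mk_eq (r := fun (b : A) (X : L) => t (op b) * X) (l := fun b Y => s b * Y) b X Y

theorem takeuchiMk_t_mul (b : A) (z : L ⊗[k] L) :
    takeuchiMk s t ((t (op b) ⊗ₜ 1) * z) = takeuchiMk s t ((1 ⊗ₜ s b) * z) := by
  induction z with
  | zero => simp
  | add z w hz hw => rw [mul_add, mul_add, map_add, map_add, hz, hw]
  | tmul X Y => simpa using takeuchiMk_t_tmul s t b X Y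

/-- Right multiplication always descends to L ⊗_A L, because the balancing relation is given by left
multiplication with t(b) ⊗ 1 and 1 ⊗ s(b). Left multiplication does not descend in general;
`takeuchiAlgebra` collects the elements for which it does. -/
theorem takeuchiMk_mul_right {w w' : L ⊗[k] L} (h : takeuchiMk s t w = takeuchiMk s t w')
    (v : L ⊗[k] L) : takeuchiMk s t (w * v) = takeuchiMk s t (w' * v) := by
  let F : TakeuchiTensor s t →ₗ[k] TakeuchiTensor s t := balancedLift
    (takeuchiMk s t ∘ₗ LinearMap.mulRight k v) (by
      intro b X Y
      have := takeuchiMk_t_mul s t b ((X ⊗ₜ Y) * v)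
      simpa [← mul_assoc] using this)
  exact congr(F $h)

/-- The elements `w` of `L ⊗ L` for which `X ⊗_B Y ↦ w (X ⊗ Y)` is well defined on `L ⊗_B L`. -/
def takeuchiAlgebra : Subalgebra k (L ⊗[k] L) where
  carrier := {w | ∀ v v', takeuchiMk s t v = takeuchiMk s t v' →
    takeuchiMk s t (w * v) = takeuchiMk s t (w * v')}
  mul_mem' {a b} ha hb v v' h := by
    simp only [mul_assoc]
    exact ha _ _ (hb _ _ h)
  add_mem' {a b} ha hb v v' h := by
    rw [add_mul, add_mul, map_add, map_add, ha _ _ h, hb _ _ h]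
  algebraMap_mem' r v v' h := by
    simp only [← Algebra.smul_def, map_smul, h]

theorem mem_takeuchiAlgebra {w : L ⊗[k] L} (h : ∀ b X Y,
    takeuchiMk s t (w * ((t (op b) * X) ⊗ₜ Y)) = takeuchiMk s t (w * (X ⊗ₜ (s b * Y)))) :
    w ∈ takeuchiAlgebra s t := by
  intro v v' e
  let F : TakeuchiTensor s t →ₗ[k] TakeuchiTensor s t := balancedLift
    (takeuchiMk s t ∘ₗ LinearMap.mulLeft k w) h
  exact congr(F $e)

theorem takeuchiTripleLeft_mk_tmul (z : L ⊗[k] L) (Y : L) :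
    takeuchiTripleLeft s t (takeuchiMk s t z ⊗ₜ Y) =
      Submodule.Quotient.mk (TensorProduct.assoc k L L L (z ⊗ₜ Y)) := rfl

theorem takeuchiTripleRight_tmul_mk (z : L ⊗[k] L) (X : L) :
    takeuchiTripleRight s t (X ⊗ₜ takeuchiMk s t z) = Submodule.Quotient.mk (X ⊗ₜ z) := rfl

/-- Since Δ(t(b) X) = (1 ⊗ t(b)) Δ X, this identity is what lets Δ ⊗ id descend to L ⊗_A L. The
mirror statement `takeuchiTriple_right` does the same for id ⊗ Δ. -/
theorem takeuchiTriple_left (b : A) (z : L ⊗[k] L) (Y : L) :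
    takeuchiTripleLeft s t (takeuchiMk s t ((1 ⊗ₜ t (op b)) * z) ⊗ₜ Y) =
      takeuchiTripleLeft s t (takeuchiMk s t z ⊗ₜ (s b * Y)) := by
  simp only [takeuchiTripleLeft_mk_tmul]
  induction z with
  | zero => simp
  | add z w hz hw => simp only [mul_add, TensorProduct.add_tmul, map_add, Submodule.Quotient.mk_add, hz, hw]
  | tmul X X' =>
    refine (Submodule.Quotient.eq _).2 (Submodule.subset_span (Or.inr ⟨b, X, X', Y, ?_⟩))
    simp

theorem takeuchiTriple_right (b : A) (z : L ⊗[k] L) (X : L) :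
    takeuchiTripleRight s t ((t (op b) * X) ⊗ₜ takeuchiMk s t z) =
      takeuchiTripleRight s t (X ⊗ₜ takeuchiMk s t ((s b ⊗ₜ 1) * z)) := by
  simp only [takeuchiTripleRight_tmul_mk]
  induction z with
  | zero => simp
  | add z w hz hw => simp only [mul_add, TensorProduct.tmul_add, Submodule.Quotient.mk_add, hz, hw]
  | tmul Y Y' =>
    refine (Submodule.Quotient.eq _).2 (Submodule.subset_span (Or.inl ⟨b, X, Y, Y', ?_⟩))
    simp

end

namespace SmashRep
variable {𝒜 : HopfModuleAlgebra k H A} {R : SmashRep 𝒜 L}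

section
variable (R)

/-- `h ↦ j(h₁) ⊗ j(h₂)` -/
noncomputable def diagJ : H →ₐ[k] L ⊗[k] L :=
  (Algebra.TensorProduct.map R.j R.j).comp (Bialgebra.comulAlgHom k H)

theorem diagJ_apply (h : H) : R.diagJ h = sweedler k h fun h₁ h₂ => R.j h₁ ⊗ₜ R.j h₂ := by
  simp only [diagJ, AlgHom.comp_apply, Bialgebra.comulAlgHom_apply]
  rw [comul_eq_sweedler, map_sweedler]
  rfl

/-- The representation on `L ⊗ L` with `s(a) = s(a) ⊗ 1`, `t(a) = 1 ⊗ t(a)` and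
`j(h) = j(h₁) ⊗ j(h₂)`. -/
noncomputable def diag : SmashRep 𝒜 (L ⊗[k] L) where
  s := Algebra.TensorProduct.includeLeft.comp R.s
  t := Algebra.TensorProduct.includeRight.comp R.t
  j := R.diagJ
  comm a b := by simp
  j_mul_s h a := by
    simp only [diagJ_apply, mul_sweedler, sweedler_mul, AlgHom.comp_apply,
      Algebra.TensorProduct.includeLeft_apply, Algebra.TensorProduct.tmul_mul_tmul, mul_one,
      R.j_mul_s, sweedler_tmul, one_mul]
    exact sweedler_assoc h (fun p q r => (R.s (𝒜.act p a) * R.j q) ⊗ₜ R.j r)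
      (by intros; fun_prop) (by intros; fun_prop) (by intros; fun_prop)
  t_mul_j b h := by
    simp only [diagJ_apply, mul_sweedler, sweedler_mul, AlgHom.comp_apply,
      Algebra.TensorProduct.includeRight_apply, Algebra.TensorProduct.tmul_mul_tmul, mul_one,
      R.t_mul_j, tmul_sweedler, one_mul]
    exact (sweedler_assoc h (fun p q r => R.j p ⊗ₜ
      (R.j q * R.t (op (𝒜.act (antipode k r) b))))
      (by intros; fun_prop) (by intros; fun_prop) (by intros; fun_prop)).symm

theorem diag_s (a : A) : R.diag.s a = R.s a ⊗ₜ 1 := rfl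
theorem diag_t (a : Aᵐᵒᵖ) : R.diag.t a = 1 ⊗ₜ R.t a := rfl
theorem diag_j (h : H) : R.diag.j h = sweedler k h fun h₁ h₂ => R.j h₁ ⊗ₜ R.j h₂ := R.diagJ_apply h

/-- Membership in a subalgebra may be tested on s(b) ⊗ 1, 1 ⊗ t(b') and j(h₁) ⊗ j(h₂). The first two
commute with the elements of the balancing relation; the third is where the cross relations are
needed. -/
theorem diag_mem (x : A ⊗[k] (A ⊗[k] H)) : R.diag.eval x ∈ takeuchiAlgebra R.s R.t := by
  induction x with
  | zero => simp
  | add x y hx hy => rw [map_add]; exact add_mem hx hy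
  | tmul b x =>
  induction x with
  | zero => simp
  | add x y hx hy => rw [TensorProduct.tmul_add, map_add]; exact add_mem hx hy
  | tmul b' h =>
  rw [eval_tmul]
  refine mul_mem (mul_mem ?_ ?_) ?_
  · refine mem_takeuchiAlgebra _ _ fun a X Y => ?_
    simp only [diag_s, Algebra.TensorProduct.tmul_mul_tmul, ← mul_assoc, R.comm, one_mul]
    rw [mul_assoc, takeuchiMk_t_tmul]
  -- Moving t(a) left through j(h₁) creates t(h₂ ▷ a), and moving s(a) left through j(h₂) creates
  -- s(h₂ ▷ a). After balancing, both sides are j(h₁) X ⊗ s(h₂ ▷ a) j(h₃) Y.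
  · refine mem_takeuchiAlgebra _ _ fun a X Y => ?_
    simp only [diag_j, sweedler_mul, map_sweedler, Algebra.TensorProduct.tmul_mul_tmul,
      ← mul_assoc, j_mul_t, j_mul_s]
    simp only [map_sweedler, mul_assoc, takeuchiMk_t_tmul, sweedler_tmul,
      tmul_sweedler]
    exact sweedler_assoc h (fun p q r => takeuchiMk R.s R.t
        ((R.j p * X) ⊗ₜ (R.s (𝒜.act q a) * (R.j r * Y)))) (by intros; unfold takeuchiMk; fun_prop)
        (by intros; unfold takeuchiMk; fun_prop) (by intros; unfold takeuchiMk; fun_prop)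
  · refine mem_takeuchiAlgebra _ _ fun a X Y => ?_
    simp only [diag_t, Algebra.TensorProduct.tmul_mul_tmul, ← mul_assoc, ← R.comm, one_mul]
    rw [takeuchiMk_t_tmul, mul_assoc]

end

variable (hR : R.IsUniversal)

/-- The algebra map `L → L ⊗ L` that represents the coproduct. -/
noncomputable def IsUniversal.comulAlgHom : L →ₐ[k] L ⊗[k] L := hR.lift R.diag

theorem IsUniversal.comulAlgHom_mem (X : L) : hR.comulAlgHom X ∈ takeuchiAlgebra R.s R.t := by
  obtain ⟨z, rfl⟩ := hR.2 X
  rw [comulAlgHom, lift_eval]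
  exact R.diag_mem z

/-- The action of `L` on `A`. -/
noncomputable def IsUniversal.action : L →ₐ[k] Module.End k A := hR.lift (base 𝒜)

theorem IsUniversal.comulAlgHom_apply (b : A) (h : H) (b' : A) :
    hR.comulAlgHom (R.s b * R.j h * R.t (op b')) =
      sweedler k h fun h₁ h₂ => (R.s b * R.j h₁) ⊗ₜ (R.j h₂ * R.t (op b')) := by
  rw [comulAlgHom, lift_apply, diag_s, diag_t, diag_j]
  simp only [mul_sweedler, sweedler_mul, Algebra.TensorProduct.tmul_mul_tmul, one_mul, mul_one]

@[simp] theorem IsUniversal.comulAlgHom_s (b : A) : hR.comulAlgHom (R.s b) = R.s b ⊗ₜ 1 :=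
  hR.lift_s _ b
@[simp] theorem IsUniversal.comulAlgHom_t (b : Aᵐᵒᵖ) : hR.comulAlgHom (R.t b) = 1 ⊗ₜ R.t b :=
  hR.lift_t _ b
theorem IsUniversal.comulAlgHom_j (h : H) :
    hR.comulAlgHom (R.j h) = sweedler k h fun h₁ h₂ => R.j h₁ ⊗ₜ R.j h₂ :=
  (hR.lift_j _ h).trans (R.diag_j h)

@[simp] theorem IsUniversal.action_s (a b : A) : hR.action (R.s a) b = a * b :=
  DFunLike.congr_fun (hR.lift_s (base 𝒜) a) b
@[simp] theorem IsUniversal.action_t (a : Aᵐᵒᵖ) (b : A) : hR.action (R.t a) b = b * unop a :=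
  DFunLike.congr_fun (hR.lift_t (base 𝒜) a) b
@[simp] theorem IsUniversal.action_j (h : H) (b : A) : hR.action (R.j h) b = 𝒜.act h b :=
  DFunLike.congr_fun (hR.lift_j (base 𝒜) h) b

/-- Both sides are algebra maps in X, so it suffices to compare them on s, j and t. The identity
holds over k, before any balancing. -/
theorem IsUniversal.coassoc (X : L) :
    TensorProduct.assoc k L L L (hR.comulAlgHom.toLinearMap.rTensor L (hR.comulAlgHom X)) =
      hR.comulAlgHom.toLinearMap.lTensor L (hR.comulAlgHom X) := by
  have e : ((Algebra.TensorProduct.assoc k k k L L L).toAlgHom.comp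
      (Algebra.TensorProduct.map hR.comulAlgHom (AlgHom.id k L))).comp hR.comulAlgHom =
      (Algebra.TensorProduct.map (AlgHom.id k L) hR.comulAlgHom).comp hR.comulAlgHom := by
    refine hR.algHom_ext (fun b => ?_) (fun h => ?_) fun b => ?_
    · simp [Algebra.TensorProduct.one_def]
    · simp only [AlgHom.comp_apply, comulAlgHom_j, map_sweedler, Algebra.TensorProduct.map_tmul,
        sweedler_tmul, tmul_sweedler, AlgHom.id_apply]
      exact sweedler_assoc h (fun p q r => R.j p ⊗ₜ[k] (R.j q ⊗ₜ[k] R.j r)) (by intros; fun_prop)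
        (by intros; fun_prop) (by intros; fun_prop)
    · simp [Algebra.TensorProduct.one_def]
  exact congr($e X)

/-- `Δ X` as an element of `L ⊗_B L` -/
noncomputable def IsUniversal.comul : L →ₗ[k] TakeuchiTensor R.s R.t :=
  takeuchiMk R.s R.t ∘ₗ hR.comulAlgHom.toLinearMap

theorem IsUniversal.comul_apply (X : L) :
    hR.comul X = takeuchiMk R.s R.t (hR.comulAlgHom X) := rfl

/-- `ε X = X ▷ 1` -/
noncomputable def IsUniversal.counit : L →ₗ[k] A :=
  LinearMap.applyₗ 1 ∘ₗ hR.action.toLinearMap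

theorem IsUniversal.counit_apply (X : L) : hR.counit X = hR.action X 1 := rfl

/-- The left representative can be replaced because right multiplication descends, and the right one
because `comulAlgHom X` lies in `takeuchiAlgebra`. For the chosen representatives the claim is
multiplicativity of `comulAlgHom`. -/
theorem IsUniversal.comul_mul_aux (X Y : L) (w v : L ⊗[k] L)
    (hw : takeuchiMk R.s R.t w = hR.comul X) (hv : takeuchiMk R.s R.t v = hR.comul Y) :
    hR.comul (X * Y) = takeuchiMk R.s R.t (w * v) := by
  rw [comul_apply] at hw hv ⊢
  rw [takeuchiMk_mul_right R.s R.t hw, hR.comulAlgHom_mem X _ _ hv, map_mul]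

theorem IsUniversal.comul_t_mul (b : A) (X : L) :
    hR.comul (R.t (op b) * X) = takeuchiMk R.s R.t ((1 ⊗ₜ R.t (op b)) * hR.comulAlgHom X) := by
  simp [comul_apply]

theorem IsUniversal.comul_s_mul (b : A) (X : L) :
    hR.comul (R.s b * X) = takeuchiMk R.s R.t ((R.s b ⊗ₜ 1) * hR.comulAlgHom X) := by
  simp [comul_apply]

/-- The bialgebroid structure on an algebra isomorphic to `A^e # H`. -/
noncomputable def IsUniversal.leftBialgebroid : LeftBialgebroid k A L where
  s := R.s
  t := R.t
  comm := R.comm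
  comul := hR.comul
  counit := hR.counit
  comul_bimodule a b X w hw := by
    rw [hR.comul_mul_aux (R.s a * R.t (op b)) X (R.s a ⊗ₜ R.t (op b)) w ?_ hw]
    simp [comul_apply]
  counit_bimodule a b X := by
    simp [counit_apply, mul_assoc, R.comm]
  coassoc X w hw := by
    -- The axiom concerns an arbitrary representative w. The maps F and G show that each side
    -- depends only on the class of w, after which w may be replaced by `comulAlgHom X`.
    let F : TakeuchiTensor R.s R.t →ₗ[k] _ := balancedLift
      (takeuchiTripleLeft R.s R.t ∘ₗ hR.comul.rTensor L) (by
        intro b X Y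
        simp only [LinearMap.comp_apply, LinearMap.rTensor_tmul, comul_t_mul]
        rw [takeuchiTriple_left]
        rfl)
    let G : TakeuchiTensor R.s R.t →ₗ[k] _ := balancedLift
      (takeuchiTripleRight R.s R.t ∘ₗ hR.comul.lTensor L) (by
        intro b X Y
        simp only [LinearMap.comp_apply, LinearMap.lTensor_tmul, comul_s_mul]
        rw [← takeuchiTriple_right]
        rfl)
    have hF : ∀ z : L ⊗[k] L, takeuchiTripleLeft R.s R.t (hR.comul.rTensor L z) =
        Submodule.Quotient.mk (TensorProduct.assoc k L L L
          (hR.comulAlgHom.toLinearMap.rTensor L z)) := fun z => by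
      induction z with
      | zero => simp
      | add z w hz hw => simp only [map_add, hz, hw, Submodule.Quotient.mk_add]
      | tmul X Y => rfl
    have hG : ∀ z : L ⊗[k] L, takeuchiTripleRight R.s R.t (hR.comul.lTensor L z) =
        Submodule.Quotient.mk (hR.comulAlgHom.toLinearMap.lTensor L z) := fun z => by
      induction z with
      | zero => simp
      | add z w hz hw => simp only [map_add, hz, hw, Submodule.Quotient.mk_add]
      | tmul X Y => rfl
    calc _ = F (takeuchiMk R.s R.t w) := rfl
      _ = takeuchiTripleLeft R.s R.t (hR.comul.rTensor L (hR.comulAlgHom X)) := by rw [hw]; rfl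
      _ = takeuchiTripleRight R.s R.t (hR.comul.lTensor L (hR.comulAlgHom X)) := by
        rw [hF, hG, hR.coassoc]
      _ = G (hR.comul X) := rfl
      _ = _ := by rw [← hw]; rfl
  counit_left X w hw := by
    let F : TakeuchiTensor R.s R.t →ₗ[k] L := balancedLift
      (LinearMap.mul' k L ∘ₗ (R.s.toLinearMap ∘ₗ hR.counit).rTensor L) (by
        intro b X Y
        simp [counit_apply, mul_assoc])
    have e : F ∘ₗ hR.comul = LinearMap.id := hR.linearMap_ext fun b h b' => by
      -- On a normal form the first leg is s(b) j(h₁), whose counit is ε(h₁) b; the counit axiom of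
      -- H finishes.
      have : F (hR.comul (R.s b * R.j h * R.t (op b'))) =
        sweedler k h fun h₁ h₂ => R.s (hR.counit (R.s b * R.j h₁)) * (R.j h₂ * R.t (op b')) := by
          rw [comul_apply, comulAlgHom_apply, map_sweedler, map_sweedler]
          rfl
      rw [LinearMap.comp_apply, this]
      simp only [counit_apply, map_mul, Module.End.mul_apply, action_j, action_s, 𝒜.act_one]
      simp only [Algebra.algebraMap_eq_smul_one, map_smul, map_one, mul_smul_comm,
        smul_mul_assoc, mul_one]
      simpa [mul_assoc] using sweedler_counit_left h (fun q => R.s b * (R.j q * R.t (op b')))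
        (by fun_prop)
    calc _ = F (takeuchiMk R.s R.t w) := rfl
      _ = X := by rw [hw]; exact congr($e X)
  counit_right X w hw := by
    let F : TakeuchiTensor R.s R.t →ₗ[k] L := balancedLift
      (LinearMap.mul' k L ∘ₗ (TensorProduct.comm k L L).toLinearMap ∘ₗ
        (R.t.toLinearMap ∘ₗ (opLinearEquiv k).toLinearMap ∘ₗ hR.counit).lTensor L) (by
        intro b X Y
        simp [counit_apply, mul_assoc])
    have e : F ∘ₗ hR.comul = LinearMap.id := hR.linearMap_ext fun b h b' => by
      have : F (hR.comul (R.s b * R.j h * R.t (op b'))) =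
        sweedler k h fun h₁ h₂ =>
          R.t (op (hR.counit (R.j h₂ * R.t (op b')))) * (R.s b * R.j h₁) := by
          rw [comul_apply, comulAlgHom_apply, map_sweedler, map_sweedler]
          rfl
      rw [LinearMap.comp_apply, this]
      simp only [counit_apply, map_mul, Module.End.mul_apply, action_j, action_t, one_mul, unop_op,
        ← mul_assoc, ← R.comm]
      -- What remains is the sum of t(h₂ ▷ b') j(h₁), which is j(h) t(b') by `j_mul_t`.
      simp only [mul_assoc, ← mul_sweedler, j_mul_t, LinearMap.id_apply]
    calc _ = F (takeuchiMk R.s R.t w) := rfl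
      _ = X := by rw [hw]; exact congr($e X)
  takeuchi a X w hw := by
    rw [takeuchiMk_mul_right R.s R.t hw, takeuchiMk_mul_right R.s R.t hw]
    -- t(a) ⊗ 1 and 1 ⊗ s(a) have the same class in L ⊗_A L, and left multiplication by the
    -- coproduct respects classes.
    refine hR.comulAlgHom_mem X _ _ ?_
    simpa using takeuchiMk_t_tmul R.s R.t a 1 1
  comul_one := by rw [comul_apply, map_one]
  comul_mul := hR.comul_mul_aux
  counit_one := by simp [counit_apply]
  counit_mul_s X Y := by simp [counit_apply]
  counit_mul_t X Y := by simp [counit_apply]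

end SmashRep
end Bialg

/-! ### The Galois map, isomorphisms, and A^e # H as a universal representation -/

section HopfAndIso
open Coalgebra HopfAlgebra MulOpposite
variable {k H A L : Type*} [Field k] [Ring H] [HopfAlgebra k H] [Ring A] [Algebra k A]
  [Ring L] [Algebra k L]

namespace SmashRep
variable {𝒜 : HopfModuleAlgebra k H A} {R : SmashRep 𝒜 L} (hR : R.IsUniversal)

/-- The representation of `A # H` underlying one of `A^e # H`. -/
def toCrossedRep (R : SmashRep 𝒜 L) : CrossedRep 𝒜 L where
  s := R.s
  j := R.j
  j_mul_s := R.j_mul_s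

/-- The algebra map `X ↦ X₊ ⊗ X₋`. -/
noncomputable def IsUniversal.transAlgHom : L →ₐ[k] L ⊗[k] Lᵐᵒᵖ := hR.lift R.toCrossedRep.trans

theorem IsUniversal.transAlgHom_apply (b : A) (h : H) (b' : A) :
    hR.transAlgHom (R.s b * R.j h * R.t (op b')) =
      sweedler k h fun h₁ h₂ =>
        (R.s b * R.j h₁) ⊗ₜ op (R.s b' * R.j (antipode k h₂)) := by
  rw [transAlgHom, lift_apply]
  change (R.s b ⊗ₜ 1) * R.toCrossedRep.transJ h * (1 ⊗ₜ op (R.s b')) = _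
  rw [CrossedRep.transJ_apply]
  simp only [mul_sweedler, sweedler_mul, Algebra.TensorProduct.tmul_mul_tmul, one_mul, mul_one]
  rfl

theorem IsUniversal.transAlgHom_t (b : A) : hR.transAlgHom (R.t (op b)) = 1 ⊗ₜ op (R.s b) :=
  hR.lift_t _ _

/-- `L ⊗_{A^op} L` -/
abbrev OpTensor (R : SmashRep 𝒜 L) : Type _ :=
  BalancedTensor k (fun (b : A) (X : L) => X * R.t (op b)) (fun (b : A) (Y : L) => R.t (op b) * Y)

/-- `X ⊗ Y ↦ X₁ ⊗ X₂ Y` -/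
noncomputable def IsUniversal.galois : R.OpTensor →ₗ[k] TakeuchiTensor R.s R.t :=
  balancedLift (takeuchiMk R.s R.t ∘ₗ LinearMap.mul' k (L ⊗[k] L) ∘ₗ
    TensorProduct.map hR.comulAlgHom.toLinearMap (TensorProduct.mk k L L 1)) (by
      intro b X Y
      simp [mul_assoc])

theorem IsUniversal.galois_mk (X Y : L) : hR.galois (Submodule.Quotient.mk (X ⊗ₜ Y)) =
    takeuchiMk R.s R.t (hR.comulAlgHom X * (1 ⊗ₜ Y)) := rfl

/-- `X ⊗ Y ↦ X₊ ⊗ X₋ Y` -/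
noncomputable def IsUniversal.galoisInv : TakeuchiTensor R.s R.t →ₗ[k] R.OpTensor :=
  balancedLift (Submodule.mkQ _ ∘ₗ (opLinearEquiv k).symm.toLinearMap.lTensor L ∘ₗ
    LinearMap.mul' k (L ⊗[k] Lᵐᵒᵖ) ∘ₗ (TensorProduct.comm k _ _).toLinearMap ∘ₗ
    TensorProduct.map hR.transAlgHom.toLinearMap
      (TensorProduct.mk k L Lᵐᵒᵖ 1 ∘ₗ (opLinearEquiv k).toLinearMap)) (by
      -- The map X ↦ X₊ ⊗ X₋ is multiplicative and sends t(b) to 1 ⊗ s(b), so t(b) X ⊗ Y goes to X₊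
      -- ⊗ X₋ s(b) Y, as X ⊗ s(b) Y does.
      intro b X Y
      simp [← mul_assoc, transAlgHom_t])

theorem IsUniversal.galoisInv_mk (b : A) (h : H) (b' : A) (Y : L) :
    hR.galoisInv (takeuchiMk R.s R.t ((R.s b * R.j h * R.t (op b')) ⊗ₜ Y)) =
      sweedler k h fun h₁ h₂ =>
        Submodule.Quotient.mk ((R.s b * R.j h₁) ⊗ₜ (R.s b' * R.j (antipode k h₂) * Y)) := by
  have e : hR.galoisInv (takeuchiMk R.s R.t ((R.s b * R.j h * R.t (op b')) ⊗ₜ Y)) =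
      Submodule.mkQ _ ((opLinearEquiv k).symm.toLinearMap.lTensor L
        ((1 ⊗ₜ op Y) * hR.transAlgHom (R.s b * R.j h * R.t (op b')))) := rfl
  rw [e, transAlgHom_apply]
  simp only [mul_sweedler, map_sweedler, Algebra.TensorProduct.tmul_mul_tmul, one_mul]
  rfl

/-- On a normal form the H-legs become h₁ ⊗ S(h₂) h₃, which collapses to h ⊗ 1. The factor t(b')
then sits in the second leg and is moved back by the balancing over A^op. -/
theorem IsUniversal.galoisInv_galois : hR.galoisInv ∘ₗ hR.galois = LinearMap.id := by
  apply Submodule.linearMap_qext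
  apply TensorProduct.ext
  refine hR.linearMap_ext fun b h b' => LinearMap.ext fun Y => ?_
  change hR.galoisInv (hR.galois (Submodule.Quotient.mk ((R.s b * R.j h * R.t (op b')) ⊗ₜ Y))) =
    Submodule.Quotient.mk ((R.s b * R.j h * R.t (op b')) ⊗ₜ Y)
  rw [galois_mk, comulAlgHom_apply]
  simp only [sweedler_mul, map_sweedler, Algebra.TensorProduct.tmul_mul_tmul, mul_one]
  have e : ∀ p q, hR.galoisInv (takeuchiMk R.s R.t ((R.s b * R.j p) ⊗ₜ
      (R.j q * R.t (op b') * Y))) = sweedler k p fun h₁ h₂ =>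
        Submodule.Quotient.mk ((R.s b * R.j h₁) ⊗ₜ (R.j (antipode k h₂ * q) * (R.t (op b') * Y))) :=
    fun p q => by simpa [mul_assoc] using hR.galoisInv_mk b p 1 (R.j q * R.t (op b') * Y)
  simp only [e]
  rw [sweedler_assoc h (fun p q r => (Submodule.Quotient.mk ((R.s b * R.j p) ⊗ₜ
      (R.j (antipode k q * r) * (R.t (op b') * Y))) : R.OpTensor)) (by intros; fun_prop)
      (by intros; fun_prop) (by intros; fun_prop),
    sweedler_right_antipode_mul h (fun p q => (Submodule.Quotient.mk ((R.s b * R.j p) ⊗ₜ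
      (R.j q * (R.t (op b') * Y))) : R.OpTensor)) (by intros; fun_prop) (by intros; fun_prop)]
  rw [map_one, one_mul]
  exact (balancedRel_mk_eq (r := fun (b : A) (X : L) => X * R.t (op b))
    (l := fun b Y => R.t (op b) * Y) b' (R.s b * R.j h) Y).symm

/-- Now the H-legs become h₁ ⊗ h₂ S(h₃), but s(b') stands between h₂ and S(h₃) and must first be
moved out of the way. -/
theorem IsUniversal.galois_galoisInv : hR.galois ∘ₗ hR.galoisInv = LinearMap.id := by
  apply Submodule.linearMap_qext
  apply TensorProduct.ext
  refine hR.linearMap_ext fun b h b' => LinearMap.ext fun Y => ?_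
  change hR.galois (hR.galoisInv (takeuchiMk R.s R.t ((R.s b * R.j h * R.t (op b')) ⊗ₜ Y))) =
    takeuchiMk R.s R.t ((R.s b * R.j h * R.t (op b')) ⊗ₜ Y)
  rw [galoisInv_mk]
  simp only [map_sweedler, galois_mk]
  have e : ∀ p q, takeuchiMk R.s R.t (hR.comulAlgHom (R.s b * R.j p) *
      (1 ⊗ₜ (R.s b' * R.j (antipode k q) * Y))) = sweedler k p fun p₁ p₂ =>
        takeuchiMk R.s R.t ((R.s b * R.j p₁ * R.t (op b')) ⊗ₜ (R.j (p₂ * antipode k q) * Y)) := by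
    intro p q
    -- By the Takeuchi property, to the right of the coproduct 1 ⊗ s(b') can be traded for t(b') ⊗
    -- 1. This frees the product h₂ S(h₃) and puts t(b') where the original normal form has it.
    have e₁ := hR.comulAlgHom_mem (R.s b * R.j p)
      (1 ⊗ₜ (R.s b' * R.j (antipode k q) * Y)) (R.t (op b') ⊗ₜ (R.j (antipode k q) * Y)) (by
        simpa [mul_assoc] using
          (takeuchiMk_t_tmul R.s R.t b' 1 (R.j (antipode k q) * Y)).symm)
    have e₂ := hR.comulAlgHom_apply b p 1
    rw [op_one, map_one, mul_one] at e₂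
    rw [e₁, e₂]
    simp only [sweedler_mul, map_sweedler, Algebra.TensorProduct.tmul_mul_tmul, mul_one, mul_assoc,
      map_mul]
  simp only [e]
  rw [sweedler_assoc h (fun p q r => takeuchiMk R.s R.t ((R.s b * R.j p * R.t (op b')) ⊗ₜ
      (R.j (q * antipode k r) * Y))) (by intros; fun_prop)
      (by intros; fun_prop) (by intros; fun_prop),
    sweedler_right_mul_antipode h (fun p q => takeuchiMk R.s R.t ((R.s b * R.j p * R.t (op b')) ⊗ₜ
      (R.j q * Y))) (by intros; fun_prop) (by intros; fun_prop)]
  rw [map_one, one_mul]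

theorem IsUniversal.isLeftHopf : hR.leftBialgebroid.IsLeftHopf := by
  refine ⟨LinearEquiv.ofLinearMap hR.galois hR.galoisInv hR.galois_galoisInv hR.galoisInv_galois,
    fun X Y w hw => ?_⟩
  exact (takeuchiMk_mul_right R.s R.t hw _).symm

/-- Δ and ε come from the algebra maps `comulAlgHom` and `action`. Intertwining these with Φ is an
equality of algebra maps, so it can be tested on s, j and t. -/
theorem IsUniversal.isIso {L' : Type*} [Ring L'] [Algebra k L'] {R' : SmashRep 𝒜 L'}
    (hR' : R'.IsUniversal) (Φ : L ≃ₐ[k] L') (hs : ∀ a, Φ (R.s a) = R'.s a)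
    (hj : ∀ h, Φ (R.j h) = R'.j h) (ht : ∀ a, Φ (R.t a) = R'.t a) :
    hR.leftBialgebroid.IsIso hR'.leftBialgebroid Φ := by
  refine ⟨hs, ht, fun X => ?_, fun X w hw => ?_⟩
  · have e : hR'.action.comp Φ.toAlgHom = hR.action := hR.algHom_ext
      (fun b => LinearMap.ext fun x => by simp [hs])
      (fun b => LinearMap.ext fun x => by simp [hj])
      (fun b => LinearMap.ext fun x => by simp [ht])
    exact congr($e X 1)
  · let F : TakeuchiTensor R.s R.t →ₗ[k] TakeuchiTensor R'.s R'.t := balancedLift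
      (takeuchiMk R'.s R'.t ∘ₗ TensorProduct.map Φ.toLinearMap Φ.toLinearMap) (by
        intro b X Y
        simpa [hs, ht] using takeuchiMk_t_tmul R'.s R'.t b (Φ X) (Φ Y))
    have e : hR'.comulAlgHom.comp Φ.toAlgHom =
        (Algebra.TensorProduct.map Φ.toAlgHom Φ.toAlgHom).comp hR.comulAlgHom :=
      hR.algHom_ext (fun b => by simp [hs])
        (fun h => by simp [hj, comulAlgHom_j, map_sweedler])
        (fun b => by simp [ht])
    calc _ = takeuchiMk R'.s R'.t ((hR'.comulAlgHom.comp Φ.toAlgHom) X) := rfl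
      _ = F (hR.comul X) := by rw [e]; rfl
      _ = _ := by
        change _ = F (takeuchiMk R.s R.t w)
        rw [← show takeuchiMk R.s R.t w = hR.comul X from hw]

end SmashRep

namespace HopfModuleAlgebra
variable (𝒜 : HopfModuleAlgebra k H A)

theorem CocycleSmash.tmul_mul_tmul_eq (b b' c c' : A) (h g : H) :
    tmul 𝒜 b b' h * tmul 𝒜 c c' g = sweedler k h fun h₁ h₂ => sweedler k g fun g₁ g₂ =>
      tmul 𝒜 (b * 𝒜.act h₁ c) (c' * 𝒜.act (antipode k g₂) b') (h₂ * g₁) :=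
  tmul_mul_tmul 𝒜 b b' c c' h g

@[fun_prop] theorem _root_.IsLin.cocycleSmash_tmul₁ {M : Type*} [AddCommGroup M] [Module k M]
    {f : M → A} (hf : IsLin k f) (b : A) (h : H) :
    IsLin k (fun x => CocycleSmash.tmul 𝒜 (f x) b h) :=
  ⟨fun x y => by rw [hf.map_add]; exact TensorProduct.add_tmul _ _ _,
    fun r x => by rw [hf.map_smul]; rfl⟩

@[fun_prop] theorem _root_.IsLin.cocycleSmash_tmul₂ {M : Type*} [AddCommGroup M] [Module k M]
    (b : A) {f : M → A} (hf : IsLin k f) (h : H) :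
    IsLin k (fun x => CocycleSmash.tmul 𝒜 b (f x) h) :=
  ⟨fun x y => by
    rw [hf.map_add, CocycleSmash.tmul, TensorProduct.add_tmul]; exact TensorProduct.tmul_add _ _ _,
    fun r x => by
      rw [hf.map_smul, CocycleSmash.tmul, ← TensorProduct.smul_tmul']
      exact TensorProduct.tmul_smul _ _ _⟩

@[fun_prop] theorem _root_.IsLin.cocycleSmash_tmul₃ {M : Type*} [AddCommGroup M] [Module k M]
    (b b' : A) {f : M → H} (hf : IsLin k f) : IsLin k (fun x => CocycleSmash.tmul 𝒜 b b' (f x)) :=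
  ⟨fun x y => by
    rw [hf.map_add, CocycleSmash.tmul, TensorProduct.tmul_add]; exact TensorProduct.tmul_add _ _ _,
    fun r x => by
      rw [hf.map_smul, CocycleSmash.tmul, TensorProduct.tmul_smul]
      exact TensorProduct.tmul_smul _ _ _⟩

/-- Here and in `mul_left_tmul` a trivial factor turns one of the two Sweedler sums into a counit.
These special cases carry most of the checks for `cocycleRep`. -/
theorem CocycleSmash.mul_right_tmul (b b' c' : A) (h : H) :
    tmul 𝒜 b b' h * tmul 𝒜 1 c' 1 = tmul 𝒜 b (c' * b') h := by
  rw [tmul_mul_tmul_eq]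
  have : ∀ p q, (sweedler k (1 : H) fun g₁ g₂ => tmul 𝒜 (b * 𝒜.act p 1)
      (c' * 𝒜.act (antipode k g₂) b') (q * g₁)) =
        counit (R := k) p • tmul 𝒜 b (c' * b') q := by
    intro p q
    rw [sweedler_one _ (by intros; fun_prop) (by intros; fun_prop)]
    rw [𝒜.act_one, antipode_one, map_one, Module.End.one_apply, Algebra.algebraMap_eq_smul_one,
      mul_smul_comm, mul_one, mul_one]
    rfl
  simp only [this]
  exact sweedler_counit_left h (fun q => tmul 𝒜 b (c' * b') q) (by fun_prop)

theorem CocycleSmash.mul_left_tmul (b c c' : A) (h g : H) :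
    tmul 𝒜 b 1 h * tmul 𝒜 c c' g =
      sweedler k h fun h₁ h₂ => tmul 𝒜 (b * 𝒜.act h₁ c) c' (h₂ * g) := by
  rw [tmul_mul_tmul_eq]
  congr! 3 with p q
  have : ∀ r s, tmul 𝒜 (b * 𝒜.act p c) (c' * 𝒜.act (antipode k s) 1) (q * r) =
      counit (R := k) s • tmul 𝒜 (b * 𝒜.act p c) c' (q * r) := by
    intro r s
    rw [𝒜.act_one, Algebra.algebraMap_eq_smul_one, mul_smul_comm, mul_one, counit_antipode]
    exact (IsLin.cocycleSmash_tmul₂ 𝒜 _ (f := fun x => x) (by fun_prop) _).map_smul _ _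
  simp only [this]
  exact sweedler_counit_right g (fun r => tmul 𝒜 (b * 𝒜.act p c) c' (q * r)) (by fun_prop)

/-- `A^e # H` as a representation of itself. -/
noncomputable def cocycleRep : SmashRep 𝒜 𝒜.CocycleSmash where
  s := AlgHom.ofLinearMap
    (IsLin.toLinearMap (k := k) (f := fun b => CocycleSmash.tmul 𝒜 b 1 1) (by fun_prop)) rfl
    (fun x y => by
      change CocycleSmash.tmul 𝒜 _ _ _ = CocycleSmash.tmul 𝒜 _ _ _ * CocycleSmash.tmul 𝒜 _ _ _
      rw [CocycleSmash.mul_left_tmul, sweedler_one _ (by intros; fun_prop) (by intros; fun_prop)]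
      simp)
  t := AlgHom.ofLinearMap
    (IsLin.toLinearMap (k := k) (f := fun b : A => CocycleSmash.tmul 𝒜 1 b 1) (by fun_prop) ∘ₗ
      (opLinearEquiv k).symm.toLinearMap) rfl
    (fun x y => by
      change CocycleSmash.tmul 𝒜 _ _ _ = CocycleSmash.tmul 𝒜 _ _ _ * CocycleSmash.tmul 𝒜 _ _ _
      rw [CocycleSmash.mul_right_tmul]
      simp)
  j := AlgHom.ofLinearMap
    (IsLin.toLinearMap (k := k) (f := fun h => CocycleSmash.tmul 𝒜 1 1 h) (by fun_prop)) rfl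
    (fun x y => by
      change CocycleSmash.tmul 𝒜 _ _ _ = CocycleSmash.tmul 𝒜 _ _ _ * CocycleSmash.tmul 𝒜 _ _ _
      rw [CocycleSmash.mul_left_tmul]
      simp only [𝒜.act_one, Algebra.algebraMap_eq_smul_one, mul_smul_comm, mul_one]
      exact (sweedler_counit_left x (fun r => CocycleSmash.tmul 𝒜 1 1 (r * y)) (by fun_prop)).symm)
  comm a b := by
    change CocycleSmash.tmul 𝒜 _ _ _ * CocycleSmash.tmul 𝒜 _ _ _ =
      CocycleSmash.tmul 𝒜 _ _ _ * CocycleSmash.tmul 𝒜 _ _ _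
    rw [CocycleSmash.mul_right_tmul, CocycleSmash.tmul_mul_tmul_eq,
      sweedler_one _ (by intros; fun_prop) (by intros; fun_prop),
      sweedler_one _ (by intros; fun_prop) (by intros; fun_prop)]
    simp
  j_mul_s h a := by
    change CocycleSmash.tmul 𝒜 _ _ _ * CocycleSmash.tmul 𝒜 _ _ _ = sweedler k h fun h₁ h₂ =>
      CocycleSmash.tmul 𝒜 _ _ _ * CocycleSmash.tmul 𝒜 _ _ _
    simp only [CocycleSmash.mul_left_tmul]
    congr! 3 with p q
    rw [sweedler_one _ (by intros; fun_prop) (by intros; fun_prop)]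
    simp
  t_mul_j b h := by
    change CocycleSmash.tmul 𝒜 _ _ _ * CocycleSmash.tmul 𝒜 _ _ _ = sweedler k h fun h₁ h₂ =>
      CocycleSmash.tmul 𝒜 _ _ _ * CocycleSmash.tmul 𝒜 _ _ _
    simp only [CocycleSmash.mul_right_tmul]
    rw [CocycleSmash.tmul_mul_tmul_eq,
      sweedler_one _ (by intros; fun_prop) (by intros; fun_prop)]
    simp

theorem cocycleRep_apply (b b' : A) (h : H) :
    𝒜.cocycleRep.s b * 𝒜.cocycleRep.j h * 𝒜.cocycleRep.t (op b') =
      CocycleSmash.tmul 𝒜 b b' h := by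
  change CocycleSmash.tmul 𝒜 _ _ _ * CocycleSmash.tmul 𝒜 _ _ _ * CocycleSmash.tmul 𝒜 _ _ _ = _
  rw [CocycleSmash.mul_left_tmul, sweedler_one _ (by intros; fun_prop) (by intros; fun_prop),
    CocycleSmash.mul_right_tmul]
  simp

/-- Since b ⊗ b' # h equals s(b) j(h) t(b') in A^e # H, the evaluation map is the identity of A ⊗ A
⊗ H. -/
theorem cocycleRep_isUniversal : 𝒜.cocycleRep.IsUniversal := by
  have : 𝒜.cocycleRep.eval = (LinearEquiv.refl k (A ⊗[k] (A ⊗[k] H))).toLinearMap := by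
    ext b b' h
    exact (𝒜.cocycleRep.eval_tmul b b' h).trans (𝒜.cocycleRep_apply b b' h)
  rw [SmashRep.IsUniversal, this]
  exact (LinearEquiv.refl k _).bijective

/-- The bialgebroid structure of `A^e # H`. -/
noncomputable def cocycleBialgebroid : LeftBialgebroid k A 𝒜.CocycleSmash :=
  𝒜.cocycleRep_isUniversal.leftBialgebroid

theorem isCocycleBialgebroid : 𝒜.IsCocycleBialgebroid 𝒜.cocycleBialgebroid where
  s_eq _ := rfl
  t_eq _ := rfl
  comul_eq b b' h ι r := by
    have := 𝒜.cocycleRep_isUniversal.comulAlgHom_apply b h b'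
    rw [cocycleRep_apply] at this
    refine congr(takeuchiMk 𝒜.cocycleRep.s 𝒜.cocycleRep.t $this).trans ?_
    rw [sweedler_eq_sum h r _ (by intros; fun_prop) (by intros; fun_prop)]
    congr! 4 with i
    · simpa using 𝒜.cocycleRep_apply b 1 (r.left i)
    · simpa using 𝒜.cocycleRep_apply 1 b' (r.right i)
  counit_eq b b' h := by
    rw [← cocycleRep_apply]
    change 𝒜.cocycleRep_isUniversal.counit _ = _
    simp [SmashRep.IsUniversal.counit_apply]

variable {L : Type*} [Ring L] [Algebra k L] {𝒜}

/-- The isomorphism of `A^e # H` with a universal representation. -/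
noncomputable def cocycleEquiv {R : SmashRep 𝒜 L} (hR : R.IsUniversal) :
    𝒜.CocycleSmash ≃ₐ[k] L :=
  AlgEquiv.ofAlgHom (𝒜.cocycleRep_isUniversal.lift R) (hR.lift 𝒜.cocycleRep)
    (hR.algHom_ext (by simp) (by simp) (by simp))
    (𝒜.cocycleRep_isUniversal.algHom_ext (by simp) (by simp) (by simp))

theorem cocycleEquiv_tmul {R : SmashRep 𝒜 L} (hR : R.IsUniversal) (b b' : A) (h : H) :
    cocycleEquiv hR (CocycleSmash.tmul 𝒜 b b' h) = R.s b * R.j h * R.t (op b') := by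
  rw [← cocycleRep_apply]
  exact 𝒜.cocycleRep_isUniversal.lift_apply R b h b'

theorem cocycleEquiv_isIso {R : SmashRep 𝒜 L} (hR : R.IsUniversal) :
    𝒜.cocycleBialgebroid.IsIso hR.leftBialgebroid (cocycleEquiv hR) :=
  𝒜.cocycleRep_isUniversal.isIso hR _ (𝒜.cocycleRep_isUniversal.lift_s R)
    (𝒜.cocycleRep_isUniversal.lift_j R) (𝒜.cocycleRep_isUniversal.lift_t R)

end HopfModuleAlgebra
end HopfAndIso

/-! ### The Hopf–Galois extension A ⊆ A # H -/

section SmashProductRep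
open Coalgebra HopfAlgebra MulOpposite
variable {k H A : Type*} [Field k] [Ring H] [HopfAlgebra k H] [Ring A] [Algebra k A]

namespace HopfModuleAlgebra
variable (𝒜 : HopfModuleAlgebra k H A)

theorem SmashProduct.tmul_mul_tmul_eq (b c : A) (h g : H) :
    tmul 𝒜 b h * tmul 𝒜 c g = sweedler k h fun h₁ h₂ => tmul 𝒜 (b * 𝒜.act h₁ c) (h₂ * g) :=
  tmul_mul_tmul 𝒜 b c h g

@[fun_prop] theorem _root_.IsLin.smashProduct_tmul₁ {M : Type*} [AddCommGroup M] [Module k M]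
    {f : M → A} (hf : IsLin k f) (h : H) : IsLin k (fun x => SmashProduct.tmul 𝒜 (f x) h) :=
  ⟨fun x y => by rw [hf.map_add]; exact TensorProduct.add_tmul _ _ _,
    fun r x => by rw [hf.map_smul]; rfl⟩

@[fun_prop] theorem _root_.IsLin.smashProduct_tmul₂ {M : Type*} [AddCommGroup M] [Module k M]
    (b : A) {f : M → H} (hf : IsLin k f) : IsLin k (fun x => SmashProduct.tmul 𝒜 b (f x)) :=
  ⟨fun x y => by rw [hf.map_add]; exact TensorProduct.tmul_add _ _ _,
    fun r x => by rw [hf.map_smul]; exact TensorProduct.tmul_smul _ _ _⟩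

theorem SmashProduct.tmul_one_mul_tmul (b c : A) (h : H) :
    tmul 𝒜 b 1 * tmul 𝒜 c h = tmul 𝒜 (b * c) h := by
  rw [tmul_mul_tmul_eq, sweedler_one _ (by intros; fun_prop) (by intros; fun_prop)]
  simp

theorem SmashProduct.tmul_mul_one_tmul (b : A) (h g : H) :
    tmul 𝒜 b h * tmul 𝒜 1 g = tmul 𝒜 b (h * g) := by
  rw [tmul_mul_tmul_eq]
  have : ∀ p q, tmul 𝒜 (b * 𝒜.act p 1) (q * g) = counit (R := k) p • tmul 𝒜 b (q * g) := by
    intro p q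
    rw [𝒜.act_one, Algebra.algebraMap_eq_smul_one, mul_smul_comm, mul_one]
    rfl
  simp only [this]
  exact sweedler_counit_left h (fun q => tmul 𝒜 b (q * g)) (by fun_prop)

theorem SmashProduct.induction {p : 𝒜.SmashProduct → Prop} (ht : ∀ a h, p (tmul 𝒜 a h))
    (ha : ∀ x y, p x → p y → p (x + y)) (x : 𝒜.SmashProduct) : p x := by
  induction x using TensorProduct.induction_on with
  | zero =>
    have := ht 0 0
    rwa [show tmul 𝒜 (0 : A) (0 : H) = 0 from TensorProduct.zero_tmul _ _] at this
  | tmul a h => exact ht a h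
  | add x y hx hy => exact ha x y hx hy

theorem SmashProduct.linearMap_ext {M : Type*} [AddCommGroup M] [Module k M]
    {f g : 𝒜.SmashProduct →ₗ[k] M} (h : ∀ a h, f (tmul 𝒜 a h) = g (tmul 𝒜 a h)) : f = g :=
  LinearMap.ext fun x => induction 𝒜 (p := fun x => f x = g x) h
    (fun x y hx hy => by rw [map_add, map_add, hx, hy]) x

/-- `A # H` as a representation of itself. -/
noncomputable def smashRep : CrossedRep 𝒜 𝒜.SmashProduct where
  s := AlgHom.ofLinearMap
    (IsLin.toLinearMap (k := k) (f := fun b => SmashProduct.tmul 𝒜 b 1) (by fun_prop)) rfl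
    (fun x y => (SmashProduct.tmul_one_mul_tmul 𝒜 x y 1).symm)
  j := AlgHom.ofLinearMap
    (IsLin.toLinearMap (k := k) (f := fun h => SmashProduct.tmul 𝒜 1 h) (by fun_prop)) rfl
    (fun x y => (SmashProduct.tmul_mul_one_tmul 𝒜 1 x y).symm)
  j_mul_s h a := by
    change SmashProduct.tmul 𝒜 _ _ * SmashProduct.tmul 𝒜 _ _ = sweedler k h fun h₁ h₂ =>
      SmashProduct.tmul 𝒜 _ _ * SmashProduct.tmul 𝒜 _ _
    simp only [SmashProduct.tmul_mul_one_tmul]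
    simp only [SmashProduct.tmul_mul_tmul_eq, mul_one, one_mul]

theorem smashRep_s (a : A) : 𝒜.smashRep.s a = SmashProduct.tmul 𝒜 a 1 := rfl
theorem smashRep_j (h : H) : 𝒜.smashRep.j h = SmashProduct.tmul 𝒜 1 h := rfl

theorem smashRep_apply (a : A) (h : H) :
    𝒜.smashRep.s a * 𝒜.smashRep.j h = SmashProduct.tmul 𝒜 a h := by
  rw [smashRep_s, smashRep_j, SmashProduct.tmul_mul_one_tmul, one_mul]

/-- The universal property of `A # H`. -/
noncomputable def smashLift {B : Type*} [Ring B] [Algebra k B] (R : CrossedRep 𝒜 B) :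
    𝒜.SmashProduct →ₐ[k] B :=
  let F : 𝒜.SmashProduct →ₗ[k] B :=
    LinearMap.mul' k B ∘ₗ TensorProduct.map R.s.toLinearMap R.j.toLinearMap
  have hF : ∀ a h, F (SmashProduct.tmul 𝒜 a h) = R.s a * R.j h := fun _ _ => rfl
  AlgHom.ofLinearMap F ((hF 1 1).trans (by simp)) (by
    intro x y
    induction x using SmashProduct.induction with
    | ha x y hx hy => rw [add_mul, map_add, map_add, hx, hy, add_mul]
    | ht a h =>
    induction y using SmashProduct.induction with
    | ha x y hx hy => rw [mul_add, map_add, map_add, hx, hy, mul_add]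
    | ht b g =>
    rw [hF, hF, SmashProduct.tmul_mul_tmul_eq, map_sweedler, mul_assoc (R.s a),
      ← mul_assoc (R.j h), R.j_mul_s]
    simp only [hF, sweedler_mul, mul_sweedler, map_mul, mul_assoc])

theorem smashLift_tmul {B : Type*} [Ring B] [Algebra k B] (R : CrossedRep 𝒜 B) (a : A) (h : H) :
    𝒜.smashLift R (SmashProduct.tmul 𝒜 a h) = R.s a * R.j h := rfl

/-- The representation `a ↦ a ⊗ 1`, `h ↦ h₁ ⊗ h₂` on `(A # H) ⊗ H`. -/
noncomputable def coactRep : CrossedRep 𝒜 (𝒜.SmashProduct ⊗[k] H) where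
  s := Algebra.TensorProduct.includeLeft.comp 𝒜.smashRep.s
  j := (Algebra.TensorProduct.map 𝒜.smashRep.j (AlgHom.id k H)).comp (Bialgebra.comulAlgHom k H)
  j_mul_s h a := by
    simp only [AlgHom.comp_apply, Bialgebra.comulAlgHom_apply]
    simp only [comul_eq_sweedler, map_sweedler, Algebra.TensorProduct.map_tmul, mul_sweedler,
      sweedler_mul, Algebra.TensorProduct.includeLeft_apply, Algebra.TensorProduct.tmul_mul_tmul,
      CrossedRep.j_mul_s, sweedler_tmul, one_mul, mul_one, AlgHom.id_apply]
    exact sweedler_assoc h (fun p q r => (𝒜.smashRep.s (𝒜.act p a) * 𝒜.smashRep.j q) ⊗ₜ[k] r)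
      (by intros; fun_prop) (by intros; fun_prop) (by intros; fun_prop)

theorem coact_tmul (a : A) (h : H) : 𝒜.smashLift 𝒜.coactRep (SmashProduct.tmul 𝒜 a h) =
    sweedler k h fun h₁ h₂ => SmashProduct.tmul 𝒜 a h₁ ⊗ₜ h₂ := by
  rw [smashLift_tmul]
  simp only [coactRep, AlgHom.comp_apply, Bialgebra.comulAlgHom_apply]
  simp only [comul_eq_sweedler, map_sweedler, Algebra.TensorProduct.map_tmul, mul_sweedler,
      Algebra.TensorProduct.includeLeft_apply, Algebra.TensorProduct.tmul_mul_tmul,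
      one_mul, AlgHom.id_apply, smashRep_apply]

/-- `A # H` as an `H`-comodule algebra -/
noncomputable def smashComodule : ComoduleAlgebra k H 𝒜.SmashProduct where
  coact := 𝒜.smashLift 𝒜.coactRep
  coassoc p := by
    refine congr($(SmashProduct.linearMap_ext 𝒜 (f := (TensorProduct.assoc k _ H H).toLinearMap ∘ₗ
      (𝒜.smashLift 𝒜.coactRep).toLinearMap.rTensor H ∘ₗ (𝒜.smashLift 𝒜.coactRep).toLinearMap)
      (g := (comul (R := k) (A := H)).lTensor _ ∘ₗ (𝒜.smashLift 𝒜.coactRep).toLinearMap)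
      fun a h => ?_) p)
    simp only [LinearMap.comp_apply, AlgHom.toLinearMap_apply, coact_tmul, map_sweedler,
      LinearMap.rTensor_tmul, LinearMap.lTensor_tmul, LinearEquiv.coe_coe, sweedler_tmul,
      TensorProduct.assoc_tmul, comul_eq_sweedler, tmul_sweedler]
    exact sweedler_assoc h (fun p q r => SmashProduct.tmul 𝒜 a p ⊗ₜ[k] (q ⊗ₜ[k] r))
      (by intros; fun_prop) (by intros; fun_prop) (by intros; fun_prop)
  counit p := by
    refine congr($(SmashProduct.linearMap_ext 𝒜 (f := (TensorProduct.rid k _).toLinearMap ∘ₗ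
      (counit (R := k) (A := H)).lTensor _ ∘ₗ (𝒜.smashLift 𝒜.coactRep).toLinearMap)
      (g := LinearMap.id) fun a h => ?_) p)
    simp only [LinearMap.comp_apply, AlgHom.toLinearMap_apply, coact_tmul, map_sweedler,
      LinearMap.lTensor_tmul, LinearEquiv.coe_coe, TensorProduct.rid_tmul, LinearMap.id_apply]
    exact sweedler_counit_right h (fun p => SmashProduct.tmul 𝒜 a p) (by fun_prop)

theorem smashComodule_coact (a : A) (h : H) :
    𝒜.smashComodule.coact (SmashProduct.tmul 𝒜 a h) =
      sweedler k h fun h₁ h₂ => SmashProduct.tmul 𝒜 a h₁ ⊗ₜ h₂ := 𝒜.coact_tmul a h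

theorem smashComodule_coact_j (h : H) :
    𝒜.smashComodule.coact (𝒜.smashRep.j h) =
      sweedler k h fun h₁ h₂ => 𝒜.smashRep.j h₁ ⊗ₜ h₂ := 𝒜.coact_tmul 1 h

theorem smashComodule_coact_s (a : A) :
    𝒜.smashComodule.coact (𝒜.smashRep.s a) = 𝒜.smashRep.s a ⊗ₜ 1 := by
  rw [smashRep_s, smashComodule_coact, sweedler_one _ (by intros; fun_prop) (by intros; fun_prop)]

/-- `a # h ↦ a ε(h)` -/
noncomputable def smashCounit : 𝒜.SmashProduct →ₗ[k] A :=
  (TensorProduct.rid k A).toLinearMap ∘ₗ (counit (R := k) (A := H)).lTensor A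

theorem smashCounit_tmul (a : A) (h : H) :
    𝒜.smashCounit (SmashProduct.tmul 𝒜 a h) = counit (R := k) h • a :=
  TensorProduct.rid_tmul _ _

theorem smashRep_s_injective : Function.Injective 𝒜.smashRep.s := fun a b h => by
  have := congr(𝒜.smashCounit $h)
  simpa [smashRep_s, smashCounit_tmul] using this

/-- The map F : (a # g) ⊗ h ↦ ε(g) a # h is a left inverse of the coaction. If p is coinvariant,
then p = F(p ⊗ 1), and F(· ⊗ 1) takes values in the image of A. -/
theorem smash_coinvariants (p : 𝒜.SmashProduct) :
    p ∈ Set.range 𝒜.smashRep.s ↔ 𝒜.smashComodule.coact p = p ⊗ₜ 1 := by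
  constructor
  · rintro ⟨a, rfl⟩
    exact 𝒜.smashComodule_coact_s a
  · intro h
    let F : 𝒜.SmashProduct ⊗[k] H →ₗ[k] 𝒜.SmashProduct :=
      LinearMap.mul' k _ ∘ₗ TensorProduct.map (𝒜.smashRep.s.toLinearMap ∘ₗ 𝒜.smashCounit)
        𝒜.smashRep.j.toLinearMap
    have e : F ∘ₗ 𝒜.smashComodule.coact.toLinearMap = LinearMap.id :=
      SmashProduct.linearMap_ext 𝒜 fun a g => by
        rw [LinearMap.comp_apply, AlgHom.toLinearMap_apply, smashComodule_coact, map_sweedler]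
        simp only [F, LinearMap.comp_apply, TensorProduct.map_tmul, AlgHom.toLinearMap_apply,
          smashCounit_tmul, map_smul, LinearMap.mul'_apply, smul_mul_assoc, smashRep_apply]
        exact sweedler_counit_left g (fun q => SmashProduct.tmul 𝒜 a q) (by fun_prop)
    have e' : F (p ⊗ₜ 1) = p := by rw [← h]; exact congr($e p)
    refine ⟨𝒜.smashCounit p, Eq.trans ?_ e'⟩
    simp [F]

/-- `q ⊗ p ↦ q p₀ ⊗ p₁` -/
noncomputable def smashCan : ComoduleAlgebra.RelTensor 𝒜.smashRep.s →ₗ[k] 𝒜.SmashProduct ⊗[k] H :=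
  balancedLift (LinearMap.mul' k _ ∘ₗ TensorProduct.map
    ((TensorProduct.mk k 𝒜.SmashProduct H).flip 1) 𝒜.smashComodule.coact.toLinearMap) (by
      intro b p q
      simp [smashComodule_coact_s, ← mul_assoc])

theorem smashCan_mk (q p : 𝒜.SmashProduct) : 𝒜.smashCan (Submodule.Quotient.mk (q ⊗ₜ p)) =
    (q ⊗ₜ 1) * 𝒜.smashComodule.coact p := rfl

/-- `p ⊗ h ↦ p S h₁ ⊗ h₂` -/
noncomputable def smashCanInv :
    𝒜.SmashProduct ⊗[k] H →ₗ[k] ComoduleAlgebra.RelTensor 𝒜.smashRep.s :=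
  TensorProduct.lift (bilin (fun p h => sweedler k h fun h₁ h₂ => Submodule.Quotient.mk
    ((p * 𝒜.smashRep.j (antipode k h₁)) ⊗ₜ 𝒜.smashRep.j h₂)) (by intros; fun_prop)
    (by intros; fun_prop))

theorem smashCanInv_tmul (p : 𝒜.SmashProduct) (h : H) : 𝒜.smashCanInv (p ⊗ₜ h) =
    sweedler k h fun h₁ h₂ => Submodule.Quotient.mk
      ((p * 𝒜.smashRep.j (antipode k h₁)) ⊗ₜ 𝒜.smashRep.j h₂) := rfl

/-- The extension is cleft, with h ↦ j(S h) the convolution inverse of j. The composite produces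
S(h₁) h₂ ⊗ h₃ in the H-legs. -/
theorem smashCan_comp_smashCanInv : 𝒜.smashCan ∘ₗ 𝒜.smashCanInv = LinearMap.id := by
  refine TensorProduct.ext' fun p h => ?_
  rw [LinearMap.comp_apply, smashCanInv_tmul, map_sweedler]
  simp only [smashCan_mk, smashComodule_coact_j, mul_sweedler, LinearMap.id_apply,
    Algebra.TensorProduct.tmul_mul_tmul, one_mul, mul_assoc, ← map_mul]
  exact (sweedler_left_antipode_mul h (fun a b => (p * 𝒜.smashRep.j a) ⊗ₜ[k] b)
    (by intros; fun_prop) (by intros; fun_prop)).trans (by simp)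

/-- The H-legs become h₁ S(h₂) ⊗ h₃, which leaves q s(a) ⊗ j(h); the factor s(a) then crosses ⊗_A.
-/
theorem smashCanInv_comp_smashCan : 𝒜.smashCanInv ∘ₗ 𝒜.smashCan = LinearMap.id := by
  apply Submodule.linearMap_qext
  apply TensorProduct.ext
  refine LinearMap.ext fun q => SmashProduct.linearMap_ext 𝒜 fun a h => ?_
  change 𝒜.smashCanInv (𝒜.smashCan (Submodule.Quotient.mk (q ⊗ₜ SmashProduct.tmul 𝒜 a h))) =
    Submodule.Quotient.mk (q ⊗ₜ SmashProduct.tmul 𝒜 a h)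
  rw [smashCan_mk, smashComodule_coact]
  simp only [mul_sweedler, map_sweedler, Algebra.TensorProduct.tmul_mul_tmul, one_mul,
    smashCanInv_tmul, ← smashRep_apply, mul_assoc, ← map_mul]
  refine (sweedler_left_mul_antipode h (fun x y => (Submodule.Quotient.mk
    ((q * (𝒜.smashRep.s a * 𝒜.smashRep.j x)) ⊗ₜ[k] 𝒜.smashRep.j y) :
      ComoduleAlgebra.RelTensor 𝒜.smashRep.s)) (by intros; fun_prop) (by intros; fun_prop)).trans ?_
  rw [map_one, mul_one]
  exact balancedRel_mk_eq (r := fun (b : A) (p : 𝒜.SmashProduct) => p * 𝒜.smashRep.s b)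
    (l := fun b p => 𝒜.smashRep.s b * p) a q (𝒜.smashRep.j h)

/-- `A ⊆ A # H` is a Hopf–Galois extension -/
noncomputable def smashGalois : HopfGaloisExtension 𝒜.smashComodule 𝒜.smashRep.s where
  injective := 𝒜.smashRep_s_injective
  range_eq := 𝒜.smash_coinvariants
  can := LinearEquiv.ofLinearMap 𝒜.smashCan 𝒜.smashCanInv 𝒜.smashCan_comp_smashCanInv
    𝒜.smashCanInv_comp_smashCan
  can_apply := 𝒜.smashCan_mk

theorem smashGalois_translation (h : H) : 𝒜.smashGalois.translation h =
    sweedler k h fun h₁ h₂ => Submodule.Quotient.mk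
      (𝒜.smashRep.j (antipode k h₁) ⊗ₜ 𝒜.smashRep.j h₂) := by
  refine (𝒜.smashCanInv_tmul 1 h).trans ?_
  simp only [one_mul]

end HopfModuleAlgebra
end SmashProductRep

/-! ### Faithful flatness of A # H -/

section Flat
open Coalgebra HopfAlgebra MulOpposite
universe v
variable {k H : Type*} {A : Type v} [Field k] [Ring H] [HopfAlgebra k H] [Ring A] [Algebra k A]

namespace HopfModuleAlgebra
variable (𝒜 : HopfModuleAlgebra k H A)

/-- The coordinates of an element of `A # H` in a `k`-basis of `H`. -/
noncomputable def smashCoords {κ : Type*} [DecidableEq κ] (c : Module.Basis κ k H) :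
    𝒜.SmashProduct ≃ₗ[k] (κ →₀ A) :=
  (TensorProduct.equivFinsuppOfBasisRight c : A ⊗[k] H ≃ₗ[k] (κ →₀ A))

theorem smashCoords_symm_single {κ : Type*} [DecidableEq κ] (c : Module.Basis κ k H) (i : κ) (a : A) :
    (𝒜.smashCoords c).symm (Finsupp.single i a) = SmashProduct.tmul 𝒜 a (c i) := by
  exact (TensorProduct.equivFinsuppOfBasisRight_symm_apply c _).trans
    (Finsupp.sum_single_index (TensorProduct.zero_tmul _ _))

theorem smashCoords_tmul_basis {κ : Type*} [DecidableEq κ] (c : Module.Basis κ k H) (i : κ) (a : A) :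
    𝒜.smashCoords c (SmashProduct.tmul 𝒜 a (c i)) = Finsupp.single i a := by
  rw [← smashCoords_symm_single, LinearEquiv.apply_symm_apply]

/-- Left multiplication by s(b) touches only the factor A, so the coordinates in a k-basis of H are
left A-linear: A # H is a free left A-module. -/
theorem smashCoords_s_mul {κ : Type*} [DecidableEq κ] (c : Module.Basis κ k H) (b : A) (p : 𝒜.SmashProduct) (i : κ) :
    𝒜.smashCoords c (𝒜.smashRep.s b * p) i = b * 𝒜.smashCoords c p i := by
  obtain ⟨p, rfl⟩ := (𝒜.smashCoords c).symm.surjective p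
  induction p using Finsupp.induction_linear with
  | zero => simp
  | add p q hp hq => simp only [map_add, mul_add, Finsupp.add_apply, hp, hq]
  | single j a =>
    rw [smashCoords_symm_single, smashRep_s, SmashProduct.tmul_one_mul_tmul,
      smashCoords_tmul_basis, smashCoords_tmul_basis]
    simp only [Finsupp.single_apply]
    split_ifs <;> simp

variable {κ : Type*} [DecidableEq κ] (c : Module.Basis κ k H) (M : Type*) [AddCommGroup M] [Module Aᵐᵒᵖ M]

/-- `M ⊗ (A # H) → ⊕ M`, `m ⊗ p ↦ (m pᵢ)ᵢ` -/
noncomputable def tensorCoords : M ⊗[ℤ] 𝒜.SmashProduct →ₗ[ℤ] (κ →₀ M) :=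
  TensorProduct.lift (AddMonoidHom.toIntLinearMap (AddMonoidHom.mk'
    (fun m => AddMonoidHom.toIntLinearMap (AddMonoidHom.mk'
      (fun p => (𝒜.smashCoords c p).mapRange (fun a => op a • m) (by simp))
      (fun p q => by ext; simp [add_smul])))
    (fun m n => by ext; simp)))

variable {M}

theorem tensorCoords_tmul (m : M) (p : 𝒜.SmashProduct) (i : κ) :
    𝒜.tensorCoords c M (m ⊗ₜ p) i = op (𝒜.smashCoords c p i) • m := rfl

theorem tensorCoords_tmul_basis (m : M) (i : κ) :
    𝒜.tensorCoords c M (m ⊗ₜ SmashProduct.tmul 𝒜 1 (c i)) = Finsupp.single i m := by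
  ext j
  rw [tensorCoords_tmul, smashCoords_tmul_basis, Finsupp.single_apply, Finsupp.single_apply]
  split_ifs <;> simp

/-- By freeness M ⊗_A (A # H) is a direct sum of copies of M. The lemma says so in terms of kernels:
the coordinate map on M ⊗_ℤ (A # H) kills exactly the balancing relations. -/
theorem tensorCoords_eq_zero_iff (z : M ⊗[ℤ] 𝒜.SmashProduct) : 𝒜.tensorCoords c M z = 0 ↔
    z ∈ balancedRel ℤ (fun (b : A) (m : M) => op b • m)
      (fun b (p : 𝒜.SmashProduct) => 𝒜.smashRep.s b * p) := by
  constructor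
  · intro h
    -- σ sends m in position i to the class of m ⊗ (1 # c_i). It recovers the class of z from its
    -- coordinates.
    let σ : (κ →₀ M) →ₗ[ℤ] (BalancedTensor ℤ (fun (b : A) (m : M) => op b • m)
        (fun b (p : 𝒜.SmashProduct) => 𝒜.smashRep.s b * p)) :=
      Finsupp.lsum ℤ fun i => Submodule.mkQ _ ∘ₗ
        (TensorProduct.mk ℤ M 𝒜.SmashProduct).flip (SmashProduct.tmul 𝒜 1 (c i))
    have e : ∀ z, σ (𝒜.tensorCoords c M z) = Submodule.Quotient.mk z := by
      intro z
      induction z with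
      | zero => simp
      | add z w hz hw => rw [map_add, map_add, hz, hw, Submodule.Quotient.mk_add]
      | tmul m p =>
      obtain ⟨p, rfl⟩ := (𝒜.smashCoords c).symm.surjective p
      induction p using Finsupp.induction_linear with
      | zero => simp
      | add p q hp hq =>
        rw [map_add, TensorProduct.tmul_add, map_add, map_add, hp, hq, Submodule.Quotient.mk_add]
      | single j a =>
        have : 𝒜.tensorCoords c M (m ⊗ₜ SmashProduct.tmul 𝒜 a (c j)) =
            Finsupp.single j (op a • m) := by
          ext i
          rw [tensorCoords_tmul, smashCoords_tmul_basis, Finsupp.single_apply, Finsupp.single_apply]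
          split_ifs <;> simp
        rw [smashCoords_symm_single, this]
        simp only [σ, Finsupp.lsum_single, LinearMap.comp_apply, LinearMap.flip_apply,
          TensorProduct.mk_apply, Submodule.mkQ_apply]
        refine (balancedRel_mk_eq (r := fun (b : A) (m : M) => op b • m)
          (l := fun b (p : 𝒜.SmashProduct) => 𝒜.smashRep.s b * p) a m _).trans ?_
        rw [smashRep_s, SmashProduct.tmul_one_mul_tmul, mul_one]
    rw [← Submodule.Quotient.mk_eq_zero, ← e, h, map_zero]
  · refine fun h => balancedRel_le_ker (𝒜.tensorCoords c M) (fun b m p => ?_) h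
    ext i
    refine Eq.trans ?_ (congrArg (fun a => op a • m) (𝒜.smashCoords_s_mul c b p i)).symm
    rw [op_mul, mul_smul]
    rfl

theorem smash_faithfullyFlat : IsLeftFaithfullyFlat 𝒜.smashRep.s := by
  intro M N _ _ _ _ f
  classical
  let c := Module.Basis.ofVectorSpace k H
  -- In coordinates f ⊗ id applies f to each component.
  have nat : ∀ (z : M ⊗[ℤ] 𝒜.SmashProduct),
      𝒜.tensorCoords c N (f.toAddMonoidHom.toIntLinearMap.rTensor _ z) =
        (𝒜.tensorCoords c M z).mapRange f (map_zero f) := by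
    intro z
    induction z with
    | zero => ext; simp
    | add z w hz hw => rw [map_add, map_add, map_add, hz, hw]; ext; simp
    | tmul m p =>
      ext i
      simp [tensorCoords_tmul]
  simp only [← 𝒜.tensorCoords_eq_zero_iff c, nat]
  constructor
  · intro hf z hz
    ext i
    have := DFunLike.congr_fun hz i
    simp only [Finsupp.mapRange_apply, Finsupp.coe_zero, Pi.zero_apply] at this ⊢
    exact hf (this.trans (map_zero f).symm)
  · intro h
    -- For the converse at least one coordinate is needed; H is nonzero because ε(1) = 1.
    have : Nontrivial H := ⟨1, 0, fun e => by
      have := congr(counit (R := k) $e)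
      simp at this⟩
    obtain ⟨i⟩ := c.index_nonempty
    rw [injective_iff_map_eq_zero]
    intro m hm
    have := h (m ⊗ₜ SmashProduct.tmul 𝒜 1 (c i))
    rw [tensorCoords_tmul_basis] at this
    simpa using this (by simp [hm])

end HopfModuleAlgebra
end Flat

/-! ### The Ehresmann–Schauenburg algebra of A # H -/

section Ehresmann
open Coalgebra HopfAlgebra MulOpposite
variable {k H A : Type*} [Field k] [Ring H] [HopfAlgebra k H] [Ring A] [Algebra k A]

/-- A representation with values in a subalgebra. -/
def SmashRep.codRestrict {𝒜 : HopfModuleAlgebra k H A} {B : Type*} [Ring B] [Algebra k B]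
    (R : SmashRep 𝒜 B) (S : Subalgebra k B) (hs : ∀ a, R.s a ∈ S) (ht : ∀ a, R.t a ∈ S)
    (hj : ∀ h, R.j h ∈ S) : SmashRep 𝒜 S where
  s := R.s.codRestrict S hs
  t := R.t.codRestrict S ht
  j := R.j.codRestrict S hj
  comm a b := Subtype.ext (R.comm a b)
  j_mul_s h a := Subtype.ext ((R.j_mul_s h a).trans (map_sweedler S.val h
    fun h₁ h₂ => R.s.codRestrict S hs (𝒜.act h₁ a) * R.j.codRestrict S hj h₂).symm)
  t_mul_j a h := Subtype.ext ((R.t_mul_j a h).trans (map_sweedler S.val h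
    fun h₁ h₂ => R.j.codRestrict S hj h₁ * R.t.codRestrict S ht (op (𝒜.act (antipode k h₂) a))).symm)

namespace HopfModuleAlgebra
variable (𝒜 : HopfModuleAlgebra k H A)

theorem trans_eval (b b' : A) (h : H) : 𝒜.smashRep.trans.eval (b ⊗ₜ (b' ⊗ₜ h)) =
    sweedler k h fun h₁ h₂ => SmashProduct.tmul 𝒜 b h₁ ⊗ₜ
      op (SmashProduct.tmul 𝒜 b' (antipode k h₂)) := by
  rw [SmashRep.eval_tmul]
  change (𝒜.smashRep.s b ⊗ₜ 1) * 𝒜.smashRep.transJ h * (1 ⊗ₜ op (𝒜.smashRep.s b')) = _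
  rw [CrossedRep.transJ_apply]
  simp only [mul_sweedler, sweedler_mul, Algebra.TensorProduct.tmul_mul_tmul, one_mul, mul_one,
    ← op_mul, smashRep_apply]

theorem diagCoact_tmul (b b' : A) (h g : H) :
    𝒜.smashComodule.diagCoact (SmashProduct.tmul 𝒜 b h ⊗ₜ op (SmashProduct.tmul 𝒜 b' g)) =
      sweedler k h fun h₁ h₂ => sweedler k g fun g₁ g₂ =>
        (SmashProduct.tmul 𝒜 b h₁ ⊗ₜ op (SmashProduct.tmul 𝒜 b' g₁)) ⊗ₜ (h₂ * g₂) := by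
  simp only [ComoduleAlgebra.diagCoact, LinearMap.comp_apply, TensorProduct.map_tmul,
    AlgHom.toLinearMap_apply, smashComodule_coact, LinearEquiv.coe_coe, coe_opLinearEquiv_symm,
    unop_op, map_sweedler, LinearMap.rTensor_tmul, tmul_sweedler, sweedler_tmul]
  rw [sweedler_comm]
  rfl

/-- The image of b ⊗ b' # h has H-legs h₁ and S(h₂). The diagonal coaction turns them into h₁, S(h₄)
and a last leg h₂ S(h₃), which collapses to 1. -/
theorem trans_eval_coinvariant (z : A ⊗[k] (A ⊗[k] H)) :
    𝒜.smashComodule.diagCoact (𝒜.smashRep.trans.eval z) = 𝒜.smashRep.trans.eval z ⊗ₜ 1 := by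
  induction z with
  | zero => simp
  | add x y hx hy => rw [map_add, map_add, hx, hy, TensorProduct.add_tmul]
  | tmul b x =>
  induction x with
  | zero => simp
  | add x y hx hy => rw [TensorProduct.tmul_add, map_add, map_add, hx, hy, TensorProduct.add_tmul]
  | tmul b' h =>
  rw [trans_eval, map_sweedler, sweedler_tmul]
  simp only [diagCoact_tmul]
  -- The middle argument of f is the coaction leg; it will receive h₂ S(h₃).
  let f : H → H → H → (𝒜.SmashProduct ⊗[k] 𝒜.SmashProductᵐᵒᵖ) ⊗[k] H := fun p q r =>
    (SmashProduct.tmul 𝒜 b p ⊗ₜ op (SmashProduct.tmul 𝒜 b' (antipode k r))) ⊗ₜ q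
  have e : ∀ p q r, (sweedler k (antipode k r) fun g₁ g₂ => (SmashProduct.tmul 𝒜 b p ⊗ₜ[k]
      op (SmashProduct.tmul 𝒜 b' g₁)) ⊗ₜ[k] (q * g₂)) =
      sweedler k r fun r₁ r₂ => f p (q * antipode k r₁) r₂ := fun p q r =>
    sweedler_antipode r _ (by intros; fun_prop) (by intros; fun_prop)
  simp only [e]
  rw [sweedler_assoc h (fun p q r => sweedler k r fun r₁ r₂ => f p (q * antipode k r₁) r₂)
    (by intros; fun_prop) (by intros; fun_prop) (by intros; fun_prop)]
  congr! 3 with p q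
  exact sweedler_left_mul_antipode q (fun x y => f p x y) (by intros; fun_prop)
    (by intros; fun_prop)

/-- `A^e # H` represented in `L(A # H, H)`. -/
noncomputable def ehresmannRep : SmashRep 𝒜 𝒜.smashComodule.EhresmannAlgebra :=
  SmashRep.codRestrict 𝒜.smashRep.trans 𝒜.smashComodule.ehresmann
    (fun a => by
      change _ = _
      simpa [SmashRep.eval_tmul] using 𝒜.trans_eval_coinvariant (a ⊗ₜ (1 ⊗ₜ 1)))
    (fun a => by
      change _ = _
      simpa [SmashRep.eval_tmul] using 𝒜.trans_eval_coinvariant (1 ⊗ₜ (unop a ⊗ₜ 1)))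
    (fun h => by
      change _ = _
      simpa [SmashRep.eval_tmul] using 𝒜.trans_eval_coinvariant (1 ⊗ₜ (1 ⊗ₜ h)))

theorem ehresmannVal_eval (z : A ⊗[k] (A ⊗[k] H)) :
    𝒜.smashComodule.ehresmannVal (𝒜.ehresmannRep.eval z) = 𝒜.smashRep.trans.eval z := by
  suffices e : 𝒜.smashComodule.ehresmannVal.toLinearMap ∘ₗ 𝒜.ehresmannRep.eval =
    𝒜.smashRep.trans.eval from congr($e z)
  ext b b' h
  change 𝒜.smashComodule.ehresmannVal (𝒜.ehresmannRep.eval (b ⊗ₜ (b' ⊗ₜ h))) =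
    𝒜.smashRep.trans.eval (b ⊗ₜ (b' ⊗ₜ h))
  rw [SmashRep.eval_tmul, SmashRep.eval_tmul, map_mul, map_mul]
  rfl

theorem ehresmannVal_tmul (b b' : A) (h : H) : 𝒜.smashComodule.ehresmannVal
    (𝒜.ehresmannRep.s b * 𝒜.ehresmannRep.j h * 𝒜.ehresmannRep.t (op b')) =
    sweedler k h fun h₁ h₂ => SmashProduct.tmul 𝒜 b h₁ ⊗ₜ
      op (SmashProduct.tmul 𝒜 b' (antipode k h₂)) := by
  rw [← SmashRep.eval_tmul, ehresmannVal_eval, trans_eval]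

/-- `A # H` as a vector space -/
def smashToTensor : 𝒜.SmashProduct ≃ₗ[k] A ⊗[k] H := LinearEquiv.refl k (A ⊗[k] H)

/-- `(b # h) ⊗ (b' # g) ↦ b ⊗ b' ⊗ h ε(g)` -/
noncomputable def ehresmannProj :
    𝒜.SmashProduct ⊗[k] 𝒜.SmashProductᵐᵒᵖ →ₗ[k] A ⊗[k] (A ⊗[k] H) :=
  (TensorProduct.comm k H A).toLinearMap.lTensor A ∘ₗ (TensorProduct.assoc k A H A).toLinearMap ∘ₗ
    TensorProduct.map 𝒜.smashToTensor.toLinearMap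
      (𝒜.smashCounit ∘ₗ (opLinearEquiv k).symm.toLinearMap)

theorem ehresmannProj_tmul (b b' : A) (h g : H) :
    𝒜.ehresmannProj (SmashProduct.tmul 𝒜 b h ⊗ₜ op (SmashProduct.tmul 𝒜 b' g)) =
      counit (R := k) g • (b ⊗ₜ (b' ⊗ₜ h)) := by
  have : 𝒜.smashToTensor (SmashProduct.tmul 𝒜 b h) = b ⊗ₜ h := rfl
  simp [ehresmannProj, smashCounit_tmul, this]

theorem ehresmannProj_eval (z : A ⊗[k] (A ⊗[k] H)) :
    𝒜.ehresmannProj (𝒜.smashRep.trans.eval z) = z := by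
  suffices e : 𝒜.ehresmannProj ∘ₗ 𝒜.smashRep.trans.eval = LinearMap.id from congr($e z)
  ext b b' h
  change 𝒜.ehresmannProj (𝒜.smashRep.trans.eval (b ⊗ₜ (b' ⊗ₜ h))) = b ⊗ₜ (b' ⊗ₜ h)
  rw [trans_eval, map_sweedler]
  simp only [ehresmannProj_tmul, counit_antipode]
  exact sweedler_counit_right h (fun p => b ⊗ₜ[k] (b' ⊗ₜ[k] p)) (by fun_prop)

/-- The map θ multiplies by the coaction leg after projecting and evaluating, and it undoes the
diagonal coaction on all of P ⊗ P^op: the legs become h₁ and S(h₂) h₃ g. On a coinvariant z the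
coaction leg is 1, and the identity θ(z ⊗ 1) = z is the claim. -/
theorem trans_eval_ehresmannProj (z : 𝒜.SmashProduct ⊗[k] 𝒜.SmashProductᵐᵒᵖ)
    (hz : 𝒜.smashComodule.diagCoact z = z ⊗ₜ 1) :
    𝒜.smashRep.trans.eval (𝒜.ehresmannProj z) = z := by
  let θ : (𝒜.SmashProduct ⊗[k] 𝒜.SmashProductᵐᵒᵖ) ⊗[k] H →ₗ[k]
      𝒜.SmashProduct ⊗[k] 𝒜.SmashProductᵐᵒᵖ :=
    TensorProduct.lift (bilin (fun w m => (1 ⊗ₜ op (𝒜.smashRep.j m)) *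
      𝒜.smashRep.trans.eval (𝒜.ehresmannProj w)) (by intros; fun_prop) (by intros; fun_prop))
  have hθ : ∀ w m, θ (w ⊗ₜ m) = (1 ⊗ₜ op (𝒜.smashRep.j m)) *
      𝒜.smashRep.trans.eval (𝒜.ehresmannProj w) := fun _ _ => rfl
  have e : θ ∘ₗ 𝒜.smashComodule.diagCoact = LinearMap.id := by
    apply TensorProduct.ext
    refine SmashProduct.linearMap_ext 𝒜 fun b h => ?_
    refine LinearMap.ext fun q => ?_
    obtain ⟨q, rfl⟩ := op_surjective q
    induction q using SmashProduct.induction with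
    | ha x y hx hy => rw [op_add, map_add, map_add, hx, hy]
    | ht b' g =>
    change θ (𝒜.smashComodule.diagCoact (SmashProduct.tmul 𝒜 b h ⊗ₜ
      op (SmashProduct.tmul 𝒜 b' g))) = SmashProduct.tmul 𝒜 b h ⊗ₜ op (SmashProduct.tmul 𝒜 b' g)
    rw [diagCoact_tmul]
    simp only [map_sweedler, hθ, ehresmannProj_tmul, map_smul, trans_eval, mul_smul_comm,
      mul_sweedler, Algebra.TensorProduct.tmul_mul_tmul, one_mul, ← op_mul, smashRep_j,
      SmashProduct.tmul_mul_one_tmul]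
    have e₁ : ∀ p q, (sweedler k g fun g₁ g₂ => counit (R := k) g₁ • sweedler k p fun h₁ h₂ =>
        SmashProduct.tmul 𝒜 b h₁ ⊗ₜ[k] op (SmashProduct.tmul 𝒜 b' (antipode k h₂ * (q * g₂)))) =
        sweedler k p fun h₁ h₂ => SmashProduct.tmul 𝒜 b h₁ ⊗ₜ[k]
          op (SmashProduct.tmul 𝒜 b' (antipode k h₂ * q * g)) := fun p q => by
      simpa only [mul_assoc] using sweedler_counit_left g (fun x => sweedler k p fun h₁ h₂ =>
        SmashProduct.tmul 𝒜 b h₁ ⊗ₜ[k] op (SmashProduct.tmul 𝒜 b' (antipode k h₂ * (q * x))))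
        (by fun_prop)
    simp only [e₁]
    rw [sweedler_assoc h (fun p q r => SmashProduct.tmul 𝒜 b p ⊗ₜ[k]
        op (SmashProduct.tmul 𝒜 b' (antipode k q * r * g)))
        (by intros; fun_prop) (by intros; fun_prop) (by intros; fun_prop),
      sweedler_right_antipode_mul h (fun p q => SmashProduct.tmul 𝒜 b p ⊗ₜ[k]
        op (SmashProduct.tmul 𝒜 b' (q * g))) (by intros; fun_prop) (by intros; fun_prop), one_mul]
  have e' : θ (z ⊗ₜ 1) = z := by rw [← hz]; exact congr($e z)
  refine Eq.trans ?_ e'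
  rw [hθ, map_one, op_one, ← Algebra.TensorProduct.one_def, one_mul]

theorem ehresmannVal_injective : Function.Injective 𝒜.smashComodule.ehresmannVal :=
  Subtype.val_injective

/-- The projection `ehresmannProj` is inverse to evaluation: on one side by the counit axiom, on the
other by coinvariance. -/
theorem ehresmannRep_isUniversal : 𝒜.ehresmannRep.IsUniversal := by
  constructor
  · intro x y h
    have := congr(𝒜.ehresmannProj (𝒜.smashComodule.ehresmannVal $h))
    rwa [ehresmannVal_eval, ehresmannVal_eval, ehresmannProj_eval, ehresmannProj_eval] at this
  · intro z
    refine ⟨𝒜.ehresmannProj (𝒜.smashComodule.ehresmannVal z), 𝒜.ehresmannVal_injective ?_⟩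
    rw [ehresmannVal_eval]
    exact 𝒜.trans_eval_ehresmannProj _ z.2

/-- The bialgebroid structure of `L(A # H, H)`. -/
noncomputable def ehresmannBialgebroid : LeftBialgebroid k A 𝒜.smashComodule.EhresmannAlgebra :=
  𝒜.ehresmannRep_isUniversal.leftBialgebroid

theorem comulFormula_tmul (b : A) (h : H) (q : 𝒜.SmashProduct) :
    𝒜.smashGalois.comulFormula (SmashProduct.tmul 𝒜 b h ⊗ₜ op q) =
      sweedler k h fun h₁ h₂ => sweedler k h₂ fun g₁ g₂ =>
        takeuchiMk (HopfGaloisExtension.src 𝒜.smashRep.s) (HopfGaloisExtension.tgt 𝒜.smashRep.s)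
          ((SmashProduct.tmul 𝒜 b h₁ ⊗ₜ op (𝒜.smashRep.j (antipode k g₁))) ⊗ₜ
            (𝒜.smashRep.j g₂ ⊗ₜ op q)) := by
  have e : 𝒜.smashGalois.comulFormula (SmashProduct.tmul 𝒜 b h ⊗ₜ op q) =
    𝒜.smashGalois.insertTranslation (𝒜.smashComodule.coact (SmashProduct.tmul 𝒜 b h)) q := rfl
  have e₁ : ∀ p g, 𝒜.smashGalois.insertTranslation (p ⊗ₜ g) q =
    HopfGaloisExtension.insertMiddle 𝒜.smashRep.s p q (𝒜.smashGalois.translation g) :=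
      fun _ _ => rfl
  rw [e, smashComodule_coact, map_sweedler,
    IsLin.map_sweedler (k := k) (φ := fun f : 𝒜.SmashProduct →ₗ[k] TakeuchiTensor
      (HopfGaloisExtension.src 𝒜.smashRep.s) (HopfGaloisExtension.tgt 𝒜.smashRep.s) => f q)
      (by fun_prop)]
  simp only [e₁, smashGalois_translation, map_sweedler]
  rfl

theorem isEhresmannSchauenburg :
    𝒜.smashGalois.IsEhresmannSchauenburg 𝒜.ehresmannBialgebroid where
  s_eq _ := rfl
  t_eq b := (show 𝒜.smashComodule.ehresmannVal (𝒜.ehresmannRep.t (op b)) =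
    1 ⊗ₜ op (𝒜.smashRep.s b) from rfl)
  counit_eq z := by
    refine congr($(𝒜.ehresmannRep_isUniversal.linearMap_ext
      (f := 𝒜.smashRep.s.toLinearMap ∘ₗ 𝒜.ehresmannRep_isUniversal.counit)
      (g := LinearMap.mul' k _ ∘ₗ (opLinearEquiv k).symm.toLinearMap.lTensor _ ∘ₗ
        𝒜.smashComodule.ehresmannVal.toLinearMap) fun b h b' => ?_) z)
    simp only [LinearMap.comp_apply, AlgHom.toLinearMap_apply, ehresmannVal_tmul, map_sweedler,
      LinearMap.lTensor_tmul, LinearEquiv.coe_coe, coe_opLinearEquiv_symm, unop_op,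
      LinearMap.mul'_apply]
    simp only [SmashRep.IsUniversal.counit_apply, map_mul, Module.End.mul_apply,
      SmashRep.IsUniversal.action_s, SmashRep.IsUniversal.action_j,
      SmashRep.IsUniversal.action_t, one_mul, ← smashRep_apply]
    -- Multiplying the two legs gives b (h₁ ▷ b') # h₂ S(h₃), whose H-part collapses to 1.
    have : ∀ p q, 𝒜.smashRep.s b * 𝒜.smashRep.j p * (𝒜.smashRep.s b' *
        𝒜.smashRep.j (antipode k q)) = sweedler k p fun x y =>
          𝒜.smashRep.s b * (𝒜.smashRep.s (𝒜.act x b') * 𝒜.smashRep.j (y * antipode k q)) := by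
      intro p q
      rw [mul_assoc, ← mul_assoc (𝒜.smashRep.j p), CrossedRep.j_mul_s]
      simp only [sweedler_mul, mul_sweedler, map_mul, mul_assoc]
    simp only [this]
    rw [sweedler_assoc h (fun p q r => 𝒜.smashRep.s b * (𝒜.smashRep.s (𝒜.act p b') *
        𝒜.smashRep.j (q * antipode k r))) (by intros; fun_prop) (by intros; fun_prop)
        (by intros; fun_prop),
      sweedler_right_mul_antipode h (fun p q => 𝒜.smashRep.s b * (𝒜.smashRep.s (𝒜.act p b') *
        𝒜.smashRep.j q)) (by intros; fun_prop) (by intros; fun_prop), map_one, mul_one,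
      unop_op]
  comul_eq z w hw := by
    let V := 𝒜.smashComodule.ehresmannVal
    let s' := HopfGaloisExtension.src 𝒜.smashRep.s
    let t' := HopfGaloisExtension.tgt 𝒜.smashRep.s
    -- The inclusion of L(P, H) in P ⊗ P^op intertwines sources and targets, so its tensor square
    -- descends to the tensor products over A and any representative w may be used.
    let F : TakeuchiTensor 𝒜.ehresmannRep.s 𝒜.ehresmannRep.t →ₗ[k] TakeuchiTensor s' t' :=
      balancedLift (takeuchiMk s' t' ∘ₗ TensorProduct.map V.toLinearMap V.toLinearMap) (by
        intro b X Y
        have e₁ : V (𝒜.ehresmannRep.t (op b) * X) = t' (op b) * V X := by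
          rw [map_mul]; rfl
        have e₂ : V (𝒜.ehresmannRep.s b * Y) = s' b * V Y := by
          rw [map_mul]; rfl
        simp only [LinearMap.comp_apply, TensorProduct.map_tmul, AlgHom.toLinearMap_apply, e₁, e₂]
        exact takeuchiMk_t_tmul s' t' b (V X) (V Y))
    have key : F ∘ₗ 𝒜.ehresmannRep_isUniversal.comul =
        𝒜.smashGalois.comulFormula ∘ₗ V.toLinearMap := by
      refine 𝒜.ehresmannRep_isUniversal.linearMap_ext fun b h b' => ?_
      have e₁ : ∀ p q, F (takeuchiMk 𝒜.ehresmannRep.s 𝒜.ehresmannRep.t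
          ((𝒜.ehresmannRep.s b * 𝒜.ehresmannRep.j p) ⊗ₜ
            (𝒜.ehresmannRep.j q * 𝒜.ehresmannRep.t (op b')))) =
          sweedler k p fun p₁ p₂ => sweedler k q fun q₁ q₂ => takeuchiMk s' t'
            ((SmashProduct.tmul 𝒜 b p₁ ⊗ₜ op (𝒜.smashRep.j (antipode k p₂))) ⊗ₜ
              (𝒜.smashRep.j q₁ ⊗ₜ op (SmashProduct.tmul 𝒜 b' (antipode k q₂)))) := by
        intro p q
        have h₁ := 𝒜.ehresmannVal_tmul b 1 p
        have h₂ := 𝒜.ehresmannVal_tmul 1 b' q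
        rw [op_one, map_one, mul_one] at h₁
        rw [map_one, one_mul] at h₂
        change takeuchiMk s' t' (V _ ⊗ₜ V _) = _
        rw [h₁, h₂]
        simp only [sweedler_tmul, tmul_sweedler, map_sweedler]
        exact sweedler_comm q p _
      rw [LinearMap.comp_apply, LinearMap.comp_apply, SmashRep.IsUniversal.comul_apply,
        SmashRep.IsUniversal.comulAlgHom_apply, AlgHom.toLinearMap_apply, ehresmannVal_tmul]
      simp only [map_sweedler, e₁, comulFormula_tmul]
      -- Both coproducts are f(h₁, h₂, h₃, h₄) with the iterated coproduct of h bracketed in two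
      -- ways; only coassociativity is left.
      let f : H → H → H → H → TakeuchiTensor s' t' := fun p q r u => takeuchiMk s' t'
            ((SmashProduct.tmul 𝒜 b p ⊗ₜ op (𝒜.smashRep.j (antipode k q))) ⊗ₜ
              (𝒜.smashRep.j r ⊗ₜ op (SmashProduct.tmul 𝒜 b' (antipode k u))))
      change (sweedler k h fun p q => sweedler k p fun p₁ p₂ => sweedler k q fun q₁ q₂ =>
        f p₁ p₂ q₁ q₂) = sweedler k h fun p q => sweedler k p fun p₁ p₂ => sweedler k p₂
          fun q₁ q₂ => f p₁ q₁ q₂ q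
      rw [sweedler_assoc h (fun p q r => sweedler k r fun q₁ q₂ => f p q q₁ q₂)
        (by intros; fun_prop) (by intros; fun_prop) (by intros; fun_prop),
        sweedler_assoc h (fun p q r => sweedler k q fun q₁ q₂ => f p q₁ q₂ r)
        (by intros; fun_prop) (by intros; fun_prop) (by intros; fun_prop)]
      congr! 3 with p q
      exact (sweedler_assoc q (fun x y z => f p x y z) (by intros; fun_prop)
        (by intros; fun_prop) (by intros; fun_prop)).symm
    calc _ = F (takeuchiMk 𝒜.ehresmannRep.s 𝒜.ehresmannRep.t w) := rfl
      _ = F (𝒜.ehresmannRep_isUniversal.comul z) := congrArg F hw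
      _ = _ := congr($key z)

end HopfModuleAlgebra
end Ehresmann

/-! ### Reduction of the cross relations to the generators of H -/

section HAlgSweedler
open Coalgebra HopfAlgebra MulOpposite
variable {k I : Type*} [Field k] [Fintype I] [DecidableEq I] {M : Type*} [AddCommGroup M] [Module k M]

namespace HAlg

theorem sweedler_x (i : I) (f : HAlg k I → HAlg k I → M) (h₁ : ∀ b, IsLin k (fun a => f a b))
    (h₂ : ∀ a, IsLin k (fun b => f a b)) :
    sweedler k (x k i) f = f (x k i) 1 + ∑ j, f (t k i j) (x k j) := by
  rw [sweedler_eq _ f h₁ h₂, comul_eq, comulHom_x, map_add, map_sum]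
  rfl

theorem sweedler_t (i j : I) (f : HAlg k I → HAlg k I → M) (h₁ : ∀ b, IsLin k (fun a => f a b))
    (h₂ : ∀ a, IsLin k (fun b => f a b)) :
    sweedler k (t k i j) f = ∑ m, f (t k i m) (t k m j) := by
  rw [sweedler_eq _ f h₁ h₂, comul_eq, comulHom_t, map_sum]
  rfl

theorem sweedler_u (i j : I) (f : HAlg k I → HAlg k I → M) (h₁ : ∀ b, IsLin k (fun a => f a b))
    (h₂ : ∀ a, IsLin k (fun b => f a b)) :
    sweedler k (u k i j) f = ∑ m, f (u k i m) (u k m j) := by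
  rw [sweedler_eq _ f h₁ h₂, comul_eq, comulHom_u, map_sum]
  rfl

theorem sweedler_algebraMap {H : Type*} [Ring H] [HopfAlgebra k H] (r : k)
    (f : H → H → M) (h₁ : ∀ b, IsLin k (fun a => f a b))
    (h₂ : ∀ a, IsLin k (fun b => f a b)) :
    sweedler k (algebraMap k H r) f = r • f 1 1 := by
  have e : IsLin k (fun y : H => sweedler k y f) := by fun_prop
  rw [Algebra.algebraMap_eq_smul_one, e.map_smul, sweedler_one f h₁ h₂]

theorem sweedler_add {H : Type*} [Ring H] [HopfAlgebra k H] (a b : H)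
    (f : H → H → M) (h₁ : ∀ b, IsLin k (fun a => f a b))
    (h₂ : ∀ a, IsLin k (fun b => f a b)) :
    sweedler k (a + b) f = sweedler k a f + sweedler k b f := by
  have e : IsLin k (fun y : H => sweedler k y f) := by fun_prop
  exact e.map_add a b

theorem antipode_x (i : I) : antipode k (x k i) = -∑ j, u k j i * x k j := antipodeLin_x i
theorem antipode_t (i j : I) : antipode k (t k i j) = u k j i := antipodeLin_t i j
theorem antipode_u (i j : I) : antipode k (u k i j) = t k j i := antipodeLin_u i j
theorem counit_x (i : I) : counit (R := k) (x k i) = 0 := by simp [counit_eq, counitHom]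
theorem counit_t (i j : I) : counit (R := k) (t k i j) = if i = j then 1 else 0 := by
  simp [counit_eq, counitHom]
theorem counit_u (i j : I) : counit (R := k) (u k i j) = if i = j then 1 else 0 := by
  simp [counit_eq, counitHom]

end HAlg

/-- To represent `A^e # H` it suffices to check the cross relations for the generators of `H`. -/
def SmashRep.ofGenerators {A B : Type*} [Ring A] [Algebra k A] [Ring B] [Algebra k B]
    {𝒜 : HopfModuleAlgebra k (HAlg k I) A} (s : A →ₐ[k] B) (t : Aᵐᵒᵖ →ₐ[k] B)
    (j : HAlg k I →ₐ[k] B) (comm : ∀ a b, s a * t b = t b * s a)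
    (hsx : ∀ i a, j (HAlg.x k i) * s a = s (𝒜.act (HAlg.x k i) a) +
      ∑ l, s (𝒜.act (HAlg.t k i l) a) * j (HAlg.x k l))
    (hst : ∀ i m a, j (HAlg.t k i m) * s a = ∑ l, s (𝒜.act (HAlg.t k i l) a) * j (HAlg.t k l m))
    (hsu : ∀ i m a, j (HAlg.u k i m) * s a = ∑ l, s (𝒜.act (HAlg.u k i l) a) * j (HAlg.u k l m))
    (htx : ∀ i a, t (op a) * j (HAlg.x k i) = j (HAlg.x k i) * t (op a) +
      ∑ l, j (HAlg.t k i l) * t (op (𝒜.act (antipode k (HAlg.x k l)) a)))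
    (htt : ∀ i m a, t (op a) * j (HAlg.t k i m) =
      ∑ l, j (HAlg.t k i l) * t (op (𝒜.act (HAlg.u k m l) a)))
    (htu : ∀ i m a, t (op a) * j (HAlg.u k i m) =
      ∑ l, j (HAlg.u k i l) * t (op (𝒜.act (HAlg.t k m l) a))) : SmashRep 𝒜 B where
  s := s
  t := t
  j := j
  comm := comm
  j_mul_s h := by
    induction h using HAlg.induct with
    | hx i =>
      intro a
      rw [HAlg.sweedler_x _ _ (by intros; fun_prop) (by intros; fun_prop), hsx]
      simp
    | ht i m =>
      intro a
      rw [HAlg.sweedler_t _ _ _ (by intros; fun_prop) (by intros; fun_prop), hst]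
    | hu i m =>
      intro a
      rw [HAlg.sweedler_u _ _ _ (by intros; fun_prop) (by intros; fun_prop), hsu]
    | hk r =>
      intro a
      rw [HAlg.sweedler_algebraMap _ _ (by intros; fun_prop) (by intros; fun_prop)]
      simp [Algebra.smul_def]
    | ha h g hh hg =>
      intro a
      rw [HAlg.sweedler_add _ _ _ (by intros; fun_prop) (by intros; fun_prop), map_add, add_mul,
        hh, hg]
    | hm h g hh hg =>
      -- The relations pass to products: j(h) j(g) s(a) is the sum of j(h) s(g₁ ▷ a) j(g₂), and the
      -- relation for h applies with g₁ ▷ a in place of a.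
      intro a
      rw [sweedler_product _ _ _ (by intros; fun_prop) (by intros; fun_prop), sweedler_comm,
        map_mul, mul_assoc, hg]
      simp only [mul_sweedler, ← mul_assoc, hh]
      simp only [sweedler_mul, map_mul, Module.End.mul_apply, mul_assoc]
  t_mul_j b h := by
    have lin : IsLin k (fun x : A => t (op x)) := ⟨fun x y => by simp, fun r x => by simp⟩
    have hl : ∀ (f : HAlg k I → A), IsLin k f → IsLin k (fun x => t (op (f x))) :=
      fun f hf => lin.comp hf
    -- b must vary: in the product case the relation for g is applied to S(h₂) ▷ b.
    induction h using HAlg.induct generalizing b with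
    | hx i =>
      rw [HAlg.sweedler_x _ _ (by intros; fun_prop)
        (fun _ => (hl _ (by fun_prop)).const_mul _), htx]
      simp
    | ht i m =>
      rw [HAlg.sweedler_t _ _ _ (by intros; fun_prop)
        (fun _ => (hl _ (by fun_prop)).const_mul _), htt]
      simp only [HAlg.antipode_t]
    | hu i m =>
      rw [HAlg.sweedler_u _ _ _ (by intros; fun_prop)
        (fun _ => (hl _ (by fun_prop)).const_mul _), htu]
      simp only [HAlg.antipode_u]
    | hk r =>
      rw [HAlg.sweedler_algebraMap _ _ (by intros; fun_prop)
        (fun _ => (hl _ (by fun_prop)).const_mul _)]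
      simp [Algebra.smul_def, Algebra.commutes]
    | ha h g hh hg =>
      rw [HAlg.sweedler_add _ _ _ (by intros; fun_prop)
        (fun _ => (hl _ (by fun_prop)).const_mul _), map_add, mul_add, hh, hg]
    | hm h g hh hg =>
      rw [sweedler_product _ _ _ (by intros; fun_prop)
        (fun _ => (hl _ (by fun_prop)).const_mul _), map_mul, ← mul_assoc, hh]
      simp only [sweedler_mul, mul_assoc, hg]
      simp only [mul_sweedler, map_mul, antipode_mul_antidistrib, Module.End.mul_apply, mul_assoc]

end HAlgSweedler

/-! ### Dual bases of a pivotal calculus and the action of H on A -/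

section PivotalBasis
open Coalgebra HopfAlgebra MulOpposite
variable {k A Ω 𝔛 I : Type*} [Field k] [Ring A] [Algebra k A]
    [AddCommGroup Ω] [Module k Ω] [Module A Ω] [Module Aᵐᵒᵖ Ω] [SMulCommClass A Aᵐᵒᵖ Ω]
    [IsScalarTower k A Ω] [IsScalarTower k Aᵐᵒᵖ Ω]
    [AddCommGroup 𝔛] [Module k 𝔛] [Module A 𝔛] [Module Aᵐᵒᵖ 𝔛] [SMulCommClass A Aᵐᵒᵖ 𝔛]
    [IsScalarTower k A 𝔛] [IsScalarTower k Aᵐᵒᵖ 𝔛]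
    [Fintype I]

namespace PivotalDual
variable {P : PivotalDual k A Ω 𝔛 I I}

/-- This is the coevaluation identity for w paired with y; it contracts the matrix sums that arise
from the coproducts of x_i and t_ij. -/
theorem sum_evL_mul_evL (y : 𝔛) (w : Ω) :
    ∑ i, P.evL y (P.ω i) * P.evL (P.x i) w = P.evL y w := by
  conv_rhs => rw [← P.coevL_Ω w]
  simp [P.evL_right]

/-- `f ↦ evL(y, f w)` -/
noncomputable def tOp (P : PivotalDual k A Ω 𝔛 I I) (y : 𝔛) (w : Ω) : Module.End k A where
  toFun f := P.evL y (f • w)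
  map_add' f g := by rw [add_smul, map_add]
  map_smul' r f := by rw [smul_assoc, map_smul, RingHom.id_apply]

/-- `f ↦ evR(w, f y)` -/
noncomputable def uOp (P : PivotalDual k A Ω 𝔛 I I) (w : Ω) (y : 𝔛) : Module.End k A where
  toFun f := P.evR w (f • y)
  map_add' f g := by rw [add_smul, map_add]
  map_smul' r f := by rw [smul_assoc, map_smul, RingHom.id_apply]

theorem tOp_apply (y : 𝔛) (w : Ω) (f : A) : P.tOp y w f = P.evL y (f • w) := rfl
theorem uOp_apply (w : Ω) (y : 𝔛) (f : A) : P.uOp w y f = P.evR w (f • y) := rfl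

variable [DecidableEq I]

/-- The two coevaluations of a pivotal dual are `∑ ω_i ⊗ x_i` and `∑ x_i ⊗ ω_i` for dual bases
`ω_i` and `x_i`. -/
structure IsDualBasis (P : PivotalDual k A Ω 𝔛 I I) : Prop where
  η_eq : P.η = P.ω
  y_eq : P.y = P.x
  evL_x_ω : ∀ i j, P.evL (P.x i) (P.ω j) = if i = j then 1 else 0
  evR_ω_x : ∀ i j, P.evR (P.ω i) (P.x j) = if i = j then 1 else 0

/-- Coevaluation writes w in the basis ω_i with coefficients evL(x_i, w), and coordinates are
unique. Hence the right partial derivatives and C⁻¹ are evaluations; `repr_left_eq` treats C by the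
other coevaluation. -/
theorem repr_right_eq (bR : Module.Basis I Aᵐᵒᵖ Ω) (hR : ⇑bR = P.ω) (w : Ω) (i : I) :
    unop (bR.repr w i) = P.evL (P.x i) w := by
  conv_lhs => rw [← P.coevL_Ω w, ← hR]
  simp [Finsupp.single_apply]

theorem repr_left_eq (bL : Module.Basis I A Ω) (hL : ⇑bL = P.ω) (hη : P.η = P.ω)
    (hy : P.y = P.x) (w : Ω) (i : I) :
    bL.repr w i = P.evR w (P.x i) := by
  conv_lhs => rw [← P.coevR_Ω w, hη, hy, ← hL]
  simp [Finsupp.single_apply]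

theorem isDualBasis (bL : Module.Basis I A Ω) (bR : Module.Basis I Aᵐᵒᵖ Ω) (hL : ⇑bL = P.ω)
    (hR : ⇑bR = P.ω) (hη : P.η = P.ω) (hy : P.y = P.x) : P.IsDualBasis where
  η_eq := hη
  y_eq := hy
  evL_x_ω i j := by
    rw [← repr_right_eq bR hR, ← hR]
    simp [Finsupp.single_apply, apply_ite unop, eq_comm]
  evR_ω_x i j := by
    rw [← repr_left_eq bL hL hη hy, ← hL]
    simp [Finsupp.single_apply]

namespace IsDualBasis
variable (hP : P.IsDualBasis)
include hP

theorem sum_evR_smul (w : Ω) : ∑ i, P.evR w (P.x i) • P.ω i = w := by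
  have := P.coevR_Ω w
  rwa [hP.η_eq, hP.y_eq] at this

theorem sum_op_evR_smul (z : 𝔛) : ∑ i, op (P.evR (P.ω i) z) • P.x i = z := by
  have := P.coevR_𝔛 z
  rwa [hP.η_eq, hP.y_eq] at this

theorem sum_evR_mul_evR (w : Ω) (y : 𝔛) :
    ∑ i, P.evR w (P.x i) * P.evR (P.ω i) y = P.evR w y := by
  conv_rhs => rw [← hP.sum_evR_smul w]
  simp [P.evR_left]

end IsDualBasis

variable (D : DifferentialCalculus k A Ω) (hP : P.IsDualBasis)

/-- The action of `H` on `A`. -/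
noncomputable def IsDualBasis.actHom : HAlg k I →ₐ[k] Module.End k A :=
  HAlg.lift (fun i => P.evL (P.x i) ∘ₗ D.d) (fun i j => P.tOp (P.x i) (P.ω j))
    (fun i j => P.uOp (P.ω i) (P.x j))
    -- Each of the four relations is one duality identity: balancing moves the inner evaluation
    -- across the outer one and exposes a coevaluation sum. The identities used are, in order, those
    -- of coevR on Ω, coevL on Ω, coevR on 𝔛 and coevL on 𝔛.
    (fun i m => by
      ext f
      simp only [LinearMap.sum_apply, Module.End.mul_apply, tOp_apply, uOp_apply]
      simp only [← P.evR_balanced, ← map_sum, hP.sum_evR_smul, P.evL_right, hP.evL_x_ω]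
      split_ifs <;> simp)
    (fun i m => by
      ext f
      simp only [LinearMap.sum_apply, Module.End.mul_apply, tOp_apply, uOp_apply]
      simp only [← P.evR_balanced, ← LinearMap.sum_apply, ← map_sum, P.coevL_Ω, P.evR_left,
        hP.evR_ω_x, eq_comm (a := m)]
      split_ifs <;> simp)
    (fun i m => by
      ext f
      simp only [LinearMap.sum_apply, Module.End.mul_apply, tOp_apply, uOp_apply]
      simp only [← P.evL_balanced, ← LinearMap.sum_apply, ← map_sum, hP.sum_op_evR_smul, P.evL_left,
        hP.evL_x_ω, eq_comm (a := m)]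
      split_ifs <;> simp)
    (fun i m => by
      ext f
      simp only [LinearMap.sum_apply, Module.End.mul_apply, tOp_apply, uOp_apply]
      simp only [← P.evL_balanced, ← map_sum, P.coevL_𝔛, P.evR_right, hP.evR_ω_x]
      split_ifs <;> simp)

theorem IsDualBasis.actHom_x (i : I) (f : A) :
    hP.actHom D (HAlg.x k i) f = P.evL (P.x i) (D.d f) := by simp [actHom]
theorem IsDualBasis.actHom_t (i j : I) (f : A) :
    hP.actHom D (HAlg.t k i j) f = P.evL (P.x i) (f • P.ω j) := by simp [actHom, tOp_apply]
theorem IsDualBasis.actHom_u (i j : I) (f : A) :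
    hP.actHom D (HAlg.u k i j) f = P.evR (P.ω i) (f • P.x j) := by simp [actHom, uOp_apply]

@[fun_prop]
theorem _root_.IsLin.actHom_left {M : Type*} [AddCommGroup M] [Module k M] {f : M → HAlg k I}
    (hf : IsLin k f) (a : A) : IsLin k (fun x => hP.actHom D (f x) a) :=
  ⟨fun x y => by simp [hf.map_add], fun r x => by simp [hf.map_smul]⟩

/-- For x_i this is the Leibniz rule, which accounts for both terms of Δ x_i; for t_ij and u_ij it
is the bimodule structure of Ω and 𝔛. The property is stable under sums and products in H. -/
theorem IsDualBasis.actHom_mul (h : HAlg k I) : ∀ a b : A, hP.actHom D h (a * b) =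
    sweedler k h fun h₁ h₂ => hP.actHom D h₁ a * hP.actHom D h₂ b := by
  induction h using HAlg.induct with
  | hx i =>
    intro a b
    rw [HAlg.sweedler_x _ _ (by intros; fun_prop) (by intros; fun_prop)]
    simp only [actHom_x, actHom_t, map_one, Module.End.one_apply, D.leibniz, map_add, P.evL_right,
      ← P.evL_balanced, sum_evL_mul_evL]
  | ht i j =>
    intro a b
    rw [HAlg.sweedler_t _ _ _ (by intros; fun_prop) (by intros; fun_prop)]
    simp only [actHom_t, ← P.evL_balanced _ _ (P.ω _)]
    rw [op_mul, mul_smul, P.evL_balanced b]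
    rw [← sum_evL_mul_evL]
    simp only [P.evL_balanced]
  | hu i j =>
    intro a b
    rw [HAlg.sweedler_u _ _ _ (by intros; fun_prop) (by intros; fun_prop)]
    simp only [actHom_u]
    rw [mul_smul, ← P.evR_balanced, ← hP.sum_evR_mul_evR]
    simp only [P.evR_balanced]
  | hk r =>
    intro a b
    rw [HAlg.sweedler_algebraMap _ _ (by intros; fun_prop) (by intros; fun_prop)]
    simp
  | ha h g hh hg =>
    intro a b
    rw [HAlg.sweedler_add _ _ _ (by intros; fun_prop) (by intros; fun_prop), map_add,
      LinearMap.add_apply, hh, hg]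
  | hm h g hh hg =>
    intro a b
    rw [sweedler_product _ _ _ (by intros; fun_prop) (by intros; fun_prop), sweedler_comm,
      map_mul (hP.actHom D), Module.End.mul_apply, hg, map_sweedler]
    simp only [hh, map_mul, Module.End.mul_apply]

/-- `A` is a module algebra over `H`. -/
noncomputable def IsDualBasis.moduleAlgebra : HopfModuleAlgebra k (HAlg k I) A where
  act := hP.actHom D
  act_mul h a b := by
    rw [hP.actHom_mul, comul_eq_sweedler, map_sweedler, map_sweedler]
    rfl
  act_one h := by
    induction h using HAlg.induct with
    | hx i =>
      have : D.d 1 = 0 := by simpa using D.leibniz 1 1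
      rw [actHom_x, this, HAlg.counit_x, map_zero, map_zero]
    | ht i j => rw [actHom_t, one_smul, hP.evL_x_ω, HAlg.counit_t]; split_ifs <;> simp
    | hu i j => rw [actHom_u, one_smul, hP.evR_ω_x, HAlg.counit_u]; split_ifs <;> simp
    | hk r => simp [Algebra.algebraMap_eq_smul_one]
    | ha h g hh hg => simp only [map_add, LinearMap.add_apply, hh, hg]
    | hm h g hh hg =>
      rw [map_mul, Module.End.mul_apply, hg, Bialgebra.counit_mul,
        Algebra.algebraMap_eq_smul_one, map_smul, hh, map_mul, Algebra.smul_def, Algebra.commutes]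

theorem IsDualBasis.act_x (i : I) (f : A) :
    (hP.moduleAlgebra D).act (HAlg.x k i) f = P.evL (P.x i) (D.d f) := hP.actHom_x D i f
theorem IsDualBasis.act_t (i j : I) (f : A) :
    (hP.moduleAlgebra D).act (HAlg.t k i j) f = P.evL (P.x i) (f • P.ω j) := hP.actHom_t D i j f
theorem IsDualBasis.act_u (i j : I) (f : A) :
    (hP.moduleAlgebra D).act (HAlg.u k i j) f = P.evR (P.ω i) (f • P.x j) := hP.actHom_u D i j f

/-- The contraction of u_ji with x_j reassembles d f by coevaluation. As evR(d f, x_i) is the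
coefficient of ω_i in d f on the left, S x_i acts as minus the left partial derivative. -/
theorem IsDualBasis.act_antipode_x (i : I) (f : A) :
    (hP.moduleAlgebra D).act (antipode k (HAlg.x k i)) f = -P.evR (D.d f) (P.x i) := by
  rw [HAlg.antipode_x, map_neg, map_sum]
  simp only [map_mul, LinearMap.neg_apply, LinearMap.sum_apply, Module.End.mul_apply, act_u, act_x]
  simp only [← P.evR_balanced, ← LinearMap.sum_apply, ← map_sum, P.coevL_Ω]

end PivotalDual
end PivotalBasis

/-! ### Generators and relations of IIL(Ω) compared with A^e # H -/

section GhobadiPresentation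
open Coalgebra HopfAlgebra MulOpposite
variable {k A Ω 𝔛 I : Type*} [Field k] [Ring A] [Algebra k A]
    [AddCommGroup Ω] [Module k Ω] [Module A Ω] [Module Aᵐᵒᵖ Ω] [SMulCommClass A Aᵐᵒᵖ Ω]
    [IsScalarTower k A Ω] [IsScalarTower k Aᵐᵒᵖ Ω]
    [AddCommGroup 𝔛] [Module k 𝔛] [Module A 𝔛] [Module Aᵐᵒᵖ 𝔛] [SMulCommClass A Aᵐᵒᵖ 𝔛]
    [IsScalarTower k A 𝔛] [IsScalarTower k Aᵐᵒᵖ 𝔛]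
    [Fintype I]

namespace GhobadiAlgebra

section Relations
variable {J : Type*} [Fintype J] (D : DifferentialCalculus k A Ω) (P : PivotalDual k A Ω 𝔛 I J)

theorem mk_rel {a b : GhobadiFree k A Ω 𝔛} (h : GhobadiRel D P a b) : mk D P a = mk D P b :=
  RingQuot.mkAlgHom_rel k h

theorem src_add (a b : A) : src D P (a + b) = src D P a + src D P b :=
  (mk_rel D P (.src_add a b)).trans (map_add _ _ _)
theorem src_mul (a b : A) : src D P (a * b) = src D P a * src D P b :=
  (mk_rel D P (.src_mul a b)).trans (map_mul _ _ _)
theorem src_algebraMap (r : k) : src D P (algebraMap k A r) = algebraMap k _ r :=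
  (mk_rel D P (.src_algebraMap r)).trans (AlgHom.commutes _ _)
theorem tgt_add (a b : A) : tgt D P (a + b) = tgt D P a + tgt D P b :=
  (mk_rel D P (.tgt_add a b)).trans (map_add _ _ _)
theorem tgt_mul (a b : A) : tgt D P (a * b) = tgt D P b * tgt D P a :=
  (mk_rel D P (.tgt_mul a b)).trans (map_mul _ _ _)
theorem tgt_algebraMap (r : k) : tgt D P (algebraMap k A r) = algebraMap k _ r :=
  (mk_rel D P (.tgt_algebraMap r)).trans (AlgHom.commutes _ _)
theorem src_mul_tgt (a b : A) : src D P a * tgt D P b = tgt D P b * src D P a := by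
  have h := mk_rel D P (.src_tgt a b)
  simp only [map_mul] at h
  exact h

/-- The source map as an algebra map. -/
noncomputable def srcHom : A →ₐ[k] GhobadiAlgebra D P where
  toFun := src D P
  map_one' := by simpa using src_algebraMap D P 1
  map_zero' := by simpa using src_algebraMap D P 0
  map_add' := src_add D P
  map_mul' := src_mul D P
  commutes' := src_algebraMap D P

/-- The target map as an algebra map. -/
noncomputable def tgtHom : Aᵐᵒᵖ →ₐ[k] GhobadiAlgebra D P where
  toFun a := tgt D P (unop a)
  map_one' := by simpa using tgt_algebraMap D P 1
  map_zero' := by simpa using tgt_algebraMap D P 0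
  map_add' _ _ := tgt_add D P _ _
  map_mul' _ _ := tgt_mul D P _ _
  commutes' := tgt_algebraMap D P

theorem srcHom_apply (a : A) : srcHom D P a = src D P a := rfl
theorem tgtHom_op (a : A) : tgtHom D P (op a) = tgt D P a := rfl

/-- `x ↦ x` as a linear map. -/
noncomputable def vecLin : 𝔛 →ₗ[k] GhobadiAlgebra D P where
  toFun := vec D P
  map_add' x y := (mk_rel D P (.vec_add x y)).trans (map_add _ _ _)
  map_smul' r x := (mk_rel D P (.vec_smul r x)).trans (map_smul _ _ _)

/-- `(x, ξ)` as a bilinear map. -/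
noncomputable def vecFormLin : 𝔛 →ₗ[k] Ω →ₗ[k] GhobadiAlgebra D P :=
  LinearMap.mk₂ k (vecForm D P)
    (fun _ _ _ => (mk_rel D P (.vecForm_add_left _ _ _)).trans (map_add _ _ _))
    (fun _ _ _ => (mk_rel D P (.vecForm_smul_left _ _ _)).trans (map_smul _ _ _))
    (fun _ _ _ => (mk_rel D P (.vecForm_add_right _ _ _)).trans (map_add _ _ _))
    (fun _ _ _ => (mk_rel D P (.vecForm_smul_right _ _ _)).trans (map_smul _ _ _))

/-- `(ξ, y)` as a bilinear map. -/
noncomputable def formVecLin : Ω →ₗ[k] 𝔛 →ₗ[k] GhobadiAlgebra D P :=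
  LinearMap.mk₂ k (formVec D P)
    (fun _ _ _ => (mk_rel D P (.formVec_add_left _ _ _)).trans (map_add _ _ _))
    (fun _ _ _ => (mk_rel D P (.formVec_smul_left _ _ _)).trans (map_smul _ _ _))
    (fun _ _ _ => (mk_rel D P (.formVec_add_right _ _ _)).trans (map_add _ _ _))
    (fun _ _ _ => (mk_rel D P (.formVec_smul_right _ _ _)).trans (map_smul _ _ _))

theorem vecLin_apply (x : 𝔛) : vecLin D P x = vec D P x := rfl
theorem vecFormLin_apply (x : 𝔛) (ξ : Ω) : vecFormLin D P x ξ = vecForm D P x ξ := rfl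
theorem formVecLin_apply (ξ : Ω) (y : 𝔛) : formVecLin D P ξ y = formVec D P ξ y := rfl

theorem src_mul_vec (a : A) (x : 𝔛) : src D P a * vec D P x = vec D P (a • x) := by
  have h := mk_rel D P (.src_vec a x)
  simp only [map_mul] at h
  exact h
theorem vec_mul_src (a : A) (x : 𝔛) :
    vec D P x * src D P a = vec D P (op a • x) + src D P (P.evL x (D.d a)) := by
  have h := mk_rel D P (.vec_src a x)
  simp only [map_mul, map_add] at h
  exact h
theorem vec_mul_tgt (a : A) (x : 𝔛) :
    vec D P x * tgt D P a = tgt D P a * vec D P x + vecForm D P x (D.d a) := by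
  have h := mk_rel D P (.vec_tgt a x)
  simp only [map_mul, map_add] at h
  exact h
theorem src_mul_vecForm (a : A) (x : 𝔛) (ξ : Ω) :
    src D P a * vecForm D P x ξ = vecForm D P (a • x) ξ := by
  have h := mk_rel D P (.src_vecForm a x ξ)
  simp only [map_mul] at h
  exact h
theorem vecForm_mul_src (a : A) (x : 𝔛) (ξ : Ω) :
    vecForm D P x ξ * src D P a = vecForm D P (op a • x) ξ := by
  have h := mk_rel D P (.vecForm_src a x ξ)
  simp only [map_mul] at h
  exact h
theorem tgt_mul_vecForm (a : A) (x : 𝔛) (ξ : Ω) :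
    tgt D P a * vecForm D P x ξ = vecForm D P x (op a • ξ) := by
  have h := mk_rel D P (.tgt_vecForm a x ξ)
  simp only [map_mul] at h
  exact h
theorem vecForm_mul_tgt (a : A) (x : 𝔛) (ξ : Ω) :
    vecForm D P x ξ * tgt D P a = vecForm D P x (a • ξ) := by
  have h := mk_rel D P (.vecForm_tgt a x ξ)
  simp only [map_mul] at h
  exact h
theorem src_mul_formVec (a : A) (ξ : Ω) (y : 𝔛) :
    src D P a * formVec D P ξ y = formVec D P (a • ξ) y := by
  have h := mk_rel D P (.src_formVec a ξ y)
  simp only [map_mul] at h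
  exact h
theorem formVec_mul_src (a : A) (ξ : Ω) (y : 𝔛) :
    formVec D P ξ y * src D P a = formVec D P (op a • ξ) y := by
  have h := mk_rel D P (.formVec_src a ξ y)
  simp only [map_mul] at h
  exact h
theorem tgt_mul_formVec (a : A) (ξ : Ω) (y : 𝔛) :
    tgt D P a * formVec D P ξ y = formVec D P ξ (op a • y) := by
  have h := mk_rel D P (.tgt_formVec a ξ y)
  simp only [map_mul] at h
  exact h
theorem formVec_mul_tgt (a : A) (ξ : Ω) (y : 𝔛) :
    formVec D P ξ y * tgt D P a = formVec D P ξ (a • y) := by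
  have h := mk_rel D P (.formVec_tgt a ξ y)
  simp only [map_mul] at h
  exact h

theorem sum_formVec_mul_vecForm (ξ : Ω) (y : 𝔛) :
    ∑ i, formVec D P (P.ω i) y * vecForm D P (P.x i) ξ = tgt D P (P.evR ξ y) := by
  have h := mk_rel D P (.inv_right ξ y)
  simp only [map_sum, map_mul] at h
  exact h
theorem sum_vecForm_mul_formVec (x : 𝔛) (ξ : Ω) :
    ∑ j, vecForm D P x (P.η j) * formVec D P ξ (P.y j) = src D P (P.evL x ξ) := by
  have h := mk_rel D P (.inv_left x ξ)
  simp only [map_sum, map_mul] at h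
  exact h
theorem sum_vecForm_mul_formVec' (x : 𝔛) (ξ : Ω) :
    ∑ j, vecForm D P (P.y j) ξ * formVec D P (P.η j) x = tgt D P (P.evL x ξ) := by
  have h := mk_rel D P (.biinv_left x ξ)
  simp only [map_sum, map_mul] at h
  exact h
theorem sum_formVec_mul_vecForm' (ξ : Ω) (x : 𝔛) :
    ∑ i, formVec D P ξ (P.x i) * vecForm D P x (P.ω i) = src D P (P.evR ξ x) := by
  have h := mk_rel D P (.biinv_right ξ x)
  simp only [map_sum, map_mul] at h
  exact h

/-- By coevaluation and left linearity the elements x_i generate all vectors over A. The expansions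
of (x, ξ) and (ξ, y) below serve the same purpose for the images of t_ij and u_ij, with coefficients
from A on the left and from A^op on the right. -/
theorem vec_eq_sum (x : 𝔛) : vec D P x = ∑ i, src D P (P.evL x (P.ω i)) * vec D P (P.x i) := by
  simp only [src_mul_vec]
  simp only [← vecLin_apply, ← map_sum, P.coevL_𝔛]

theorem vecForm_eq_sum_left (x : 𝔛) (ξ : Ω) :
    vecForm D P x ξ = ∑ i, src D P (P.evL x (P.ω i)) * vecForm D P (P.x i) ξ := by
  simp only [src_mul_vecForm]
  simp only [← vecFormLin_apply, ← LinearMap.sum_apply, ← map_sum, P.coevL_𝔛]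

theorem formVec_eq_sum_right (ξ : Ω) (y : 𝔛) :
    formVec D P ξ y = ∑ i, formVec D P ξ (P.x i) * tgt D P (P.evL y (P.ω i)) := by
  simp only [formVec_mul_tgt]
  simp only [← formVecLin_apply, ← map_sum, P.coevL_𝔛]

end Relations

section Basis
variable [DecidableEq I] (D : DifferentialCalculus k A Ω) {P : PivotalDual k A Ω 𝔛 I I} (hP : P.IsDualBasis)

theorem vecForm_eq_sum_right (hP : P.IsDualBasis) (x : 𝔛) (ξ : Ω) :
    vecForm D P x ξ = ∑ i, vecForm D P x (P.ω i) * tgt D P (P.evR ξ (P.x i)) := by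
  simp only [vecForm_mul_tgt]
  simp only [← vecFormLin_apply, ← map_sum, hP.sum_evR_smul]

theorem formVec_eq_sum_left (hP : P.IsDualBasis) (ξ : Ω) (y : 𝔛) :
    formVec D P ξ y = ∑ i, src D P (P.evR ξ (P.x i)) * formVec D P (P.ω i) y := by
  simp only [src_mul_formVec]
  simp only [← formVecLin_apply, ← LinearMap.sum_apply, ← map_sum,
    hP.sum_evR_smul]

/-- The algebra map `H → IIL(Ω)`. -/
noncomputable def ofHAlg : HAlg k I →ₐ[k] GhobadiAlgebra D P :=
  HAlg.lift (fun i => vec D P (P.x i)) (fun i m => vecForm D P (P.x i) (P.ω m))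
    (fun i m => formVec D P (P.ω i) (P.x m))
    -- The four families of relations of H are the relations `inv_left`, `inv_right`, `biinv_left`
    -- and `biinv_right`, in this order, evaluated on the dual bases.
    (fun i m => by
      have := sum_vecForm_mul_formVec D P (P.x i) (P.ω m)
      rw [hP.η_eq, hP.y_eq, hP.evL_x_ω] at this
      rw [this, ← srcHom_apply]
      split_ifs <;> simp)
    (fun j m => by
      rw [sum_formVec_mul_vecForm D P (P.ω m) (P.x j), hP.evR_ω_x, ← tgtHom_op]
      simp only [eq_comm (a := m)]
      split_ifs <;> simp)
    (fun i m => by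
      have := sum_vecForm_mul_formVec' D P (P.x m) (P.ω i)
      rw [hP.η_eq, hP.y_eq, hP.evL_x_ω] at this
      rw [this, ← tgtHom_op]
      simp only [eq_comm (a := m)]
      split_ifs <;> simp)
    (fun i m => by
      rw [sum_formVec_mul_vecForm' D P (P.ω i) (P.x m), hP.evR_ω_x, ← srcHom_apply]
      split_ifs <;> simp)

theorem ofHAlg_x (i : I) : ofHAlg D hP (HAlg.x k i) = vec D P (P.x i) := by simp [ofHAlg]
theorem ofHAlg_t (i m : I) : ofHAlg D hP (HAlg.t k i m) = vecForm D P (P.x i) (P.ω m) := by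
  simp [ofHAlg]
theorem ofHAlg_u (i m : I) : ofHAlg D hP (HAlg.u k i m) = formVec D P (P.ω i) (P.x m) := by
  simp [ofHAlg]

/-- `IIL(Ω)` satisfies the relations of `A^e # H`. -/
noncomputable def rep : SmashRep (hP.moduleAlgebra D) (GhobadiAlgebra D P) :=
  SmashRep.ofGenerators (srcHom D P) (tgtHom D P) (ofHAlg D hP)
    (fun a b => src_mul_tgt D P a (unop b))
    (fun i a => by
      simp only [ofHAlg_x, srcHom_apply, hP.act_x, hP.act_t, vec_mul_src, ← P.evL_balanced,
        ← vec_eq_sum, add_comm])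
    (fun i m a => by
      simp only [ofHAlg_t, srcHom_apply, hP.act_t, vecForm_mul_src, ← P.evL_balanced,
        ← vecForm_eq_sum_left])
    (fun i m a => by
      simp only [ofHAlg_u, srcHom_apply, hP.act_u, formVec_mul_src, ← P.evR_balanced,
        ← formVec_eq_sum_left D hP])
    -- Since S x_l acts by -evR(d a, x_l), the sum over l is -(x_i, d a), and the claim is the
    -- relation between x and a̲.
    (fun i a => by
      simp only [ofHAlg_x, ofHAlg_t, tgtHom_op, hP.act_antipode_x, op_neg, map_neg, mul_neg,
        Finset.sum_neg_distrib, ← vecForm_eq_sum_right D hP, vec_mul_tgt]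
      abel)
    (fun i m a => by
      simp only [ofHAlg_t, tgtHom_op, hP.act_u, tgt_mul_vecForm, ← P.evR_balanced,
        ← vecForm_eq_sum_right D hP])
    (fun i m a => by
      simp only [ofHAlg_u, tgtHom_op, hP.act_t, tgt_mul_formVec, ← P.evL_balanced,
        ← formVec_eq_sum_right])

theorem rep_s (a : A) : (rep D hP).s a = src D P a := rfl
theorem rep_t (a : A) : (rep D hP).t (op a) = tgt D P a := rfl
theorem rep_j (h : HAlg k I) : (rep D hP).j h = ofHAlg D hP h := rfl

end Basis
end GhobadiAlgebra

/-! ### Images of the generators of IIL(Ω) in an arbitrary representation of A^e # H -/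

namespace PivotalDual.IsDualBasis
variable [DecidableEq I] {D : DifferentialCalculus k A Ω} {P : PivotalDual k A Ω 𝔛 I I} {hP : P.IsDualBasis}
  {B : Type*} [Ring B] [Algebra k B] (R : SmashRep (hP.moduleAlgebra D) B)

theorem j_x_mul_s (i : I) (a : A) : R.j (HAlg.x k i) * R.s a =
    R.s (P.evL (P.x i) (D.d a)) + ∑ l, R.s (P.evL (P.x i) (a • P.ω l)) * R.j (HAlg.x k l) := by
  rw [R.j_mul_s, HAlg.sweedler_x _ _ (by intros; fun_prop) (by intros; fun_prop)]
  simp [act_x, act_t]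

theorem j_t_mul_s (i m : I) (a : A) : R.j (HAlg.t k i m) * R.s a =
    ∑ l, R.s (P.evL (P.x i) (a • P.ω l)) * R.j (HAlg.t k l m) := by
  rw [R.j_mul_s, HAlg.sweedler_t _ _ _ (by intros; fun_prop) (by intros; fun_prop)]
  simp [act_t]

theorem j_u_mul_s (i m : I) (a : A) : R.j (HAlg.u k i m) * R.s a =
    ∑ l, R.s (P.evR (P.ω i) (a • P.x l)) * R.j (HAlg.u k l m) := by
  rw [R.j_mul_s, HAlg.sweedler_u _ _ _ (by intros; fun_prop) (by intros; fun_prop)]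
  simp [act_u]

theorem t_mul_j_x (i : I) (a : A) : R.t (op a) * R.j (HAlg.x k i) =
    R.j (HAlg.x k i) * R.t (op a) -
      ∑ l, R.j (HAlg.t k i l) * R.t (op (P.evR (D.d a) (P.x l))) := by
  rw [R.t_mul_j, HAlg.sweedler_x _ _ (by intros; fun_prop) (by intros; fun_prop)]
  simp [act_antipode_x, sub_eq_add_neg]

theorem t_mul_j_t (i m : I) (a : A) : R.t (op a) * R.j (HAlg.t k i m) =
    ∑ l, R.j (HAlg.t k i l) * R.t (op (P.evR (P.ω m) (a • P.x l))) := by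
  rw [R.t_mul_j, HAlg.sweedler_t _ _ _ (by intros; fun_prop) (by intros; fun_prop)]
  simp [HAlg.antipode_t, act_u]

theorem t_mul_j_u (i m : I) (a : A) : R.t (op a) * R.j (HAlg.u k i m) =
    ∑ l, R.j (HAlg.u k i l) * R.t (op (P.evL (P.x m) (a • P.ω l))) := by
  rw [R.t_mul_j, HAlg.sweedler_u _ _ _ (by intros; fun_prop) (by intros; fun_prop)]
  simp [HAlg.antipode_u, act_t]

/-- The image of `x` in a representation of `A^e # H`. -/
noncomputable def repVec (x : 𝔛) : B := ∑ i, R.s (P.evL x (P.ω i)) * R.j (HAlg.x k i)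

/-- The image of `(x, ξ)` in a representation of `A^e # H`. -/
noncomputable def repVecForm (x : 𝔛) (ξ : Ω) : B :=
  ∑ i, R.s (P.evL x (P.ω i)) * ∑ m, R.j (HAlg.t k i m) * R.t (op (P.evR ξ (P.x m)))

/-- The image of `(ξ, y)` in a representation of `A^e # H`. -/
noncomputable def repFormVec (ξ : Ω) (y : 𝔛) : B :=
  ∑ i, R.s (P.evR ξ (P.x i)) * ∑ m, R.j (HAlg.u k i m) * R.t (op (P.evL y (P.ω m)))

theorem s_mul_repVec (a : A) (x : 𝔛) : R.s a * repVec R x = repVec R (a • x) := by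
  simp only [repVec, Finset.mul_sum, P.evL_left, map_mul, mul_assoc]

/-- The first term of Δ x_i yields the derivative, and the t-term is contracted by `sum_evL_mul_evL`
into the right action on x. -/
theorem repVec_mul_s (a : A) (x : 𝔛) :
    repVec R x * R.s a = repVec R (op a • x) + R.s (P.evL x (D.d a)) := by
  simp only [repVec, Finset.sum_mul, mul_assoc, j_x_mul_s, mul_add, Finset.sum_add_distrib,
    Finset.mul_sum]
  rw [add_comm, Finset.sum_comm]
  simp only [← mul_assoc, ← map_mul, ← Finset.sum_mul, ← map_sum, sum_evL_mul_evL,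
    P.evL_balanced]

theorem repVec_mul_t (a : A) (x : 𝔛) :
    repVec R x * R.t (op a) = R.t (op a) * repVec R x + repVecForm R x (D.d a) := by
  simp only [repVec, repVecForm, Finset.sum_mul, Finset.mul_sum, mul_assoc,
    ← mul_assoc (R.t (op a)), ← R.comm, ← Finset.sum_add_distrib]
  simp only [t_mul_j_x, mul_sub, ← Finset.mul_sum, sub_add_cancel]

theorem s_mul_repVecForm (a : A) (x : 𝔛) (ξ : Ω) :
    R.s a * repVecForm R x ξ = repVecForm R (a • x) ξ := by
  simp only [repVecForm, Finset.mul_sum, P.evL_left, map_mul, mul_assoc]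

theorem repVecForm_mul_t (a : A) (x : 𝔛) (ξ : Ω) :
    repVecForm R x ξ * R.t (op a) = repVecForm R x (a • ξ) := by
  simp only [repVecForm, Finset.sum_mul, P.evR_left, op_mul, map_mul, mul_assoc]

/-- Moving s(a) to the left inserts the matrix t_il ▷ a = evL(x_i, a ω_l), which the coefficients
evL(x, ω_i) contract to evL(x a, ω_l). The analogous lemmas for (ξ, y) and for t follow the same
pattern. -/
theorem repVecForm_mul_s (a : A) (x : 𝔛) (ξ : Ω) :
    repVecForm R x ξ * R.s a = repVecForm R (op a • x) ξ := by
  simp only [repVecForm, Finset.sum_mul, Finset.mul_sum, mul_assoc, ← R.comm]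
  simp only [← mul_assoc (R.j _) (R.s _), j_t_mul_s, Finset.sum_mul, Finset.mul_sum]
  simp only [← mul_assoc, ← map_mul]
  rw [Finset.sum_congr rfl fun _ _ => Finset.sum_comm, Finset.sum_comm]
  refine Finset.sum_congr rfl fun l _ => ?_
  rw [Finset.sum_comm]
  simp only [← Finset.sum_mul, ← map_sum, sum_evL_mul_evL, P.evL_balanced]

theorem t_mul_repVecForm (a : A) (x : 𝔛) (ξ : Ω) :
    R.t (op a) * repVecForm R x ξ = repVecForm R x (op a • ξ) := by
  simp only [repVecForm, Finset.mul_sum, ← mul_assoc (R.t _), ← R.comm]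
  simp only [mul_assoc (R.s _)]
  simp only [← mul_assoc (R.t _) (R.j _), t_mul_j_t, Finset.sum_mul, Finset.mul_sum]
  simp only [mul_assoc, ← map_mul, ← op_mul]
  refine Finset.sum_congr rfl fun i _ => ?_
  rw [Finset.sum_comm]
  simp only [← Finset.mul_sum, ← map_sum, ← Finset.op_sum, hP.sum_evR_mul_evR, P.evR_balanced]

theorem s_mul_repFormVec (a : A) (ξ : Ω) (y : 𝔛) :
    R.s a * repFormVec R ξ y = repFormVec R (a • ξ) y := by
  simp only [repFormVec, Finset.mul_sum, P.evR_left, map_mul, mul_assoc]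

theorem repFormVec_mul_t (a : A) (ξ : Ω) (y : 𝔛) :
    repFormVec R ξ y * R.t (op a) = repFormVec R ξ (a • y) := by
  simp only [repFormVec, Finset.sum_mul, P.evL_left, op_mul, map_mul, mul_assoc]

theorem repFormVec_mul_s (a : A) (ξ : Ω) (y : 𝔛) :
    repFormVec R ξ y * R.s a = repFormVec R (op a • ξ) y := by
  simp only [repFormVec, Finset.sum_mul, Finset.mul_sum, mul_assoc, ← R.comm]
  simp only [← mul_assoc (R.j _) (R.s _), j_u_mul_s, Finset.sum_mul, Finset.mul_sum]
  simp only [← mul_assoc, ← map_mul]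
  rw [Finset.sum_congr rfl fun _ _ => Finset.sum_comm, Finset.sum_comm]
  refine Finset.sum_congr rfl fun l _ => ?_
  rw [Finset.sum_comm]
  simp only [← Finset.sum_mul, ← map_sum, hP.sum_evR_mul_evR, P.evR_balanced]

theorem t_mul_repFormVec (a : A) (ξ : Ω) (y : 𝔛) :
    R.t (op a) * repFormVec R ξ y = repFormVec R ξ (op a • y) := by
  simp only [repFormVec, Finset.mul_sum, ← mul_assoc (R.t _), ← R.comm]
  simp only [mul_assoc (R.s _)]
  simp only [← mul_assoc (R.t _) (R.j _), t_mul_j_u, Finset.sum_mul, Finset.mul_sum]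
  simp only [mul_assoc, ← map_mul, ← op_mul]
  refine Finset.sum_congr rfl fun i _ => ?_
  rw [Finset.sum_comm]
  simp only [← Finset.mul_sum, ← map_sum, ← Finset.op_sum, sum_evL_mul_evL, P.evL_balanced]

theorem repVecForm_x (i : I) (ξ : Ω) : repVecForm R (P.x i) ξ =
    ∑ m, R.j (HAlg.t k i m) * R.t (op (P.evR ξ (P.x m))) := by
  simp [repVecForm, hP.evL_x_ω]

theorem repVecForm_ω (x : 𝔛) (m : I) : repVecForm R x (P.ω m) =
    ∑ i, R.s (P.evL x (P.ω i)) * R.j (HAlg.t k i m) := by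
  simp [repVecForm, hP.evR_ω_x, apply_ite op]

theorem repFormVec_ω (i : I) (y : 𝔛) : repFormVec R (P.ω i) y =
    ∑ m, R.j (HAlg.u k i m) * R.t (op (P.evL y (P.ω m))) := by
  simp [repFormVec, hP.evR_ω_x]

theorem repFormVec_x (ξ : Ω) (m : I) : repFormVec R ξ (P.x m) =
    ∑ i, R.s (P.evR ξ (P.x i)) * R.j (HAlg.u k i m) := by
  simp [repFormVec, hP.evL_x_ω, apply_ite op]

/-- The inner target element is absorbed into ξ, so that the matrices u and t become adjacent; their
relation leaves a single sum, which is a coevaluation. The other three identities use the remaining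
relations of H in the same way. -/
theorem sum_repFormVec_mul_repVecForm (ξ : Ω) (y : 𝔛) :
    ∑ i, repFormVec R (P.ω i) y * repVecForm R (P.x i) ξ = R.t (op (P.evR ξ y)) := by
  simp only [repFormVec_ω, Finset.sum_mul, mul_assoc, t_mul_repVecForm]
  simp only [repVecForm_x, Finset.mul_sum, ← mul_assoc, ← map_mul]
  rw [Finset.sum_comm]
  rw [Finset.sum_congr rfl fun _ _ => Finset.sum_comm]
  simp only [← Finset.sum_mul, ← map_sum, HAlg.sum_u_t, apply_ite R.j, map_one, map_zero, ite_mul,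
    one_mul, zero_mul, Finset.sum_ite_eq, Finset.mem_univ, if_true, ← Finset.op_sum, P.evR_balanced,
    P.coevL_𝔛]

theorem sum_repVecForm_mul_repFormVec (x : 𝔛) (ξ : Ω) :
    ∑ j, repVecForm R x (P.ω j) * repFormVec R ξ (P.x j) = R.s (P.evL x ξ) := by
  simp only [repFormVec_x, Finset.mul_sum, ← mul_assoc, repVecForm_mul_s]
  simp only [repVecForm_ω, Finset.sum_mul, mul_assoc, ← map_mul]
  rw [Finset.sum_comm]
  rw [Finset.sum_congr rfl fun _ _ => Finset.sum_comm]
  simp only [← Finset.mul_sum, ← map_sum, HAlg.sum_t_u, apply_ite R.j, map_one, map_zero, mul_ite,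
    mul_one, mul_zero, Finset.sum_ite_eq', Finset.mem_univ, if_true, P.evL_balanced,
    hP.sum_evR_smul]

theorem sum_repVecForm_mul_repFormVec' (x : 𝔛) (ξ : Ω) :
    ∑ j, repVecForm R (P.x j) ξ * repFormVec R (P.ω j) x = R.t (op (P.evL x ξ)) := by
  simp only [repVecForm_x, Finset.sum_mul, mul_assoc, t_mul_repFormVec]
  simp only [repFormVec_ω, Finset.mul_sum, ← mul_assoc, ← map_mul]
  rw [Finset.sum_comm]
  rw [Finset.sum_congr rfl fun _ _ => Finset.sum_comm]
  simp only [← Finset.sum_mul, ← map_sum, HAlg.sum_t_u', apply_ite R.j, map_one, map_zero, ite_mul,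
    one_mul, zero_mul, Finset.sum_ite_eq, Finset.mem_univ, if_true, ← Finset.op_sum, P.evL_balanced,
    hP.sum_evR_smul]

theorem sum_repFormVec_mul_repVecForm' (ξ : Ω) (x : 𝔛) :
    ∑ i, repFormVec R ξ (P.x i) * repVecForm R x (P.ω i) = R.s (P.evR ξ x) := by
  simp only [repVecForm_ω, Finset.mul_sum, ← mul_assoc, repFormVec_mul_s]
  simp only [repFormVec_x, Finset.sum_mul, mul_assoc, ← map_mul]
  rw [Finset.sum_comm]
  rw [Finset.sum_congr rfl fun _ _ => Finset.sum_comm]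
  simp only [← Finset.mul_sum, ← map_sum, HAlg.sum_u_t', apply_ite R.j, map_one, map_zero, mul_ite,
    mul_one, mul_zero, Finset.sum_ite_eq', Finset.mem_univ, if_true, P.evR_balanced,
    P.coevL_𝔛]

/-- A representation of `A^e # H` on the generators of `IIL(Ω)`. -/
noncomputable def repGen : GhobadiGen A Ω 𝔛 → B
  | .src a => R.s a
  | .tgt a => R.t (op a)
  | .vec x => repVec R x
  | .vecForm x ξ => repVecForm R x ξ
  | .formVec ξ y => repFormVec R ξ y

theorem repGen_rel {a b : GhobadiFree k A Ω 𝔛} (h : GhobadiRel D P a b) :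
    FreeAlgebra.lift k (repGen R) a = FreeAlgebra.lift k (repGen R) b := by
  cases h <;> simp only [GhobadiFree.src, GhobadiFree.tgt, GhobadiFree.vec, GhobadiFree.vecForm,
    GhobadiFree.formVec, map_mul, map_add, map_sum, map_smul, FreeAlgebra.lift_ι_apply, repGen,
    AlgHom.commutes, op_mul, op_add]
  case tgt_algebraMap r => exact R.t.commutes r
  case src_tgt a b => exact R.comm _ _
  case vec_add => simp [repVec, add_mul, Finset.sum_add_distrib]
  case vec_smul => simp [repVec, Finset.smul_sum]
  case vecForm_add_left => simp [repVecForm, add_mul, Finset.sum_add_distrib]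
  case vecForm_add_right => simp [repVecForm, mul_add, Finset.sum_add_distrib]
  case vecForm_smul_left => simp [repVecForm, Finset.smul_sum]
  case vecForm_smul_right => simp [repVecForm, ← Finset.smul_sum]
  case formVec_add_left => simp [repFormVec, add_mul, Finset.sum_add_distrib]
  case formVec_add_right => simp [repFormVec, mul_add, Finset.sum_add_distrib]
  case formVec_smul_left => simp [repFormVec, Finset.smul_sum]
  case formVec_smul_right => simp [repFormVec, ← Finset.smul_sum]
  case src_vecForm => exact s_mul_repVecForm R _ _ _
  case vecForm_src => exact repVecForm_mul_s R _ _ _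
  case tgt_vecForm => exact t_mul_repVecForm R _ _ _
  case vecForm_tgt => exact repVecForm_mul_t R _ _ _
  case src_vec => exact s_mul_repVec R _ _
  case vec_src => exact repVec_mul_s R _ _
  case vec_tgt => exact repVec_mul_t R _ _
  case formVec_tgt => exact repFormVec_mul_t R _ _ _
  case tgt_formVec => exact t_mul_repFormVec R _ _ _
  case formVec_src => exact repFormVec_mul_s R _ _ _
  case src_formVec => exact s_mul_repFormVec R _ _ _
  case inv_right => exact sum_repFormVec_mul_repVecForm R _ _
  case inv_left => rw [hP.η_eq, hP.y_eq]; exact sum_repVecForm_mul_repFormVec R _ _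
  case biinv_left => rw [hP.η_eq, hP.y_eq]; exact sum_repVecForm_mul_repFormVec' R _ _
  case biinv_right => exact sum_repFormVec_mul_repVecForm' R _ _

/-- The algebra map from `IIL(Ω)` to a representation of `A^e # H`. -/
noncomputable def liftGhobadi : GhobadiAlgebra D P →ₐ[k] B :=
  RingQuot.liftAlgHom k ⟨FreeAlgebra.lift k (repGen R), fun _ _ h => repGen_rel R h⟩

theorem liftGhobadi_mk (z : GhobadiFree k A Ω 𝔛) :
    liftGhobadi R (GhobadiAlgebra.mk D P z) = FreeAlgebra.lift k (repGen R) z :=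
  RingQuot.liftAlgHom_mkAlgHom_apply k _ _ _

theorem liftGhobadi_src (a : A) : liftGhobadi R (GhobadiAlgebra.src D P a) = R.s a :=
  (liftGhobadi_mk R _).trans (FreeAlgebra.lift_ι_apply _ _)
theorem liftGhobadi_tgt (a : A) : liftGhobadi R (GhobadiAlgebra.tgt D P a) = R.t (op a) :=
  (liftGhobadi_mk R _).trans (FreeAlgebra.lift_ι_apply _ _)
theorem liftGhobadi_vec (x : 𝔛) : liftGhobadi R (GhobadiAlgebra.vec D P x) = repVec R x :=
  (liftGhobadi_mk R _).trans (FreeAlgebra.lift_ι_apply _ _)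
theorem liftGhobadi_vecForm (x : 𝔛) (ξ : Ω) :
    liftGhobadi R (GhobadiAlgebra.vecForm D P x ξ) = repVecForm R x ξ :=
  (liftGhobadi_mk R _).trans (FreeAlgebra.lift_ι_apply _ _)
theorem liftGhobadi_formVec (ξ : Ω) (y : 𝔛) :
    liftGhobadi R (GhobadiAlgebra.formVec D P ξ y) = repFormVec R ξ y :=
  (liftGhobadi_mk R _).trans (FreeAlgebra.lift_ι_apply _ _)

/-- On dual basis elements the expansions defining `repVec`, `repVecForm` and `repFormVec` reduce to
one term, so the images of x_i, t_ij and u_ij are the expected ones. -/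
theorem liftGhobadi_ofHAlg (h : HAlg k I) :
    liftGhobadi R (GhobadiAlgebra.ofHAlg D hP h) = R.j h := by
  have : (liftGhobadi R).comp (GhobadiAlgebra.ofHAlg D hP) = R.j := by
    apply HAlg.algHom_ext
    · intro i
      rw [AlgHom.comp_apply, GhobadiAlgebra.ofHAlg_x, liftGhobadi_vec]
      simp [repVec, hP.evL_x_ω]
    · intro i m
      rw [AlgHom.comp_apply, GhobadiAlgebra.ofHAlg_t, liftGhobadi_vecForm, repVecForm_ω]
      simp [hP.evL_x_ω]
    · intro i m
      rw [AlgHom.comp_apply, GhobadiAlgebra.ofHAlg_u, liftGhobadi_formVec, repFormVec_x]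
      simp [hP.evR_ω_x]
  exact congr($this h)

end PivotalDual.IsDualBasis
end GhobadiPresentation

/-! ### Universality of IIL(Ω), its coproduct and counit -/

section GhobadiUniversal
open Coalgebra HopfAlgebra MulOpposite
variable {k A Ω 𝔛 I : Type*} [Field k] [Ring A] [Algebra k A]
    [AddCommGroup Ω] [Module k Ω] [Module A Ω] [Module Aᵐᵒᵖ Ω] [SMulCommClass A Aᵐᵒᵖ Ω]
    [IsScalarTower k A Ω] [IsScalarTower k Aᵐᵒᵖ Ω]
    [AddCommGroup 𝔛] [Module k 𝔛] [Module A 𝔛] [Module Aᵐᵒᵖ 𝔛] [SMulCommClass A Aᵐᵒᵖ 𝔛]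
    [IsScalarTower k A 𝔛] [IsScalarTower k Aᵐᵒᵖ 𝔛]
    [Fintype I]

/-- Under evaluation j is h ↦ 1 ⊗ 1 ⊗ h, which is injective over a field once k embeds in A.
Nontriviality of A is needed only for this embedding. -/
theorem SmashRep.IsUniversal.j_injective {H : Type*} [Ring H] [HopfAlgebra k H]
    {𝒜 : HopfModuleAlgebra k H A} {L : Type*} [Ring L] [Algebra k L] {R : SmashRep 𝒜 L}
    (hR : R.IsUniversal) [Nontrivial A] : Function.Injective R.j := by
  have inj := (algebraMap k A).injective
  have e : ∀ h, R.j h = R.eval ((1 : A) ⊗ₜ ((1 : A) ⊗ₜ h)) := fun h => by simp [eval_tmul]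
  intro h h' w
  rw [e, e] at w
  exact Algebra.TensorProduct.includeRight_injective (R := k) (A := A) (B := H) inj
    (Algebra.TensorProduct.includeRight_injective (R := k) (A := A) (B := A ⊗[k] H) inj (hR.1 w))

namespace GhobadiAlgebra

theorem algHom_ext {J : Type*} [Fintype J] {D : DifferentialCalculus k A Ω}
    {P : PivotalDual k A Ω 𝔛 I J} {B : Type*} [Ring B] [Algebra k B]
    {f g : GhobadiAlgebra D P →ₐ[k] B} (hs : ∀ a, f (src D P a) = g (src D P a))
    (ht : ∀ a, f (tgt D P a) = g (tgt D P a)) (hv : ∀ x, f (vec D P x) = g (vec D P x))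
    (hvf : ∀ x ξ, f (vecForm D P x ξ) = g (vecForm D P x ξ))
    (hfv : ∀ ξ y, f (formVec D P ξ y) = g (formVec D P ξ y)) : f = g := by
  apply RingQuot.ringQuot_ext'
  ext a
  cases a with
  | src a => exact hs a
  | tgt a => exact ht a
  | vec x => exact hv x
  | vecForm x ξ => exact hvf x ξ
  | formVec ξ y => exact hfv ξ y

variable [DecidableEq I] (D : DifferentialCalculus k A Ω) {P : PivotalDual k A Ω 𝔛 I I} (hP : P.IsDualBasis)

/-- Expanding a generator over the dual bases inside IIL(Ω) gives it back. This and the next two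
lemmas show that passing to A^e # H and returning fixes the generators. -/
theorem repVec_rep (x : 𝔛) : PivotalDual.IsDualBasis.repVec (rep D hP) x = vec D P x := by
  rw [vec_eq_sum]
  simp only [PivotalDual.IsDualBasis.repVec, rep_s, rep_j, ofHAlg_x]

theorem repVecForm_rep (x : 𝔛) (ξ : Ω) :
    PivotalDual.IsDualBasis.repVecForm (rep D hP) x ξ = vecForm D P x ξ := by
  simp only [PivotalDual.IsDualBasis.repVecForm, rep_s, rep_t, rep_j, ofHAlg_t,
    ← vecForm_eq_sum_right D hP, ← vecForm_eq_sum_left]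

theorem repFormVec_rep (ξ : Ω) (y : 𝔛) :
    PivotalDual.IsDualBasis.repFormVec (rep D hP) ξ y = formVec D P ξ y := by
  simp only [PivotalDual.IsDualBasis.repFormVec, rep_s, rep_t, rep_j, ofHAlg_u,
    ← formVec_eq_sum_right, ← formVec_eq_sum_left D hP]

/-- `IIL(Ω)` is isomorphic to `A^e # H`. -/
theorem rep_isUniversal : (rep D hP).IsUniversal := by
  set C := (hP.moduleAlgebra D).cocycleRep
  have hC : C.IsUniversal := (hP.moduleAlgebra D).cocycleRep_isUniversal
  -- Φ uses the universal property of A^e # H, and Θ the presentation of IIL(Ω). Both composites are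
  -- algebra maps that fix generators.
  let Φ := hC.lift (rep D hP)
  let Θ := PivotalDual.IsDualBasis.liftGhobadi C
  have h₁ : Θ.comp Φ = AlgHom.id k _ := hC.algHom_ext
    (fun b => (congr(Θ $(hC.lift_s _ b))).trans (PivotalDual.IsDualBasis.liftGhobadi_src C b))
    (fun h => (congr(Θ $(hC.lift_j _ h))).trans (PivotalDual.IsDualBasis.liftGhobadi_ofHAlg C h))
    (fun b => (congr(Θ $(hC.lift_t _ (op b)))).trans
      (PivotalDual.IsDualBasis.liftGhobadi_tgt C b))
  have h₂ : Φ.comp Θ = AlgHom.id k _ := algHom_ext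
    (fun a => by
      rw [AlgHom.comp_apply, PivotalDual.IsDualBasis.liftGhobadi_src]
      exact hC.lift_s _ a)
    (fun a => by
      rw [AlgHom.comp_apply, PivotalDual.IsDualBasis.liftGhobadi_tgt]
      exact hC.lift_t _ _)
    (fun x => by
      rw [AlgHom.comp_apply, PivotalDual.IsDualBasis.liftGhobadi_vec]
      refine Eq.trans ?_ (repVec_rep D hP x)
      simp [PivotalDual.IsDualBasis.repVec, Φ])
    (fun x ξ => by
      rw [AlgHom.comp_apply, PivotalDual.IsDualBasis.liftGhobadi_vecForm]
      refine Eq.trans ?_ (repVecForm_rep D hP x ξ)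
      simp [PivotalDual.IsDualBasis.repVecForm, Φ])
    (fun ξ y => by
      rw [AlgHom.comp_apply, PivotalDual.IsDualBasis.liftGhobadi_formVec]
      refine Eq.trans ?_ (repFormVec_rep D hP ξ y)
      simp [PivotalDual.IsDualBasis.repFormVec, Φ])
  -- Evaluation in IIL(Ω) factors through evaluation in A^e # H, which is bijective.
  have e : ⇑(rep D hP).eval = Φ ∘ C.eval := funext fun z => (hC.lift_eval _ z).symm
  have hΦ : Function.Bijective Φ :=
    Function.bijective_iff_has_inverse.2 ⟨Θ, fun x => congr($h₁ x), fun x => congr($h₂ x)⟩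
  rw [SmashRep.IsUniversal, e]
  exact hΦ.comp hC

theorem comulAlgHom_src (a : A) :
    (rep_isUniversal D hP).comulAlgHom (src D P a) = src D P a ⊗ₜ 1 :=
  (rep_isUniversal D hP).comulAlgHom_s a
theorem comulAlgHom_tgt (a : A) :
    (rep_isUniversal D hP).comulAlgHom (tgt D P a) = 1 ⊗ₜ tgt D P a :=
  (rep_isUniversal D hP).comulAlgHom_t (op a)

/-- For x_i this is the coproduct of H transported by j. A general x is a combination of the x_i
with left coefficients in A, and these enter the first leg only, where the expansion can be folded
back. For (x, ξ) and (ξ, y) the target coefficients are folded into the second leg likewise. -/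
theorem comulAlgHom_vec (x : 𝔛) : (rep_isUniversal D hP).comulAlgHom (vec D P x) =
    vec D P x ⊗ₜ 1 + ∑ l, vecForm D P x (P.ω l) ⊗ₜ vec D P (P.x l) := by
  have (i : I) : (rep_isUniversal D hP).comulAlgHom (vec D P (P.x i)) =
      vec D P (P.x i) ⊗ₜ 1 + ∑ l, vecForm D P (P.x i) (P.ω l) ⊗ₜ vec D P (P.x l) := by
    rw [← ofHAlg_x D hP, ← rep_j, (rep_isUniversal D hP).comulAlgHom_j,
      HAlg.sweedler_x _ _ (by intros; fun_prop) (by intros; fun_prop)]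
    simp [rep_j, ofHAlg_x, ofHAlg_t]
  conv_lhs => rw [vec_eq_sum]
  simp only [map_sum, map_mul, comulAlgHom_src, this, mul_add, Finset.mul_sum,
    Finset.sum_add_distrib, Algebra.TensorProduct.tmul_mul_tmul, one_mul]
  rw [Finset.sum_comm]
  simp only [← TensorProduct.sum_tmul, ← vec_eq_sum, ← vecForm_eq_sum_left]

theorem comulAlgHom_vecForm (x : 𝔛) (ξ : Ω) :
    (rep_isUniversal D hP).comulAlgHom (vecForm D P x ξ) =
      ∑ l, vecForm D P x (P.ω l) ⊗ₜ vecForm D P (P.x l) ξ := by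
  have (i m : I) : (rep_isUniversal D hP).comulAlgHom (vecForm D P (P.x i) (P.ω m)) =
      ∑ l, vecForm D P (P.x i) (P.ω l) ⊗ₜ vecForm D P (P.x l) (P.ω m) := by
    rw [← ofHAlg_t D hP, ← rep_j, (rep_isUniversal D hP).comulAlgHom_j,
      HAlg.sweedler_t _ _ _ (by intros; fun_prop) (by intros; fun_prop)]
    simp [rep_j, ofHAlg_t]
  have (i : I) : (rep_isUniversal D hP).comulAlgHom (vecForm D P (P.x i) ξ) =
      ∑ l, vecForm D P (P.x i) (P.ω l) ⊗ₜ vecForm D P (P.x l) ξ := by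
    conv_lhs => rw [vecForm_eq_sum_right D hP]
    simp only [map_sum, map_mul, comulAlgHom_tgt, this, Finset.sum_mul,
      Algebra.TensorProduct.tmul_mul_tmul, mul_one]
    rw [Finset.sum_comm]
    simp only [← TensorProduct.tmul_sum, ← vecForm_eq_sum_right D hP]
  conv_lhs => rw [vecForm_eq_sum_left]
  simp only [map_sum, map_mul, comulAlgHom_src, this, Finset.mul_sum,
    Algebra.TensorProduct.tmul_mul_tmul, one_mul]
  rw [Finset.sum_comm]
  simp only [← TensorProduct.sum_tmul, ← vecForm_eq_sum_left]

theorem comulAlgHom_formVec (ξ : Ω) (y : 𝔛) :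
    (rep_isUniversal D hP).comulAlgHom (formVec D P ξ y) =
      ∑ l, formVec D P ξ (P.x l) ⊗ₜ formVec D P (P.ω l) y := by
  have (i m : I) : (rep_isUniversal D hP).comulAlgHom (formVec D P (P.ω i) (P.x m)) =
      ∑ l, formVec D P (P.ω i) (P.x l) ⊗ₜ formVec D P (P.ω l) (P.x m) := by
    rw [← ofHAlg_u D hP, ← rep_j, (rep_isUniversal D hP).comulAlgHom_j,
      HAlg.sweedler_u _ _ _ (by intros; fun_prop) (by intros; fun_prop)]
    simp [rep_j, ofHAlg_u]
  have (i : I) : (rep_isUniversal D hP).comulAlgHom (formVec D P (P.ω i) y) =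
      ∑ l, formVec D P (P.ω i) (P.x l) ⊗ₜ formVec D P (P.ω l) y := by
    conv_lhs => rw [formVec_eq_sum_right]
    simp only [map_sum, map_mul, comulAlgHom_tgt, this, Finset.sum_mul,
      Algebra.TensorProduct.tmul_mul_tmul, mul_one]
    rw [Finset.sum_comm]
    simp only [← TensorProduct.tmul_sum, ← formVec_eq_sum_right]
  conv_lhs => rw [formVec_eq_sum_left D hP]
  simp only [map_sum, map_mul, comulAlgHom_src, this, Finset.mul_sum,
    Algebra.TensorProduct.tmul_mul_tmul, one_mul]
  rw [Finset.sum_comm]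
  simp only [← TensorProduct.sum_tmul, ← formVec_eq_sum_left D hP]

theorem action_src (a b : A) : (rep_isUniversal D hP).action (src D P a) b = a * b :=
  (rep_isUniversal D hP).action_s a b
theorem action_tgt (a b : A) : (rep_isUniversal D hP).action (tgt D P a) b = b * a :=
  (rep_isUniversal D hP).action_t (op a) b
theorem action_ofHAlg (h : HAlg k I) (b : A) :
    (rep_isUniversal D hP).action (ofHAlg D hP h) b = (hP.moduleAlgebra D).act h b :=
  (rep_isUniversal D hP).action_j h b

/-- With the two lemmas that follow, this describes the action of IIL(Ω) on A without bases;
evaluating at b = 1 gives the prescribed counit. -/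
theorem action_vec (x : 𝔛) (b : A) :
    (rep_isUniversal D hP).action (vec D P x) b = P.evL x (D.d b) := by
  rw [vec_eq_sum]
  simp only [map_sum, map_mul, ← ofHAlg_x D hP, LinearMap.sum_apply, Module.End.mul_apply,
    action_src, action_ofHAlg, hP.act_x, PivotalDual.sum_evL_mul_evL]

theorem action_vecForm (x : 𝔛) (ξ : Ω) (b : A) :
    (rep_isUniversal D hP).action (vecForm D P x ξ) b = P.evL x (b • ξ) := by
  rw [vecForm_eq_sum_left]
  simp only [vecForm_eq_sum_right D hP _ ξ]
  simp only [map_sum, map_mul, ← ofHAlg_t D hP, LinearMap.sum_apply, Module.End.mul_apply,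
    action_src, action_tgt, action_ofHAlg, hP.act_t, mul_smul]
  simp only [← Finset.mul_sum, ← map_sum, ← Finset.smul_sum, hP.sum_evR_smul, PivotalDual.sum_evL_mul_evL]

theorem action_formVec (ξ : Ω) (y : 𝔛) (b : A) :
    (rep_isUniversal D hP).action (formVec D P ξ y) b = P.evR ξ (b • y) := by
  rw [formVec_eq_sum_left D hP]
  simp only [formVec_eq_sum_right D P _ y]
  simp only [map_sum, map_mul, ← ofHAlg_u D hP, LinearMap.sum_apply, Module.End.mul_apply,
    action_src, action_tgt, action_ofHAlg, hP.act_u, mul_smul]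
  simp only [← Finset.mul_sum, ← map_sum, ← Finset.smul_sum, P.coevL_𝔛, hP.sum_evR_mul_evR]

theorem isGhobadi : IsGhobadi D P (rep_isUniversal D hP).leftBialgebroid where
  s_eq _ := rfl
  t_eq _ := rfl
  comul_vec x := congr(takeuchiMk (rep D hP).s (rep D hP).t $(comulAlgHom_vec D hP x))
  comul_vecForm x ξ :=
    congr(takeuchiMk (rep D hP).s (rep D hP).t $(comulAlgHom_vecForm D hP x ξ))
  comul_formVec ξ y := by
    rw [hP.η_eq, hP.y_eq]
    exact congr(takeuchiMk (rep D hP).s (rep D hP).t $(comulAlgHom_formVec D hP ξ y))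
  counit_vec x := by
    have : D.d 1 = 0 := by simpa using D.leibniz 1 1
    exact (action_vec D hP x 1).trans (by rw [this, map_zero])
  counit_vecForm x ξ := (action_vecForm D hP x ξ 1).trans (by rw [one_smul])
  counit_formVec ξ y := (action_formVec D hP ξ y 1).trans (by rw [one_smul])

end GhobadiAlgebra
end GhobadiUniversal

theorem proposition5p14 {k A Ω 𝔛 I : Type*} [Field k] [Ring A] [Algebra k A]
    [AddCommGroup Ω] [Module k Ω] [Module A Ω] [Module Aᵐᵒᵖ Ω] [SMulCommClass A Aᵐᵒᵖ Ω]
    [IsScalarTower k A Ω] [IsScalarTower k Aᵐᵒᵖ Ω]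
    [AddCommGroup 𝔛] [Module k 𝔛] [Module A 𝔛] [Module Aᵐᵒᵖ 𝔛] [SMulCommClass A Aᵐᵒᵖ 𝔛]
    [IsScalarTower k A 𝔛] [IsScalarTower k Aᵐᵒᵖ 𝔛]
    [Fintype I] [DecidableEq I]
    -- the calculus, with a joint left and right basis `ω_i`
    (D : DifferentialCalculus k A Ω) (bL : Module.Basis I A Ω) (bR : Module.Basis I Aᵐᵒᵖ Ω)
    -- the pivotal structure, with `coevL = ∑ ω_i ⊗ x_i` and `coevR = ∑ x_i ⊗ ω_i`
    (P : PivotalDual k A Ω 𝔛 I I) (hL : ⇑bL = P.ω) (hR : ⇑bR = P.ω) (hη : P.η = P.ω)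
    (hy : P.y = P.x) :
    -- the Hopf algebra structure of `H`
    ((∀ i : I, Coalgebra.comul (R := k) (HAlg.x k i) =
        HAlg.x k i ⊗ₜ[k] 1 + ∑ j, HAlg.t k i j ⊗ₜ[k] HAlg.x k j) ∧
      (∀ i j : I, Coalgebra.comul (R := k) (HAlg.t k i j) =
        ∑ m, HAlg.t k i m ⊗ₜ[k] HAlg.t k m j) ∧
      (∀ i j : I, Coalgebra.comul (R := k) (HAlg.u k i j) =
        ∑ m, HAlg.u k i m ⊗ₜ[k] HAlg.u k m j) ∧
      (∀ i : I, Coalgebra.counit (R := k) (HAlg.x k i) = 0) ∧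
      (∀ i j : I, Coalgebra.counit (R := k) (HAlg.t k i j) = if i = j then 1 else 0) ∧
      (∀ i j : I, Coalgebra.counit (R := k) (HAlg.u k i j) = if i = j then 1 else 0) ∧
      (∀ i : I, HopfAlgebra.antipode k (HAlg.x k i) = -∑ j, HAlg.u k j i * HAlg.x k j) ∧
      (∀ i j : I, HopfAlgebra.antipode k (HAlg.t k i j) = HAlg.u k j i) ∧
      (∀ i j : I, HopfAlgebra.antipode k (HAlg.u k i j) = HAlg.t k j i)) ∧
    -- the module algebra structure of `A`
    ∃ 𝒜 : HopfModuleAlgebra k (HAlg k I) A,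
      (∀ i f, 𝒜.act (HAlg.x k i) f = D.rightPartial bR i f) ∧
      (∀ i j f, 𝒜.act (HAlg.t k i j) f = commutationOpInv bR i j f) ∧
      (∀ i j f, 𝒜.act (HAlg.u k i j) f = commutationOp bL j i f) ∧
    -- `IIL(Ω)` is a Hopf algebroid
    ∃ 𝓑 : LeftBialgebroid k A (GhobadiAlgebra D P),
      GhobadiAlgebra.IsGhobadi D P 𝓑 ∧ 𝓑.IsLeftHopf ∧
    -- `H` is a subalgebra of `IIL(Ω)`
    ∃ j : HAlg k I →ₐ[k] GhobadiAlgebra D P,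
      (∀ i, j (HAlg.x k i) = GhobadiAlgebra.vec D P (P.x i)) ∧
      (∀ i m, j (HAlg.t k i m) = GhobadiAlgebra.vecForm D P (P.x i) (P.ω m)) ∧
      (∀ i m, j (HAlg.u k i m) = GhobadiAlgebra.formVec D P (P.ω i) (P.x m)) ∧
      (Nontrivial A → Function.Injective j) ∧
    -- `A^e # H` is a Hopf algebroid isomorphic to `IIL(Ω)`
    ∃ 𝓢 : LeftBialgebroid k A 𝒜.CocycleSmash,
      𝒜.IsCocycleBialgebroid 𝓢 ∧ 𝓢.IsLeftHopf ∧
      (∃ Φ : 𝒜.CocycleSmash ≃ₐ[k] GhobadiAlgebra D P, 𝓢.IsIso 𝓑 Φ ∧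
        ∀ b b' h, Φ (HopfModuleAlgebra.CocycleSmash.tmul 𝒜 b b' h) =
          GhobadiAlgebra.src D P b * j h * GhobadiAlgebra.tgt D P b') ∧
    -- `A^e # H` is isomorphic to the Ehresmann-Schauenburg Hopf algebroid `L(A # H, H)`
    ∃ 𝒞 : ComoduleAlgebra k (HAlg k I) 𝒜.SmashProduct,
      (∀ (a : A) (h : HAlg k I) (ι : Type) (r : Coalgebra.Repr k h ι),
        𝒞.coact (HopfModuleAlgebra.SmashProduct.tmul 𝒜 a h) =
          ∑ i ∈ r.index, HopfModuleAlgebra.SmashProduct.tmul 𝒜 a (r.left i) ⊗ₜ[k] r.right i) ∧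
    ∃ ι : A →ₐ[k] 𝒜.SmashProduct,
      (∀ a, ι a = HopfModuleAlgebra.SmashProduct.tmul 𝒜 a 1) ∧ IsLeftFaithfullyFlat ι ∧
    ∃ G : HopfGaloisExtension 𝒞 ι,
    ∃ 𝓔 : LeftBialgebroid k A 𝒞.EhresmannAlgebra,
      G.IsEhresmannSchauenburg 𝓔 ∧ 𝓔.IsLeftHopf ∧
      ∃ Ψ : 𝒜.CocycleSmash ≃ₐ[k] 𝒞.EhresmannAlgebra, 𝓢.IsIso 𝓔 Ψ := by
  have hP : P.IsDualBasis := PivotalDual.isDualBasis bL bR hL hR hη hy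
  have hU := GhobadiAlgebra.rep_isUniversal D hP
  have hE := (hP.moduleAlgebra D).ehresmannRep_isUniversal
  refine ⟨⟨HAlg.comulHom_x, HAlg.comulHom_t, HAlg.comulHom_u, HAlg.counit_x, HAlg.counit_t,
    HAlg.counit_u, HAlg.antipode_x, HAlg.antipode_t, HAlg.antipode_u⟩, hP.moduleAlgebra D,
    fun i f => ?_, fun i j f => ?_, fun i j f => ?_, hU.leftBialgebroid,
    GhobadiAlgebra.isGhobadi D hP, hU.isLeftHopf, GhobadiAlgebra.ofHAlg D hP,
    GhobadiAlgebra.ofHAlg_x D hP, GhobadiAlgebra.ofHAlg_t D hP, GhobadiAlgebra.ofHAlg_u D hP,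
    fun _ => hU.j_injective, (hP.moduleAlgebra D).cocycleBialgebroid,
    (hP.moduleAlgebra D).isCocycleBialgebroid, (hP.moduleAlgebra D).cocycleRep_isUniversal.isLeftHopf,
    ⟨HopfModuleAlgebra.cocycleEquiv hU, HopfModuleAlgebra.cocycleEquiv_isIso hU,
      HopfModuleAlgebra.cocycleEquiv_tmul hU⟩,
    (hP.moduleAlgebra D).smashComodule, fun a h ι r => ?_, (hP.moduleAlgebra D).smashRep.s,
    fun _ => rfl, (hP.moduleAlgebra D).smash_faithfullyFlat, (hP.moduleAlgebra D).smashGalois,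
    (hP.moduleAlgebra D).ehresmannBialgebroid, (hP.moduleAlgebra D).isEhresmannSchauenburg,
    hE.isLeftHopf, HopfModuleAlgebra.cocycleEquiv hE, HopfModuleAlgebra.cocycleEquiv_isIso hE⟩
  · rw [hP.act_x, DifferentialCalculus.rightPartial, PivotalDual.repr_right_eq bR hR]
  · rw [hP.act_t, commutationOpInv, PivotalDual.repr_right_eq bR hR, hR]
  -- By balancing, evR(ω_i, f x_j) = evR(ω_i f, x_j) is the coefficient of ω_j in ω_i f, which
  -- explains the transposed indices.
  · rw [hP.act_u, commutationOp, PivotalDual.repr_left_eq bL hL hη hy, hL, P.evR_balanced]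
  · rw [(hP.moduleAlgebra D).smashComodule_coact,
      sweedler_eq_sum h r _ (by intros; fun_prop) (by intros; fun_prop)]
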